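/- Let $(a,b)$, $-\infty\le a<b\le\infty$, be an open interval and let $\varrho,\varsigma,\chi$ be locally finite Borel measures on $(a,b)$ (finite on compact subsets) such that $\varrho$ is real-valued (signed), $\varsigma$ is positive with support all of $(a,b)$, $\chi$ is positive and not identically zero, and $\varsigma(\{x\})\chi(\{x\})=\varsigma(\{x\})\varrho(\{x\})=0$ for all $x\in(a,b)$. Integrals $\int_c^x$ are taken over $[c,x)$ if $c<x$, and are minus the integral over $[x,c)$ if $x<c$. For a measure $\mu$, let $AC_{\mathrm{loc}}((a,b);\mu)$ be the set of functions $f(x)=f(c)+\int_c^x h\,d\mu$ with $h\in L^1_{\mathrm{loc}}((a,b);\mu)$, and write $df/d\mu=h$. Consider the expression $\tau f=\frac{d}{d\varrho}\bigl(-\frac{df}{d\varsigma}+\int f\,d\chi\bigr)$, defined for those $f\in AC_{\mathrm{loc}}((a,b);\varsigma)$ for which $-\frac{df}{d\varsigma}+\int_c^{\cdot} f\,d\chi$ has a (necessarily unique) representative in $AC_{\mathrm{loc}}((a,b);\varrho)$; the corresponding representative of $df/d\varsigma$ is denoted by $f^{[1]}$. Let $H^1(a,b)$ be the Hilbert space of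 all $f\in AC_{\mathrm{loc}}((a,b);\varsigma)$ with $\|f\|^2=\int|f|^2d\chi+\int|df/d\varsigma|^2d\varsigma<\infty$; $f$ is said to lie in $H^1(a,b)$ near an endpoint if the integrals are finite near this endpoint. Let $T_{\mathrm{loc}}$ be the set of pairs $(f,f_\tau)$ in $AC_{\mathrm{loc}}((a,b);\varsigma)$ with $\tau f=f_\tau$ in $L^1_{\mathrm{loc}}((a,b);\varrho)$, and let $T_{\max}=T_{\mathrm{loc}}\cap(H^1(a,b)\times H^1(a,b))$. For pairs $f,g\in T_{\mathrm{loc}}$ put $V(f,g)=f_\tau g^{[1]}-f^{[1]}g_\tau$, a function on $(a,b)$, whose values at $a$ and $b$ are understood as limits; ${}^*$ denotes complex conjugation. A solution $u$ of $(\tau-z)u=0$ is identified with the pair $(u,zu)$. The limit-circle case prevails at an endpoint if for every $z\in\mathbb C\setminus\{0\}$ all solutions of $(\tau-z)u=0$ lie in $H^1(a,b)$ near this endpoint. Let $v_a,v_b\in T_{\max}$ be such that, if the limit-circle case prevails at $a$, then $V(v_a,v_a^*)(a)=0$ and $V(f,v_a^*)(a)\ne0$ for some $f\in T_{\max}$,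 and, if it prevails at $b$, then $V(v_b,v_b^*)(b)=0$ and $V(f,v_b^*)(b)\neq0$ for some $f\in T_{\max}$. Let $$S=\{f\in T_{\max} : V(f,v_a^*)(a)=V(f,v_b^*)(b)=0\}$$ be the corresponding self-adjoint linear relation in $H^1(a,b)$ with separated boundary conditions, with resolvent set $\rho(S)=\{z\in\mathbb C : (S-z)^{-1}\text{ is an everywhere defined bounded operator on }H^1(a,b)\}$, and put $\rho(S)^\times=\rho(S)\setminus\{0\}$. A pair $f\in T_{\mathrm{loc}}$ lies in $S$ near an endpoint if $f$ and $f_\tau$ lie in $H^1(a,b)$ near this endpoint and, in the limit-circle case there, $f$ satisfies the boundary condition of $S$ at this endpoint. Let $\theta_z,\phi_z$, $z\in\mathbb C\setminus\{0\}$, be solutions of $(\tau-z)u=0$ such that $\phi_z$ is non-trivial and lies in $S$ near $a$, $V(\theta_z,\phi_z)=1$, and for each $c\in(a,b)$ the functions $z\mapsto\phi_z(c)$, $\phi_z^{[1]}(c)$, $\theta_z(c)$, $\theta_z^{[1]}(c)$ are analytic on $\mathbb C\setminus\{0\}$ with at most a pole at zero, and real, i.e. they satisfy $F(z^*)=F(z)^*$.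 Then for each $z\in\rho(S)^\times$ there is a unique $M(z)\in\mathbb C$ such that $\psi_z=\theta_z+M(z)\phi_z$ lies in $S$ near $b$. The resulting function $M$ (the singular Weyl--Titchmarsh function) is analytic on $\rho(S)^\times$, the set $\rho(S)^\times$ is invariant under complex conjugation, and $$M(z)=M(z^*)^*,\qquad z\in\rho(S)^\times .$$ -/

import Mathlib

open MeasureTheory Filter Topology Set
open scoped ComplexConjugate

noncomputable section

namespace LeftDefinite

/-- The open interval `(a, b)` with possibly infinite endpoints, as a type. In the order of this
type, `x → a` is the filter `atBot` and `x → b` is the filter `atTop`. -/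
abbrev Interval (a b : EReal) : Type := {x : ℝ // a < (x : EReal) ∧ (x : EReal) < b}

/-- A real-valued Borel measure whose total variation is finite on compact sets (but possibly
infinite on the whole space), given by its Jordan decomposition. -/
structure RealMeasure (X : Type*) [TopologicalSpace X] [MeasurableSpace X] where
  pos : Measure X
  neg : Measure X
  pos_locallyFinite : IsLocallyFiniteMeasure pos
  neg_locallyFinite : IsLocallyFiniteMeasure neg
  mutuallySingular : pos ⟂ₘ neg

/-- The total variation measure. -/
def RealMeasure.variation {X : Type*} [TopologicalSpace X] [MeasurableSpace X]
    (ν : RealMeasure X) : Measure X := ν.pos + ν.neg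

section AbsolutelyContinuous

variable {a b : EReal}

/-- `∫_c^x h dμ`: the integral over `[c, x)` if `c < x`, minus the integral over `[x, c)` if
`x < c`, and `0` if `x = c`. -/
def stieltjesIntegral (μ : Measure (Interval a b)) (h : Interval a b → ℂ)
    (c x : Interval a b) : ℂ :=
  (∫ s in Ico c x, h s ∂μ) - ∫ s in Ico x c, h s ∂μ

/-- `f ∈ AC_loc((a,b); μ)` with Radon-Nikodym derivative `df/dμ = h ∈ L¹_loc((a,b); μ)`. -/
def HasRNDeriv (μ : Measure (Interval a b)) (f h : Interval a b → ℂ) : Prop :=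
  LocallyIntegrable h μ ∧ ∀ c x, f x = f c + stieltjesIntegral μ h c x

/-- `f ∈ AC_loc((a,b); ν)` with Radon-Nikodym derivative `df/dν = h ∈ L¹_loc((a,b); ν)`, for a
real-valued measure `ν`. -/
def HasRNDerivReal (ν : RealMeasure (Interval a b)) (f h : Interval a b → ℂ) : Prop :=
  LocallyIntegrable h ν.variation ∧
    ∀ c x, f x = f c + (stieltjesIntegral ν.pos h c x - stieltjesIntegral ν.neg h c x)

/-- The set `AC_loc((a,b); μ)`. -/
def ACloc (μ : Measure (Interval a b)) : Set (Interval a b → ℂ) :=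
  {f | ∃ h, HasRNDeriv μ f h}

open Classical in
/-- A representative of `df/dμ` for `f ∈ AC_loc((a,b); μ)`; it is unique up to `μ`-null sets. -/
def rnDeriv (μ : Measure (Interval a b)) (f : Interval a b → ℂ) : Interval a b → ℂ :=
  if h : ∃ g, HasRNDeriv μ f g then h.choose else 0

end AbsolutelyContinuous

/-- The coefficients of a left-definite Sturm-Liouville expression
`τ f = d/dϱ (-df/dς + ∫ f dχ)` on `(a, b)`, where `rho`, `sigma`, `chi` stand for `ϱ`, `ς`, `χ`. -/
structure Coefficients (a b : EReal) where
  rho : RealMeasure (Interval a b)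
  sigma : Measure (Interval a b)
  chi : Measure (Interval a b)
  sigma_locallyFinite : IsLocallyFiniteMeasure sigma
  chi_locallyFinite : IsLocallyFiniteMeasure chi
  sigma_support : ∀ U : Set (Interval a b), IsOpen U → U.Nonempty → sigma U ≠ 0
  chi_ne_zero : chi ≠ 0
  sigma_chi : ∀ x, sigma {x} * chi {x} = 0
  sigma_rho : ∀ x, sigma {x} * rho.variation {x} = 0

namespace Coefficients

variable {a b : EReal} (τ : Coefficients a b)

/-- `f` lies in the maximal domain of `τ`, the function `q` is the representative of `df/dς` for
which `-q + ∫_c^x f dχ` lies in `AC_loc((a,b); ϱ)`, and `τ f = g` in `L¹_loc((a,b); ϱ)`. -/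
def IsTau (f q g : Interval a b → ℂ) : Prop :=
  HasRNDeriv τ.sigma f q ∧
    ∀ c, HasRNDerivReal τ.rho (fun x => -q x + stieltjesIntegral τ.chi f c x) g

open Classical in
/-- The quasi-derivative `f^{[1]}` of a function in the maximal domain of `τ`, i.e. the unique
representative of `df/dς` described in `IsTau`. -/
def quasiDeriv (f : Interval a b → ℂ) : Interval a b → ℂ :=
  if h : ∃ q, ∃ g, τ.IsTau f q g then h.choose else 0

/-- The relation `T_loc` of all pairs `(f, f_τ)` in `AC_loc((a,b); ς)` with `τ f = f_τ`. -/
def Tloc : Set ((Interval a b → ℂ) × (Interval a b → ℂ)) :=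
  {p | p.1 ∈ ACloc τ.sigma ∧ p.2 ∈ ACloc τ.sigma ∧ ∃ q, τ.IsTau p.1 q p.2}

/-- `u` is a solution of `(τ - z) u = 0`. -/
def IsSolution (z : ℂ) (u : Interval a b → ℂ) : Prop := ∃ q, τ.IsTau u q (z • u)

/-- The modified Wronskian `V(f, g) = f_τ g^{[1]} - f^{[1]} g_τ` of two pairs. The function
`V(f, g^*)` is `τ.V f (star g)`, with the pointwise complex conjugate of both components. -/
def V (f g : (Interval a b → ℂ) × (Interval a b → ℂ)) (x : Interval a b) : ℂ :=
  f.2 x * τ.quasiDeriv g.1 x - τ.quasiDeriv f.1 x * g.2 x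

/-- The modified Sobolev space `H¹(a,b)`. -/
def H1 : Set (Interval a b → ℂ) :=
  {f | f ∈ ACloc τ.sigma ∧ MemLp f 2 τ.chi ∧ MemLp (rnDeriv τ.sigma f) 2 τ.sigma}

/-- The norm of `H¹(a,b)`. -/
def normH1 (f : Interval a b → ℂ) : ℝ :=
  Real.sqrt ((∫ x, ‖f x‖ ^ 2 ∂τ.chi) + ∫ x, ‖rnDeriv τ.sigma f x‖ ^ 2 ∂τ.sigma)

/-- `f` lies in `H¹(a,b)` near `a`. -/
def H1NearLeft (f : Interval a b → ℂ) : Prop :=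
  f ∈ ACloc τ.sigma ∧ ∃ c, MemLp f 2 (τ.chi.restrict (Iio c)) ∧
    MemLp (rnDeriv τ.sigma f) 2 (τ.sigma.restrict (Iio c))

/-- `f` lies in `H¹(a,b)` near `b`. -/
def H1NearRight (f : Interval a b → ℂ) : Prop :=
  f ∈ ACloc τ.sigma ∧ ∃ c, MemLp f 2 (τ.chi.restrict (Ici c)) ∧
    MemLp (rnDeriv τ.sigma f) 2 (τ.sigma.restrict (Ici c))

/-- The maximal relation `T_max` in `H¹(a,b)`. -/
def Tmax : Set ((Interval a b → ℂ) × (Interval a b → ℂ)) :=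
  {p | p.1 ∈ τ.H1 ∧ p.2 ∈ τ.H1 ∧ p ∈ τ.Tloc}

/-- `τ` is in the limit-circle case at `a`. -/
def LimitCircleLeft : Prop :=
  ∀ z : ℂ, z ≠ 0 → ∀ u, τ.IsSolution z u → τ.H1NearLeft u

/-- `τ` is in the limit-circle case at `b`. -/
def LimitCircleRight : Prop :=
  ∀ z : ℂ, z ≠ 0 → ∀ u, τ.IsSolution z u → τ.H1NearRight u

/-- The pair `v_a ∈ T_max` defines a self-adjoint boundary condition at `a`, if `τ` is in the
limit-circle case there: `V(v_a, v_a^*)(a) = 0` and `V(f, v_a^*)(a) ≠ 0` for some `f ∈ T_max`. -/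
def IsBoundaryLeft (v : (Interval a b → ℂ) × (Interval a b → ℂ)) : Prop :=
  v ∈ τ.Tmax ∧ (τ.LimitCircleLeft →
    Tendsto (τ.V v (star v)) atBot (𝓝 0) ∧
      ∃ f ∈ τ.Tmax, ∃ l : ℂ, l ≠ 0 ∧ Tendsto (τ.V f (star v)) atBot (𝓝 l))

/-- The corresponding notion at `b`. -/
def IsBoundaryRight (v : (Interval a b → ℂ) × (Interval a b → ℂ)) : Prop :=
  v ∈ τ.Tmax ∧ (τ.LimitCircleRight →
    Tendsto (τ.V v (star v)) atTop (𝓝 0) ∧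
      ∃ f ∈ τ.Tmax, ∃ l : ℂ, l ≠ 0 ∧ Tendsto (τ.V f (star v)) atTop (𝓝 l))

/-- The restriction `S = {f ∈ T_max | V(f, v_a^*)(a) = V(f, v_b^*)(b) = 0}` of `T_max` with
separated boundary conditions. -/
def sepRelation (va vb : (Interval a b → ℂ) × (Interval a b → ℂ)) :
    Set ((Interval a b → ℂ) × (Interval a b → ℂ)) :=
  {f | f ∈ τ.Tmax ∧ Tendsto (τ.V f (star va)) atBot (𝓝 0) ∧
    Tendsto (τ.V f (star vb)) atTop (𝓝 0)}

/-- The resolvent set of a linear relation `S` in `H¹(a,b)`: all `z` for which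
`(S - z)⁻¹ = {(g, f) | (f, g + z f) ∈ S}` is an everywhere defined bounded operator. -/
def resolventSet (S : Set ((Interval a b → ℂ) × (Interval a b → ℂ))) : Set ℂ :=
  {z | (∀ g ∈ τ.H1, ∃! f, f ∈ τ.H1 ∧ (f, g + z • f) ∈ S) ∧
    ∃ C : ℝ, ∀ g ∈ τ.H1, ∀ f ∈ τ.H1, (f, g + z • f) ∈ S → τ.normH1 f ≤ C * τ.normH1 g}

/-- A pair `f ∈ T_loc` lies in `S` near `a`: it lies in `T_max` near `a` and satisfies the boundary
condition at `a` if `τ` is in the limit-circle case there. -/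
def InSNearLeft (va f : (Interval a b → ℂ) × (Interval a b → ℂ)) : Prop :=
  f ∈ τ.Tloc ∧ τ.H1NearLeft f.1 ∧ τ.H1NearLeft f.2 ∧
    (τ.LimitCircleLeft → Tendsto (τ.V f (star va)) atBot (𝓝 0))

/-- A pair `f ∈ T_loc` lies in `S` near `b`. -/
def InSNearRight (vb f : (Interval a b → ℂ) × (Interval a b → ℂ)) : Prop :=
  f ∈ τ.Tloc ∧ τ.H1NearRight f.1 ∧ τ.H1NearRight f.2 ∧
    (τ.LimitCircleRight → Tendsto (τ.V f (star vb)) atTop (𝓝 0))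

/-- `F` is analytic on `ℂ \ {0}`, has at most a pole at zero, and is real: `F(z^*) = F(z)^*`. The
value of `F` at zero plays no role. -/
def RealAnalyticAwayZero (F : ℂ → ℂ) : Prop :=
  AnalyticOnNhd ℂ F {0}ᶜ ∧ MeromorphicAt F 0 ∧ ∀ z, z ≠ 0 → F (conj z) = conj (F z)

/-- `u_z`, `z ≠ 0`, is a real analytic family of solutions of `(τ - z) u = 0`. -/
def IsRealAnalyticSolution (u : ℂ → Interval a b → ℂ) : Prop :=
  (∀ z, z ≠ 0 → τ.IsSolution z (u z)) ∧
    ∀ c, RealAnalyticAwayZero (fun z => u z c) ∧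
      RealAnalyticAwayZero (fun z => τ.quasiDeriv (u z) c)

/-- `θ_z`, `φ_z`, `z ≠ 0`, is a real analytic fundamental system of `(τ - z) u = 0` such that
`φ_z` is non-trivial and lies in `S` near `a`, and `V(θ_z, φ_z) = 1`. Here a solution `u` of
`(τ - z) u = 0` is identified with the pair `(u, z u)`. -/
structure IsFundamentalSystem (va : (Interval a b → ℂ) × (Interval a b → ℂ))
    (θ φ : ℂ → Interval a b → ℂ) : Prop where
  φ_analytic : τ.IsRealAnalyticSolution φ
  φ_ne_zero : ∀ z, z ≠ 0 → φ z ≠ 0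
  φ_left : ∀ z, z ≠ 0 → τ.InSNearLeft va (φ z, z • φ z)
  θ_analytic : τ.IsRealAnalyticSolution θ
  wronskian : ∀ z, z ≠ 0 → ∀ x, τ.V (θ z, z • θ z) (φ z, z • φ z) x = 1

/-- The defining property of the value `m = M(z)` of the singular Weyl-Titchmarsh function: the
solution `ψ_z = θ_z + m φ_z` lies in `S` near `b`. -/
def IsWeylValue (vb : (Interval a b → ℂ) × (Interval a b → ℂ))
    (θ φ : ℂ → Interval a b → ℂ) (z m : ℂ) : Prop :=
  τ.InSNearRight vb (θ z + m • φ z, z • (θ z + m • φ z))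

end Coefficients

end LeftDefinite

end

/-! Near each end everything is governed by the form `V`, which at a point is the 2×2 determinant of
the vectors `(f_τ, f^{[1]})`. The Lagrange identity writes its increments as integrals of products
of functions that are `L²` near an end for pairs in the maximal relation, so `V` has limits there. A
nonzero limit forces all solutions into `H¹` near that end (`h1Near_of_tendsto_V_ne_zero`, variation
of constants with a Gronwall-type bound). Hence outside the limit-circle case `V` always tends to
zero and the boundary condition is automatic. In the limit-circle case the Plücker relation for `V`
shows that two pairs satisfying the boundary condition have vanishing `V` at the end. Both cases
give that `S` is invariant under conjugation, and so is its resolvent set.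

Uniqueness of `M(z)`: two different values would put `φ_z` into `S` near both ends, making it an
eigenfunction.

Existence in the limit-circle case at `b`: the boundary functional does not vanish on `φ_z`, so `m`
solves a linear equation. Otherwise, let `f` be the resolvent applied to some `g` vanishing to the
right of `d`. There `f = α θ_z + β φ_z`, and if `α ≠ 0` then `M(z) = β/α`. It remains to treat the
case where `α = 0` for every such `g`. Testing with cut-offs `g` of `φ_z^*` then gives that
`φ_z^{[1]} φ_z^*` equals the energy of `φ_z` to the left of each point. Consequently `φ_z` has no
zeros and `z ∫ |φ_z|² dϱ = 0` over every interval, so `ϱ = 0`. For `ϱ = 0` a nested-set argument in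
the manner of Weyl's discs gives a solution `θ_z + m φ_z` of finite energy near `b`.

Analyticity at `z₀`: cut `ψ_{z₀}` off on the left to obtain `h ∈ H¹` and put `u_z = ψ_{z₀} + (z -
z₀)(S - z)⁻¹ h`. To the right of the cut-off this is a solution for `z` lying in `S` near `b`, thus
`α θ_z + β φ_z`, and Cramer's rule at two points expresses `M(z) = β/α` by point values. These are
analytic because `H¹` is complete with bounded point evaluations, so that the Neumann argument for
the resolvent applies.

Symmetry: the conjugate of `ψ_{z^*}` is `θ_z + M(z^*)^* φ_z`, which lies in `S` near `b`; uniqueness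
identifies it with `ψ_z`. -/

noncomputable section

namespace LeftDefinite

variable {a b : EReal}

/-! ### Order and topology of the interval. -/

section Order

instance ordConnected_interval (a b : EReal) :
    OrdConnected {x : ℝ | a < (x : EReal) ∧ (x : EReal) < b} :=
  ⟨fun _ hx _ hy _ hz => ⟨hx.1.trans_le (EReal.coe_le_coe_iff.2 hz.1),
    (EReal.coe_le_coe_iff.2 hz.2).trans_lt hy.2⟩⟩

instance : OrderTopology (Interval a b) :=
  orderTopology_of_ordConnected (t := {x : ℝ | a < (x : EReal) ∧ (x : EReal) < b})

instance : NoMaxOrder (Interval a b) where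
  exists_gt x := by
    obtain ⟨y, hy, hyb⟩ := EReal.lt_iff_exists_real_btwn.1 x.2.2
    exact ⟨⟨y, x.2.1.trans hy, hyb⟩, Subtype.mk_lt_mk.2 (EReal.coe_lt_coe_iff.1 hy)⟩

instance : NoMinOrder (Interval a b) where
  exists_lt x := by
    obtain ⟨y, hy, hyb⟩ := EReal.lt_iff_exists_real_btwn.1 x.2.1
    exact ⟨⟨y, hy, hyb.trans x.2.2⟩, Subtype.mk_lt_mk.2 (EReal.coe_lt_coe_iff.1 hyb)⟩

instance : DenselyOrdered (Interval a b) where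
  dense x y hxy := by
    obtain ⟨z, h1, h2⟩ := exists_between (show (x : ℝ) < y from hxy)
    exact ⟨⟨z, x.2.1.trans (EReal.coe_lt_coe_iff.2 h1), (EReal.coe_lt_coe_iff.2 h2).trans y.2.2⟩,
      h1, h2⟩

instance : CompactIccSpace (Interval a b) where
  isCompact_Icc {x y} := by
    rw [Subtype.isCompact_iff]
    convert isCompact_Icc (a := (x : ℝ)) (b := (y : ℝ)) using 1
    ext t
    constructor
    · rintro ⟨s, hs, rfl⟩
      exact hs
    · intro ht
      exact ⟨⟨t, (ordConnected_interval a b).out x.2 y.2 ht⟩, ht, rfl⟩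

end Order

/-! ### Primitives with respect to a measure, over half-open intervals. -/

section Stieltjes

variable {μ : Measure (Interval a b)} {f g h p : Interval a b → ℂ} {c d x y : Interval a b}

theorem integrableOn_Ico (hh : LocallyIntegrable h μ) (x y : Interval a b) :
    IntegrableOn h (Ico x y) μ :=
  (hh.integrableOn_isCompact isCompact_Icc).mono_set Ico_subset_Icc_self

theorem locallyIntegrable_of_Ico (hh : ∀ x y, IntegrableOn h (Ico x y) μ) :
    LocallyIntegrable h μ := by
  intro x
  obtain ⟨y, hy⟩ := exists_lt x
  obtain ⟨z, hz⟩ := exists_gt x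
  exact ⟨Ico y z, mem_of_superset (Ioo_mem_nhds hy hz) Ioo_subset_Ico_self, hh y z⟩

theorem measure_Ico_lt_top [IsLocallyFiniteMeasure μ] (x y : Interval a b) : μ (Ico x y) < ⊤ :=
  (measure_mono Ico_subset_Icc_self).trans_lt isCompact_Icc.measure_lt_top

theorem stieltjesIntegral_of_le (hxy : x ≤ y) :
    stieltjesIntegral μ h x y = ∫ s in Ico x y, h s ∂μ := by
  simp [stieltjesIntegral, Ico_eq_empty_of_le hxy]

theorem stieltjesIntegral_symm (x y : Interval a b) :
    stieltjesIntegral μ h y x = -stieltjesIntegral μ h x y := by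
  simp [stieltjesIntegral]

theorem setIntegral_Ico_add (hh : LocallyIntegrable h μ) (hcx : c ≤ x) (hxy : x ≤ y) :
    (∫ s in Ico c x, h s ∂μ) + ∫ s in Ico x y, h s ∂μ = ∫ s in Ico c y, h s ∂μ := by
  rw [← setIntegral_union (Ico_disjoint_Ico_same) measurableSet_Ico (integrableOn_Ico hh _ _)
    (integrableOn_Ico hh _ _), Ico_union_Ico_eq_Ico hcx hxy]

theorem stieltjesIntegral_add (hh : LocallyIntegrable h μ) (c x y : Interval a b) :
    stieltjesIntegral μ h c x + stieltjesIntegral μ h x y = stieltjesIntegral μ h c y := by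
  have key : ∀ {c x y : Interval a b}, c ≤ x → x ≤ y →
      stieltjesIntegral μ h c x + stieltjesIntegral μ h x y = stieltjesIntegral μ h c y := by
    intro c x y h1 h2
    rw [stieltjesIntegral_of_le h1, stieltjesIntegral_of_le h2,
      stieltjesIntegral_of_le (h1.trans h2), setIntegral_Ico_add hh h1 h2]
  have s := fun u v => stieltjesIntegral_symm (μ := μ) (h := h) u v
  rcases le_total c x with h1 | h1 <;> rcases le_total x y with h2 | h2 <;>
    rcases le_total c y with h3 | h3
  · exact key h1 h2
  · exact key h1 h2
  · linear_combination -(key h3 h2) + s y x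
  · linear_combination key h3 h1 + s y x - s y c
  · linear_combination -(key h1 h3) + s x c
  · linear_combination key h2 h3 + s x c - s y c
  · linear_combination s x c + s y x - s y c - key h2 h1
  · linear_combination s x c + s y x - s y c - key h2 h1

theorem HasRNDeriv.sub_eq (hf : HasRNDeriv μ f h) (hxy : x ≤ y) :
    f y - f x = ∫ s in Ico x y, h s ∂μ := by
  rw [hf.2 x y, stieltjesIntegral_of_le hxy]; ring

theorem HasRNDeriv.of_le (hh : LocallyIntegrable h μ)
    (hf : ∀ x y, x ≤ y → f y - f x = ∫ s in Ico x y, h s ∂μ) : HasRNDeriv μ f h := by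
  refine ⟨hh, fun x y => ?_⟩
  rcases le_total x y with hxy | hxy
  · rw [stieltjesIntegral_of_le hxy, ← hf x y hxy]; ring
  · rw [stieltjesIntegral_symm, stieltjesIntegral_of_le hxy, ← hf y x hxy]; ring

theorem HasRNDeriv.of_base (hh : LocallyIntegrable h μ) (c : Interval a b)
    (hf : ∀ x, f x = f c + stieltjesIntegral μ h c x) : HasRNDeriv μ f h := by
  refine ⟨hh, fun x y => ?_⟩
  rw [hf y, hf x, ← stieltjesIntegral_add hh c x y]; ring

theorem HasRNDeriv.add {k : Interval a b → ℂ} (hf : HasRNDeriv μ f h) (hg : HasRNDeriv μ g k) :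
    HasRNDeriv μ (f + g) (h + k) := by
  refine .of_le (hf.1.add hg.1) fun x y hxy => ?_
  have : ∫ s in Ico x y, (h + k) s ∂μ = (∫ s in Ico x y, h s ∂μ) + ∫ s in Ico x y, k s ∂μ :=
    integral_add (integrableOn_Ico hf.1 x y) (integrableOn_Ico hg.1 x y)
  rw [this, ← hf.sub_eq hxy, ← hg.sub_eq hxy]; simp only [Pi.add_apply]; ring

theorem HasRNDeriv.smul (r : ℂ) (hf : HasRNDeriv μ f h) : HasRNDeriv μ (r • f) (r • h) := by
  refine .of_le (hf.1.smul r) fun x y hxy => ?_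
  have : ∫ s in Ico x y, (r • h) s ∂μ = r • ∫ s in Ico x y, h s ∂μ := integral_smul r _
  rw [this, ← hf.sub_eq hxy]; simp only [Pi.smul_apply, smul_eq_mul]; ring

theorem locallyIntegrable_star (hh : LocallyIntegrable h μ) : LocallyIntegrable (star h) μ :=
  locallyIntegrable_of_Ico fun x y =>
    (Complex.conjCLE : ℂ →L[ℝ] ℂ).integrable_comp (integrableOn_Ico hh x y)

theorem HasRNDeriv.star (hf : HasRNDeriv μ f h) : HasRNDeriv μ (star f) (star h) := by
  refine .of_le (locallyIntegrable_star hf.1) fun x y hxy => ?_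
  have : ∫ s in Ico x y, (Star.star h) s ∂μ = conj (∫ s in Ico x y, h s ∂μ) := integral_conj
  rw [this, ← hf.sub_eq hxy]; simp

theorem HasRNDeriv.zero : HasRNDeriv μ 0 0 :=
  .of_le locallyIntegrable_zero fun x y _ => by simp

/-- A function bounded on every compact subinterval. -/
def LocallyBdd (f : Interval a b → ℂ) : Prop :=
  ∀ x y, ∃ C, ∀ t ∈ Icc x y, ‖f t‖ ≤ C

theorem LocallyBdd.add (hf : LocallyBdd f) (hg : LocallyBdd g) : LocallyBdd (f + g) := by
  intro x y
  obtain ⟨C, hC⟩ := hf x y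
  obtain ⟨D, hD⟩ := hg x y
  exact ⟨C + D, fun t ht => (norm_add_le _ _).trans (add_le_add (hC t ht) (hD t ht))⟩

theorem LocallyBdd.mul (hf : LocallyBdd f) (hg : LocallyBdd g) : LocallyBdd (f * g) := by
  intro x y
  obtain ⟨C, hC⟩ := hf x y
  obtain ⟨D, hD⟩ := hg x y
  refine ⟨C * D, fun t ht => ?_⟩
  rw [Pi.mul_apply, norm_mul]
  exact mul_le_mul (hC t ht) (hD t ht) (norm_nonneg _) ((norm_nonneg _).trans (hC t ht))

theorem LocallyBdd.neg (hf : LocallyBdd f) : LocallyBdd (-f) := by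
  intro x y
  obtain ⟨C, hC⟩ := hf x y
  exact ⟨C, fun t ht => by simpa using hC t ht⟩

theorem LocallyBdd.const (k : ℂ) : LocallyBdd (fun _ : Interval a b => k) :=
  fun _ _ => ⟨‖k‖, fun _ _ => le_rfl⟩

theorem locallyBdd_stieltjesIntegral (hh : LocallyIntegrable h μ) (c : Interval a b) :
    LocallyBdd (stieltjesIntegral μ h c) := by
  intro x y
  refine ⟨(∫ s in Ico c y, ‖h s‖ ∂μ) + ∫ s in Ico x c, ‖h s‖ ∂μ, fun t ht => ?_⟩
  refine (norm_sub_le _ _).trans (add_le_add ?_ ?_)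
  · exact (norm_integral_le_integral_norm _).trans (setIntegral_mono_set
      (integrableOn_Ico hh c y).norm (ae_of_all _ fun _ => norm_nonneg _)
      (Ico_subset_Ico_right ht.2).eventuallyLE)
  · exact (norm_integral_le_integral_norm _).trans (setIntegral_mono_set
      (integrableOn_Ico hh x c).norm (ae_of_all _ fun _ => norm_nonneg _)
      (Ico_subset_Ico_left ht.1).eventuallyLE)

/-- With `h` replaced by a measurable version, both terms are parameter integrals of functions
jointly measurable on the product, so Fubini's measurability statement applies. -/
theorem measurable_stieltjesIntegral [SFinite μ] (hh : AEStronglyMeasurable h μ)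
    (c : Interval a b) : Measurable (stieltjesIntegral μ h c) := by
  obtain ⟨k, hk, hhk⟩ := hh
  have e : ∀ A : Set (Interval a b), ∫ s in A, h s ∂μ = ∫ s in A, k s ∂μ := fun A =>
    integral_congr_ae (ae_restrict_of_ae hhk)
  have h1 : StronglyMeasurable fun x => ∫ s, (Ico c x).indicator k s ∂μ := by
    refine StronglyMeasurable.integral_prod_right
      (f := fun x s => (Ico c x).indicator k s) ?_
    have : (Function.uncurry fun (x s : Interval a b) => (Ico c x).indicator k s) =
        {q : Interval a b × Interval a b | c ≤ q.2 ∧ q.2 < q.1}.indicator (fun q => k q.2) := by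
      ext ⟨x, s⟩; simp [indicator]
    rw [this]
    exact (hk.comp_measurable measurable_snd).indicator
      ((measurableSet_le measurable_const measurable_snd).inter
        (measurableSet_lt (α := Interval a b) measurable_snd measurable_fst))
  have h2 : StronglyMeasurable fun x => ∫ s, (Ico x c).indicator k s ∂μ := by
    refine StronglyMeasurable.integral_prod_right
      (f := fun x s => (Ico x c).indicator k s) ?_
    have : (Function.uncurry fun (x s : Interval a b) => (Ico x c).indicator k s) =
        {q : Interval a b × Interval a b | q.1 ≤ q.2 ∧ q.2 < c}.indicator (fun q => k q.2) := by
      ext ⟨x, s⟩; simp [indicator]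
    rw [this]
    exact (hk.comp_measurable measurable_snd).indicator
      ((measurableSet_le measurable_fst measurable_snd).inter
        (measurableSet_lt (α := Interval a b) measurable_snd measurable_const))
  have : stieltjesIntegral μ h c = fun x =>
      (∫ s, (Ico c x).indicator k s ∂μ) - ∫ s, (Ico x c).indicator k s ∂μ := by
    ext x
    rw [stieltjesIntegral, e, e, integral_indicator measurableSet_Ico,
      integral_indicator measurableSet_Ico]
  rw [this]
  exact h1.measurable.sub h2.measurable

theorem HasRNDeriv.locallyBdd (hf : HasRNDeriv μ f h) : LocallyBdd f := by
  intro x y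
  obtain ⟨C, hC⟩ := ((LocallyBdd.const (f x)).add (locallyBdd_stieltjesIntegral hf.1 x)) x y
  exact ⟨C, fun t ht => by rw [hf.2 x t]; exact hC t ht⟩

theorem HasRNDeriv.measurable [SFinite μ] (hf : HasRNDeriv μ f h) : Measurable f := by
  rcases isEmpty_or_nonempty (Interval a b) with hE | ⟨⟨c⟩⟩
  · exact measurable_of_empty f
  · have : f = fun x => f c + stieltjesIntegral μ h c x := funext fun x => hf.2 c x
    rw [this]
    exact measurable_const.add (measurable_stieltjesIntegral hf.1.aestronglyMeasurable c)

theorem LocallyBdd.integrableOn_mul (hf : LocallyBdd f) (hm : Measurable f)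
    (hh : LocallyIntegrable h μ) (x y : Interval a b) :
    IntegrableOn (fun s => f s * h s) (Ico x y) μ := by
  obtain ⟨C, hC⟩ := hf x y
  refine (integrableOn_Ico hh x y).bdd_mul hm.aestronglyMeasurable (c := C) ?_
  filter_upwards [ae_restrict_mem measurableSet_Ico] with t ht
  exact hC t (Ico_subset_Icc_self ht)

theorem LocallyBdd.locallyIntegrable_mul (hf : LocallyBdd f) (hm : Measurable f)
    (hh : LocallyIntegrable h μ) : LocallyIntegrable (fun s => f s * h s) μ :=
  locallyIntegrable_of_Ico (hf.integrableOn_mul hm hh)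

theorem LocallyBdd.locallyIntegrable [IsLocallyFiniteMeasure μ] (hf : LocallyBdd f)
    (hm : Measurable f) : LocallyIntegrable f μ := by
  simpa using hf.locallyIntegrable_mul hm (locallyIntegrable_const (μ := μ) (1 : ℂ))

theorem exists_strictMono_tendsto (x : Interval a b) :
    ∃ u : ℕ → Interval a b, StrictMono u ∧ (∀ n, u n < x) ∧ Tendsto u atTop (𝓝 x) := by
  obtain ⟨y, hy⟩ := exists_lt x
  obtain ⟨u, h1, h2, h3⟩ := exists_seq_strictMono_tendsto' hy
  exact ⟨u, h1, fun n => (h2 n).2, h3⟩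

theorem iInter_Ico_eq_empty {u : ℕ → Interval a b} (hu : Tendsto u atTop (𝓝 x)) :
    ⋂ n, Ico (u n) x = ∅ := by
  refine eq_empty_of_forall_notMem fun t ht => ?_
  rw [mem_iInter] at ht
  exact absurd (le_of_tendsto' hu fun n => (ht n).1) (not_le.2 (ht 0).2)

theorem tendsto_setIntegral_Ico {E : Type*} [NormedAddCommGroup E] [NormedSpace ℝ E]
    {h : Interval a b → E} (hh : LocallyIntegrable h μ)
    {u : ℕ → Interval a b} (hu : StrictMono u) (hux : Tendsto u atTop (𝓝 x)) :
    Tendsto (fun n => ∫ s in Ico (u n) x, h s ∂μ) atTop (𝓝 0) := by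
  have := tendsto_setIntegral_of_antitone (f := h) (μ := μ) (s := fun n => Ico (u n) x)
    (fun n => measurableSet_Ico) (fun m n hmn => Ico_subset_Ico_left (hu.monotone hmn))
    ⟨0, (hh.integrableOn_isCompact isCompact_Icc).mono_set Ico_subset_Icc_self⟩
  simpa [iInter_Ico_eq_empty hux] using this

/-- The intervals `[u n, x)` decrease to the empty set, even if `μ` has an atom at `x`. Primitives
are therefore left-continuous, which later singles out the representative `f^{[1]}`. -/
theorem tendsto_stieltjesIntegral_left (hh : LocallyIntegrable h μ) (c : Interval a b)
    {u : ℕ → Interval a b} (hu : StrictMono u) (hlt : ∀ n, u n < x)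
    (hux : Tendsto u atTop (𝓝 x)) :
    Tendsto (fun n => stieltjesIntegral μ h c (u n)) atTop (𝓝 (stieltjesIntegral μ h c x)) := by
  have h1 := tendsto_setIntegral_Ico hh hu hux
  have : (fun n => stieltjesIntegral μ h c (u n)) =
      fun n => stieltjesIntegral μ h c x - ∫ s in Ico (u n) x, h s ∂μ := by
    ext n
    rw [← stieltjesIntegral_add hh c (u n) x, stieltjesIntegral_of_le (hlt n).le]; ring
  rw [this]
  simpa using tendsto_const_nhds.sub h1

/-- A locally integrable function is determined a.e. by its integrals over half-open intervals. -/
theorem ae_eq_zero_of_forall_Ico [SFinite μ] (hh : LocallyIntegrable h μ)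
    (h0 : ∀ x y, x ≤ y → ∫ s in Ico x y, h s ∂μ = 0) : h =ᵐ[μ] 0 := by
  have main : ∀ c d : Interval a b, h =ᵐ[μ.restrict (Ico c d)] 0 := by
    intro c d
    have hinteg : Integrable h (μ.restrict (Ico c d)) := integrableOn_Ico hh c d
    refine hinteg.ae_eq_zero_of_forall_setIntegral_eq_zero fun s hs _ => ?_
    have hb : borel (Interval a b) = _ := borel_eq_generateFrom_Ico (Interval a b)
    rw [← BorelSpace.measurable_eq (α := Interval a b)] at hb
    have hT : ∫ s, h s ∂(μ.restrict (Ico c d)) = 0 := by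
      rcases le_total c d with hcd | hcd
      · exact h0 c d hcd
      · simp [Ico_eq_empty_of_le hcd]
    -- Half-open intervals form a π-system generating the Borel sets, and the sets over which `h`
    -- integrates to zero form a λ-system.
    refine MeasurableSpace.induction_on_inter
      (C := fun s _ => ∫ x in s, h x ∂(μ.restrict (Ico c d)) = 0) hb
      (by simpa using isPiSystem_Ico (id : Interval a b → _) id) (by simp) ?_ ?_ ?_ s hs
    · rintro t ⟨l, u, -, rfl⟩
      rw [Measure.restrict_restrict measurableSet_Ico, Ico_inter_Ico]
      rcases le_total (max l c) (min u d) with hle | hle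
      · exact h0 _ _ hle
      · rw [Ico_eq_empty_of_le (by exact hle)]; simp
    · intro t ht h1
      have := integral_add_compl ht hinteg
      rw [h1, hT, zero_add] at this
      exact this
    · intro f hd hm h1
      rw [integral_iUnion hm hd hinteg.integrableOn]
      simp [h1]
  rcases isEmpty_or_nonempty (Interval a b) with hE | hN
  · exact Filter.eventuallyEq_iff_exists_mem.2 ⟨univ, univ_mem, fun x => (hE.false x).elim⟩
  obtain ⟨u, hu⟩ := exists_seq_tendsto (atTop : Filter (Interval a b))
  obtain ⟨v, hv⟩ := exists_seq_tendsto (atBot : Filter (Interval a b))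
  have hU : (⋃ n, Ico (v n) (u n)) = univ := by
    refine eq_univ_of_forall fun x => mem_iUnion.2 ?_
    obtain ⟨n, hn⟩ := ((hu.eventually_gt_atTop x).and (hv.eventually_le_atBot x)).exists
    exact ⟨n, hn.2, hn.1⟩
  rw [← Measure.restrict_univ (μ := μ), ← hU]
  exact (ae_restrict_iUnion_iff _ _).2 fun n => main _ _

theorem HasRNDeriv.ae_eq [SFinite μ] {k : Interval a b → ℂ} (hf : HasRNDeriv μ f h)
    (hf' : HasRNDeriv μ f k) : h =ᵐ[μ] k := by
  have := ae_eq_zero_of_forall_Ico (h := h - k) (μ := μ) (hf.1.sub hf'.1) fun x y hxy => by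
    have e : ∫ s in Ico x y, (h - k) s ∂μ = (∫ s in Ico x y, h s ∂μ) - ∫ s in Ico x y, k s ∂μ :=
      integral_sub (integrableOn_Ico hf.1 x y) (integrableOn_Ico hf'.1 x y)
    rw [e, ← hf.sub_eq hxy, ← hf'.sub_eq hxy, sub_self]
  filter_upwards [this] with x hx
  exact sub_eq_zero.1 hx

theorem hasRNDeriv_rnDeriv (hf : f ∈ ACloc μ) : HasRNDeriv μ f (rnDeriv μ f) := by
  have hf' : ∃ g, HasRNDeriv μ f g := hf
  rw [rnDeriv, dif_pos hf']
  exact hf'.choose_spec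

theorem HasRNDeriv.rnDeriv_ae_eq [SFinite μ] (hf : HasRNDeriv μ f h) : rnDeriv μ f =ᵐ[μ] h :=
  (hasRNDeriv_rnDeriv ⟨h, hf⟩).ae_eq hf

open Classical in
/-- Gluing two primitives at a point where they agree. -/
theorem HasRNDeriv.glue {k : Interval a b → ℂ} (hf : HasRNDeriv μ f h) (hg : HasRNDeriv μ g k)
    (hd : f d = g d) :
    HasRNDeriv μ ((Iio d).piecewise f g) ((Iio d).piecewise h k) := by
  have hl : LocallyIntegrable ((Iio d).piecewise h k) μ := locallyIntegrable_of_Ico fun x y =>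
    Integrable.piecewise measurableSet_Iio (integrableOn_Ico hf.1 x y).integrableOn
      (integrableOn_Ico hg.1 x y).integrableOn
  refine .of_base hl d fun x => ?_
  have hdd : (Iio d).piecewise f g d = g d := by simp [piecewise]
  rw [hdd]
  rcases lt_or_ge x d with hx | hx
  · rw [piecewise_eq_of_mem (Iio d) _ _ hx, stieltjesIntegral_symm, stieltjesIntegral_of_le hx.le,
      ← hd, setIntegral_congr_fun (g := h) measurableSet_Ico, ← hf.sub_eq hx.le]
    · ring
    · exact fun s hs => piecewise_eq_of_mem (Iio d) _ _ hs.2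
  · rw [piecewise_eq_of_notMem (Iio d) _ _ (by simpa using hx), stieltjesIntegral_of_le hx,
      setIntegral_congr_fun (g := k) measurableSet_Ico, ← hg.sub_eq hx]
    · ring
    · exact fun s hs => piecewise_eq_of_notMem (Iio d) _ _ (by simpa using hs.1)

end Stieltjes

/-! ### Integration by parts for measures without common atoms. -/

section ByParts

variable {μ ν : Measure (Interval a b)} {f p r : Interval a b → ℂ} {x y : Interval a b}

theorem ae_measure_singleton_eq_zero [SFinite ν] (hat : ∀ t, μ {t} * ν {t} = 0) :
    ∀ᵐ t ∂μ, ν {t} = 0 := by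
  have hc : {t : Interval a b | 0 < ν {t}}.Countable :=
    Measure.countable_meas_pos_of_disjoint_iUnion (fun t => measurableSet_singleton t)
      (fun s t hst => disjoint_singleton.2 hst)
  have h0 : μ {t : Interval a b | 0 < ν {t}} = 0 :=
    (measure_null_iff_singleton hc).2 fun t ht =>
      (mul_eq_zero.1 (hat t)).resolve_right (ne_of_gt ht)
  filter_upwards [measure_eq_zero_iff_ae_notMem.1 h0] with t ht
  simpa using ht

/-- Integration by parts for two measures without common atoms. -/
theorem integral_mul_integral_Ico [SFinite μ] [SFinite ν] (hat : ∀ t, μ {t} * ν {t} = 0)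
    (hp : LocallyIntegrable p μ) (hr : LocallyIntegrable r ν) (x y : Interval a b) :
    (∫ s in Ico x y, p s ∂μ) * ∫ t in Ico x y, r t ∂ν =
      (∫ t in Ico x y, (∫ s in Ico x t, p s ∂μ) * r t ∂ν) +
        ∫ s in Ico x y, (∫ t in Ico x s, r t ∂ν) * p s ∂μ := by
  set μ' := μ.restrict (Ico x y)
  set ν' := ν.restrict (Ico x y)
  set G : Interval a b × Interval a b → ℂ := fun q => p q.1 * r q.2
  set A : Set (Interval a b × Interval a b) := {q | q.1 < q.2}
  set B : Set (Interval a b × Interval a b) := {q | q.2 < q.1}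
  have hA : MeasurableSet A := measurableSet_lt (α := Interval a b) measurable_fst measurable_snd
  have hB : MeasurableSet B := measurableSet_lt (α := Interval a b) measurable_snd measurable_fst
  have hG : Integrable G (μ'.prod ν') :=
    Integrable.mul_prod (integrableOn_Ico hp x y) (integrableOn_Ico hr x y)
  have hAB : Disjoint A B := disjoint_left.2 fun q h1 h2 =>
    lt_asymm (show q.1 < q.2 from h1) h2
  -- The complement of the two open triangles is the diagonal. It is null because for `μ`-almost
  -- every `s` the point `s` is no atom of `ν`.
  have hd : (μ'.prod ν') (A ∪ B)ᶜ = 0 := by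
    refine (Measure.measure_prod_null (hA.union hB).compl).2 ?_
    filter_upwards [ae_restrict_of_ae (ae_measure_singleton_eq_zero (μ := μ) (ν := ν) hat)]
      with s hs
    refine measure_mono_null ?_ ((Measure.restrict_apply_le _ _).trans_eq hs |>.antisymm bot_le)
    intro t ht
    simp only [A, B, mem_preimage, mem_compl_iff, mem_union, not_or] at ht
    exact le_antisymm (not_lt.1 ht.1) (not_lt.1 ht.2)
  have hU : (A ∪ B : Set _) =ᵐ[μ'.prod ν'] univ := by
    rw [ae_eq_univ]; exact hd
  have e1 : ∫ q, G q ∂(μ'.prod ν') = (∫ q in A, G q ∂(μ'.prod ν')) + ∫ q in B, G q ∂(μ'.prod ν') := by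
    rw [← setIntegral_union hAB hB hG.integrableOn hG.integrableOn, setIntegral_congr_set hU,
      Measure.restrict_univ]
  have e0 : ∫ q, G q ∂(μ'.prod ν') = (∫ s, p s ∂μ') * ∫ t, r t ∂ν' := integral_prod_mul p r
  rw [← e0, e1]
  congr 1
  · rw [← integral_indicator hA, integral_prod_symm _ (hG.indicator hA)]
    refine setIntegral_congr_fun measurableSet_Ico fun t ht => ?_
    have : (fun s => A.indicator G (s, t)) = (Iio t).indicator (fun s => p s * r t) := by
      ext s; simp [A, G, indicator]
    simp only [this]
    rw [integral_indicator measurableSet_Iio, integral_mul_const,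
      Measure.restrict_restrict measurableSet_Iio]
    congr 3
    ext s
    simp only [mem_inter_iff, mem_Iio, mem_Ico]
    exact ⟨fun h => ⟨h.2.1, h.1⟩, fun h => ⟨h.2, h.1, h.2.trans ht.2⟩⟩
  · rw [← integral_indicator hB, integral_prod _ (hG.indicator hB)]
    refine setIntegral_congr_fun measurableSet_Ico fun s hs => ?_
    have : (fun t => B.indicator G (s, t)) = (Iio s).indicator (fun t => r t * p s) := by
      ext t; simp [B, G, indicator, mul_comm]
    simp only [this]
    rw [integral_indicator measurableSet_Iio, integral_mul_const,
      Measure.restrict_restrict measurableSet_Iio]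
    congr 3
    ext t
    simp only [mem_inter_iff, mem_Iio, mem_Ico]
    exact ⟨fun h => ⟨h.2.1, h.1⟩, fun h => ⟨h.2, h.1, h.2.trans hs.2⟩⟩

theorem HasRNDeriv.mul_integral_Ico [SFinite μ] [SFinite ν] (hat : ∀ t, μ {t} * ν {t} = 0)
    (hf : HasRNDeriv μ f p) (hr : LocallyIntegrable r ν) (hxy : x ≤ y) :
    f y * ∫ t in Ico x y, r t ∂ν =
      (∫ t in Ico x y, f t * r t ∂ν) + ∫ s in Ico x y, (∫ t in Ico x s, r t ∂ν) * p s ∂μ := by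
  have h1 := integral_mul_integral_Ico hat hf.1 hr x y
  have h2 : ∫ t in Ico x y, (∫ s in Ico x t, p s ∂μ) * r t ∂ν =
      (∫ t in Ico x y, f t * r t ∂ν) - f x * ∫ t in Ico x y, r t ∂ν := by
    rw [← integral_const_mul, ← integral_sub
      (hf.locallyBdd.integrableOn_mul hf.measurable hr x y)
      ((integrableOn_Ico hr x y).const_mul _)]
    refine setIntegral_congr_fun measurableSet_Ico fun t ht => ?_
    rw [← hf.sub_eq ht.1]; ring
  rw [h2, ← hf.sub_eq hxy] at h1
  linear_combination h1

end ByParts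

/-! ### The expression `τ`: uniqueness of the quasi-derivative, energy and Lagrange identities. -/

namespace Coefficients

variable (τ : Coefficients a b)

instance : IsLocallyFiniteMeasure τ.sigma := τ.sigma_locallyFinite
instance : IsLocallyFiniteMeasure τ.chi := τ.chi_locallyFinite
instance : IsLocallyFiniteMeasure τ.rho.pos := τ.rho.pos_locallyFinite
instance : IsLocallyFiniteMeasure τ.rho.neg := τ.rho.neg_locallyFinite

theorem sigma_pos_atom (t : Interval a b) : τ.sigma {t} * τ.rho.pos {t} = 0 := by
  have := τ.sigma_rho t
  simp only [RealMeasure.variation, Measure.add_apply, mul_add, add_eq_zero] at this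
  exact this.1

theorem sigma_neg_atom (t : Interval a b) : τ.sigma {t} * τ.rho.neg {t} = 0 := by
  have := τ.sigma_rho t
  simp only [RealMeasure.variation, Measure.add_apply, mul_add, add_eq_zero] at this
  exact this.2

variable {τ} {f g h q q' d e f₁ f₂ g₁ g₂ : Interval a b → ℂ} {x y z : Interval a b}

/-- In terms of increments the base point disappears and the two parts of `ϱ` separate, so the
algebra of quasi-derivatives reduces to linearity of integrals. -/
theorem isTau_iff : τ.IsTau f q g ↔ HasRNDeriv τ.sigma f q ∧ LocallyIntegrable g τ.rho.pos ∧
    LocallyIntegrable g τ.rho.neg ∧ ∀ x y, x ≤ y → q y - q x = (∫ s in Ico x y, f s ∂τ.chi) -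
      ((∫ s in Ico x y, g s ∂τ.rho.pos) - ∫ s in Ico x y, g s ∂τ.rho.neg) := by
  constructor
  · rintro ⟨h1, h2⟩
    have hv : ∀ x y, IntegrableOn g (Ico x y) τ.rho.variation := fun x y =>
      integrableOn_Ico (h2 x).1 x y
    refine ⟨h1, locallyIntegrable_of_Ico fun x y => (hv x y).mono_measure ?_,
      locallyIntegrable_of_Ico fun x y => (hv x y).mono_measure ?_, fun x y hxy => ?_⟩
    · exact Measure.le_add_right le_rfl
    · exact Measure.le_add_left le_rfl
    · have := (h2 x).2 x y
      beta_reduce at this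
      rw [stieltjesIntegral_of_le hxy, stieltjesIntegral_of_le hxy, stieltjesIntegral_of_le hxy,
        stieltjesIntegral_of_le le_rfl] at this
      simp only [Ico_self, Measure.restrict_empty, integral_zero_measure, add_zero] at this
      linear_combination -this
  · rintro ⟨h1, h2, h3, h4⟩
    refine ⟨h1, fun c => ⟨locallyIntegrable_of_Ico fun x y => ?_, fun x y => ?_⟩⟩
    · rw [RealMeasure.variation, IntegrableOn, Measure.restrict_add]
      exact Integrable.add_measure (integrableOn_Ico h2 x y) (integrableOn_Ico h3 x y)
    · have hc : LocallyIntegrable f τ.chi := h1.locallyBdd.locallyIntegrable h1.measurable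
      have hadd := stieltjesIntegral_add hc c x y
      rcases le_total x y with hxy | hxy
      · have := h4 x y hxy
        simp only [← stieltjesIntegral_of_le hxy] at this
        linear_combination -this - hadd
      · have := h4 y x hxy
        simp only [← stieltjesIntegral_of_le hxy] at this
        rw [stieltjesIntegral_symm (μ := τ.rho.pos) y x,
          stieltjesIntegral_symm (μ := τ.rho.neg) y x]
        rw [stieltjesIntegral_symm (μ := τ.chi) y x] at hadd
        linear_combination this - hadd

theorem IsTau.locallyIntegrable_chi (hf : τ.IsTau f q g) : LocallyIntegrable f τ.chi :=
  hf.1.locallyBdd.locallyIntegrable hf.1.measurable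

theorem IsTau.eq_stieltjesIntegral (hf : τ.IsTau f q g) (c : Interval a b) (x : Interval a b) :
    q x = q c + stieltjesIntegral τ.chi f c x -
      (stieltjesIntegral τ.rho.pos g c x - stieltjesIntegral τ.rho.neg g c x) := by
  have := (hf.2 c).2 c x
  beta_reduce at this
  rw [stieltjesIntegral_of_le (μ := τ.chi) (le_refl c)] at this
  simp only [Ico_self, Measure.restrict_empty, integral_zero_measure, add_zero] at this
  linear_combination -this

theorem IsTau.locallyBdd (hf : τ.IsTau f q g) : LocallyBdd q := by
  obtain ⟨-, hp, hn, -⟩ := isTau_iff.1 hf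
  intro x y
  obtain ⟨C, hC⟩ := (((LocallyBdd.const (q x)).add
    (locallyBdd_stieltjesIntegral hf.locallyIntegrable_chi x)).add
    ((locallyBdd_stieltjesIntegral hp x).add (locallyBdd_stieltjesIntegral hn x).neg).neg) x y
  refine ⟨C, fun t ht => ?_⟩
  convert hC t ht using 2
  rw [hf.eq_stieltjesIntegral x t]
  simp only [Pi.add_apply, Pi.neg_apply]; ring

theorem IsTau.measurable (hf : τ.IsTau f q g) : Measurable q := by
  obtain ⟨-, hp, hn, -⟩ := isTau_iff.1 hf
  rcases isEmpty_or_nonempty (Interval a b) with hE | ⟨⟨c⟩⟩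
  · exact measurable_of_empty q
  · have : q = fun x => q c + stieltjesIntegral τ.chi f c x -
      (stieltjesIntegral τ.rho.pos g c x - stieltjesIntegral τ.rho.neg g c x) :=
      funext fun x => hf.eq_stieltjesIntegral c x
    rw [this]
    exact (measurable_const.add (measurable_stieltjesIntegral
      hf.locallyIntegrable_chi.aestronglyMeasurable c)).sub
      ((measurable_stieltjesIntegral hp.aestronglyMeasurable c).sub
      (measurable_stieltjesIntegral hn.aestronglyMeasurable c))

theorem IsTau.tendsto_left (hf : τ.IsTau f q g) {u : ℕ → Interval a b} (hu : StrictMono u)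
    (hlt : ∀ n, u n < x) (hux : Tendsto u atTop (𝓝 x)) :
    Tendsto (fun n => q (u n)) atTop (𝓝 (q x)) := by
  obtain ⟨-, hp, hn, -⟩ := isTau_iff.1 hf
  have hx := hf.eq_stieltjesIntegral x x
  rw [hx]
  conv => enter [1, n]; rw [hf.eq_stieltjesIntegral x (u n)]
  exact (tendsto_const_nhds.add (tendsto_stieltjesIntegral_left hf.locallyIntegrable_chi x hu hlt
    hux)).sub ((tendsto_stieltjesIntegral_left hp x hu hlt hux).sub
    (tendsto_stieltjesIntegral_left hn x hu hlt hux))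

/-- A left-continuous function vanishing almost everywhere to the left of a point vanishes
there. -/
theorem eq_zero_of_ae_eq_zero {w : Interval a b → ℂ} {c : Interval a b} (hcx : c < x)
    (hw : ∀ u : ℕ → Interval a b, StrictMono u → (∀ n, u n < x) → Tendsto u atTop (𝓝 x) →
      Tendsto (fun n => w (u n)) atTop (𝓝 (w x)))
    (h0 : ∀ᵐ t ∂τ.sigma.restrict (Ico c x), w t = 0) : w x = 0 := by
  by_contra hne
  have key : ∀ y, c ≤ y → y < x → ∃ t, y < t ∧ t < x ∧ w t = 0 := by
    intro y hcy hyx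
    by_contra hcon
    push Not at hcon
    refine τ.sigma_support (Ioo y x) isOpen_Ioo (nonempty_Ioo.2 hyx) ?_
    rw [ae_restrict_iff' measurableSet_Ico] at h0
    refine measure_mono_null (fun t ht => ?_) (ae_iff.1 h0)
    exact fun h => hcon t ht.1 ht.2 (h ⟨hcy.trans ht.1.le, ht.2⟩)
  obtain ⟨u, hu, hlt, hux⟩ := exists_strictMono_tendsto x
  have hev := hux.eventually (lt_mem_nhds hcx)
  obtain ⟨N, hN⟩ := eventually_atTop.1 hev
  have hch : ∀ y : {y // c ≤ y ∧ y < x}, ∃ t : {y // c ≤ y ∧ y < x}, y < t ∧ w t.1 = 0 := by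
    rintro ⟨y, h1, h2⟩
    obtain ⟨t, ht1, ht2, ht3⟩ := key y h1 h2
    exact ⟨⟨t, h1.trans ht1.le, ht2⟩, ht1, ht3⟩
  choose F hF using hch
  have hU : ∀ n, c ≤ u (N + n) ∧ u (N + n) < x := fun n =>
    ⟨(hN _ (Nat.le_add_right _ _)).le, hlt _⟩
  -- Left continuity is available along strictly increasing sequences only. The zeros of `w` are
  -- therefore chosen recursively, each beyond both its predecessor and the next term of a sequence
  -- tending to `x`.
  let v : ℕ → {y // c ≤ y ∧ y < x} := fun n =>
    Nat.rec (F ⟨u N, hU 0⟩) (fun n y => F (max y ⟨u (N + n + 1), hU (n + 1)⟩)) n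
  have hv1 : StrictMono fun n => (v n).1 := by
    refine strictMono_nat_of_lt_succ fun n => ?_
    exact lt_of_le_of_lt (le_max_left (v n) ⟨u (N + n + 1), hU (n + 1)⟩) (hF _).1
  have hv2 : ∀ n, u (N + n) < (v n).1 := by
    intro n
    cases n with
    | zero => exact (hF ⟨u N, hU 0⟩).1
    | succ n => exact lt_of_le_of_lt (le_max_right (v n) ⟨u (N + n + 1), hU (n + 1)⟩) (hF _).1
  have hv3 : ∀ n, w (v n).1 = 0 := by
    intro n
    cases n with
    | zero => exact (hF _).2
    | succ n => exact (hF _).2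
  have hlim : Tendsto (fun n => (v n).1) atTop (𝓝 x) := by
    refine tendsto_of_tendsto_of_tendsto_of_le_of_le
      (hux.comp (tendsto_add_atTop_nat N)) tendsto_const_nhds (fun n => ?_) fun n => (v n).2.2.le
    have := (hv2 n).le
    rwa [Nat.add_comm] at this
  have := hw _ hv1 (fun n => (v n).2.2) hlim
  simp only [hv3] at this
  exact hne (tendsto_nhds_unique this tendsto_const_nhds)

/-- Both representatives agree `ς`-almost everywhere and are left-continuous. As `ς` charges every
open interval, they agree everywhere. -/
theorem IsTau.quasiDeriv_unique (hf : τ.IsTau f q g) (hf' : τ.IsTau f q' h) : q = q' := by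
  funext x
  obtain ⟨c, hc⟩ := exists_lt x
  have := eq_zero_of_ae_eq_zero (τ := τ) (w := fun t => q t - q' t) hc
    (fun u h1 h2 h3 => (hf.tendsto_left h1 h2 h3).sub (hf'.tendsto_left h1 h2 h3))
    (ae_restrict_of_ae ((hf.1.ae_eq hf'.1).mono fun t ht => sub_eq_zero.2 ht))
  exact sub_eq_zero.1 this

theorem IsTau.quasiDeriv_eq (hf : τ.IsTau f q g) : τ.quasiDeriv f = q := by
  have h : ∃ q, ∃ g, τ.IsTau f q g := ⟨q, g, hf⟩
  rw [quasiDeriv, dif_pos h]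
  obtain ⟨g', hg'⟩ := h.choose_spec
  exact hg'.quasiDeriv_unique hf

theorem IsTau.add (hf : τ.IsTau f q g) (hf' : τ.IsTau f₁ q' g₁) :
    τ.IsTau (f + f₁) (q + q') (g + g₁) := by
  obtain ⟨h1, h2, h3, h4⟩ := isTau_iff.1 hf
  obtain ⟨k1, k2, k3, k4⟩ := isTau_iff.1 hf'
  refine isTau_iff.2 ⟨h1.add k1, h2.add k2, h3.add k3, fun x y hxy => ?_⟩
  simp only [Pi.add_apply]
  rw [integral_add (integrableOn_Ico hf.locallyIntegrable_chi x y)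
    (integrableOn_Ico hf'.locallyIntegrable_chi x y),
    integral_add (integrableOn_Ico h2 x y) (integrableOn_Ico k2 x y),
    integral_add (integrableOn_Ico h3 x y) (integrableOn_Ico k3 x y)]
  linear_combination h4 x y hxy + k4 x y hxy

theorem IsTau.smul (r : ℂ) (hf : τ.IsTau f q g) : τ.IsTau (r • f) (r • q) (r • g) := by
  obtain ⟨h1, h2, h3, h4⟩ := isTau_iff.1 hf
  refine isTau_iff.2 ⟨h1.smul r, h2.smul r, h3.smul r, fun x y hxy => ?_⟩
  simp only [Pi.smul_apply, smul_eq_mul, integral_const_mul]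
  linear_combination r * h4 x y hxy

theorem IsTau.star (hf : τ.IsTau f q g) : τ.IsTau (star f) (star q) (star g) := by
  obtain ⟨h1, h2, h3, h4⟩ := isTau_iff.1 hf
  refine isTau_iff.2 ⟨h1.star, locallyIntegrable_star h2, locallyIntegrable_star h3,
    fun x y hxy => ?_⟩
  have e : ∀ (μ : Measure (Interval a b)) (k : Interval a b → ℂ),
      ∫ s in Ico x y, (Star.star k) s ∂μ = conj (∫ s in Ico x y, k s ∂μ) := fun μ k => integral_conj
  rw [e, e, e, ← map_sub, ← map_sub, ← h4 x y hxy]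
  simp

/-- The energy identity `q h |_x^y = ∫ f h dχ - ∫ (τ f) h dϱ + ∫ q (dh/dς) dς`. -/
theorem IsTau.mul_sub_mul (hf : τ.IsTau f q g) (hh : HasRNDeriv τ.sigma h d) (hxy : x ≤ y) :
    q y * h y - q x * h x = (∫ s in Ico x y, h s * f s ∂τ.chi) -
      ((∫ s in Ico x y, h s * g s ∂τ.rho.pos) - ∫ s in Ico x y, h s * g s ∂τ.rho.neg) +
      ∫ s in Ico x y, q s * d s ∂τ.sigma := by
  obtain ⟨h1, h2, h3, h4⟩ := isTau_iff.1 hf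
  have a1 := hh.mul_integral_Ico τ.sigma_chi hf.locallyIntegrable_chi hxy
  have a2 := hh.mul_integral_Ico τ.sigma_pos_atom h2 hxy
  have a3 := hh.mul_integral_Ico τ.sigma_neg_atom h3 hxy
  have i0 : IntegrableOn d (Ico x y) τ.sigma := integrableOn_Ico hh.1 x y
  have i : ∀ {μ : Measure (Interval a b)} [IsLocallyFiniteMeasure μ] {k : Interval a b → ℂ},
      LocallyIntegrable k μ →
      IntegrableOn (fun s => (∫ t in Ico x s, k t ∂μ) * d s) (Ico x y) τ.sigma := by
    intro μ _ k hk
    refine ((locallyBdd_stieltjesIntegral hk x).integrableOn_mul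
      (measurable_stieltjesIntegral hk.aestronglyMeasurable x) hh.1 x y).congr_fun
      (fun s hs => ?_) measurableSet_Ico
    simp only [stieltjesIntegral_of_le hs.1]
  have i1 := i hf.locallyIntegrable_chi
  have i2 := i h2
  have i3 := i h3
  -- Inserting the integral representation of `q` produces the double integrals of the three
  -- integrations by parts.
  have key : ∫ s in Ico x y, q s * d s ∂τ.sigma = q x * (h y - h x) +
      (∫ s in Ico x y, (∫ t in Ico x s, f t ∂τ.chi) * d s ∂τ.sigma) -
      ((∫ s in Ico x y, (∫ t in Ico x s, g t ∂τ.rho.pos) * d s ∂τ.sigma) -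
      ∫ s in Ico x y, (∫ t in Ico x s, g t ∂τ.rho.neg) * d s ∂τ.sigma) := by
    rw [hh.sub_eq hxy, ← integral_const_mul, ← integral_add (i0.const_mul _) i1,
      ← integral_sub i2 i3, ← integral_sub (by exact (i0.const_mul _).add i1) (by exact i2.sub i3)]
    refine setIntegral_congr_fun measurableSet_Ico fun s hs => ?_
    linear_combination d s * h4 x s hs.1
  rw [key]
  linear_combination h y * h4 x y hxy + a1 - a2 + a3

/-- The Lagrange identity. -/
theorem IsTau.lagrange (hf : τ.IsTau f₁ q f₂) (hf₂ : HasRNDeriv τ.sigma f₂ d)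
    (hg : τ.IsTau g₁ q' g₂) (hg₂ : HasRNDeriv τ.sigma g₂ e) (hxy : x ≤ y) :
    (f₂ y * q' y - q y * g₂ y) - (f₂ x * q' x - q x * g₂ x) =
      (∫ s in Ico x y, (f₂ s * g₁ s - f₁ s * g₂ s) ∂τ.chi) +
        ∫ s in Ico x y, (d s * q' s - q s * e s) ∂τ.sigma := by
  -- Both energy identities contain the same term `∫ f_τ g_τ dϱ`; it cancels in their difference.
  have h1 := hg.mul_sub_mul hf₂ hxy
  have h2 := hf.mul_sub_mul hg₂ hxy
  have c1 : IntegrableOn (fun s => f₂ s * g₁ s) (Ico x y) τ.chi :=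
    hf₂.locallyBdd.integrableOn_mul hf₂.measurable hg.locallyIntegrable_chi x y
  have c2 : IntegrableOn (fun s => f₁ s * g₂ s) (Ico x y) τ.chi :=
    hf.1.locallyBdd.integrableOn_mul hf.1.measurable
      (hg₂.locallyBdd.locallyIntegrable hg₂.measurable) x y
  have c3 : IntegrableOn (fun s => d s * q' s) (Ico x y) τ.sigma :=
    (hg.locallyBdd.integrableOn_mul hg.measurable hf₂.1 x y).congr_fun
      (fun s _ => mul_comm _ _) measurableSet_Ico
  have c4 : IntegrableOn (fun s => q s * e s) (Ico x y) τ.sigma :=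
    hf.locallyBdd.integrableOn_mul hf.measurable hg₂.1 x y
  rw [integral_sub c1 c2, integral_sub c3 c4]
  simp only [mul_comm (g₂ _) (f₂ _), mul_comm (g₂ _) (f₁ _), mul_comm (q' _) (d _)] at h1 h2
  linear_combination h1 - h2

end Coefficients

/-! ### Limits and tails of integrals at the two ends, treated uniformly. -/

section Ends

/-- The filters `x → a` and `x → b`. -/
def IsEnd (l : Filter (Interval a b)) : Prop := l = atBot ∨ l = atTop

variable {μ : Measure (Interval a b)} {E : Type*} [NormedAddCommGroup E] [NormedSpace ℝ E]

theorem tendsto_setIntegral_Iio {k : Interval a b → E} {J : Set (Interval a b)} (hJ : J ∈ atBot)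
    (hk : IntegrableOn k J μ) :
    Tendsto (fun t => ∫ s in Iio t, k s ∂μ) atBot (𝓝 0) := by
  rcases isEmpty_or_nonempty (Interval a b) with hE | hN
  · have : (atBot : Filter (Interval a b)) = ⊥ := Filter.filter_eq_bot_of_isEmpty _
    rw [this]; exact tendsto_bot
  obtain ⟨c, hc⟩ := mem_atBot_sets.1 hJ
  have := tendsto_setIntegral_of_antitone (f := k) (μ := μ) (ι := (Interval a b)ᵒᵈ)
    (s := fun t => Iio (OrderDual.ofDual t)) (fun n => measurableSet_Iio)
    (fun m n hmn => Iio_subset_Iio hmn)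
    ⟨OrderDual.toDual c, hk.mono_set fun t ht => hc t (le_of_lt ht)⟩
  have h0 : ⋂ t : (Interval a b)ᵒᵈ, Iio (OrderDual.ofDual t) = ∅ :=
    eq_empty_of_forall_notMem fun t ht => lt_irrefl t (mem_iInter.1 ht (OrderDual.toDual t))
  rw [h0, Measure.restrict_empty, integral_zero_measure] at this
  exact this

theorem tendsto_setIntegral_Ici {k : Interval a b → E} {J : Set (Interval a b)} (hJ : J ∈ atTop)
    (hk : IntegrableOn k J μ) :
    Tendsto (fun t => ∫ s in Ici t, k s ∂μ) atTop (𝓝 0) := by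
  rcases isEmpty_or_nonempty (Interval a b) with hE | hN
  · have : (atTop : Filter (Interval a b)) = ⊥ := Filter.filter_eq_bot_of_isEmpty _
    rw [this]; exact tendsto_bot
  obtain ⟨c, hc⟩ := mem_atTop_sets.1 hJ
  have := tendsto_setIntegral_of_antitone (f := k) (μ := μ)
    (s := fun t : Interval a b => Ici t) (fun n => measurableSet_Ici)
    (fun m n hmn => Ici_subset_Ici.2 hmn) ⟨c, hk.mono_set fun t ht => hc t ht⟩
  have h0 : ⋂ t : Interval a b, Ici t = ∅ := by
    refine eq_empty_of_forall_notMem fun t ht => ?_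
    obtain ⟨s, hs⟩ := exists_gt t
    exact not_le.2 hs (mem_iInter.1 ht s)
  rw [h0] at this
  simpa using this

theorem IsEnd.exists_tail {l : Filter (Interval a b)} (hl : IsEnd l) {k : Interval a b → ℝ}
    {J : Set (Interval a b)} (hJ : J ∈ l) (hk : IntegrableOn k J μ) {ε : ℝ} (hε : 0 < ε) :
    ∃ J' ∈ l, J' ⊆ J ∧ OrdConnected J' ∧ MeasurableSet J' ∧ ∫ s in J', k s ∂μ < ε := by
  rcases isEmpty_or_nonempty (Interval a b) with hE | hN
  · refine ⟨∅, ?_, empty_subset _, ordConnected_empty, MeasurableSet.empty, by simpa⟩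
    rw [Filter.filter_eq_bot_of_isEmpty l]; exact mem_bot
  rcases hl with rfl | rfl
  · obtain ⟨c, hc⟩ := mem_atBot_sets.1 hJ
    obtain ⟨t, ht, htc⟩ := (((tendsto_setIntegral_Iio hJ hk).eventually (gt_mem_nhds hε)).and
      (eventually_le_atBot c)).exists
    exact ⟨Iio t, Iio_mem_atBot t, fun s hs => hc s (le_of_lt (lt_of_lt_of_le hs htc)),
      ordConnected_Iio, measurableSet_Iio, ht⟩
  · obtain ⟨c, hc⟩ := mem_atTop_sets.1 hJ
    obtain ⟨t, ht, htc⟩ := (((tendsto_setIntegral_Ici hJ hk).eventually (gt_mem_nhds hε)).and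
      (eventually_ge_atTop c)).exists
    exact ⟨Ici t, Ici_mem_atTop t, fun s hs => hc s (le_trans htc hs),
      ordConnected_Ici, measurableSet_Ici, ht⟩

theorem integrableOn_Iio {k : Interval a b → ℂ} {J : Set (Interval a b)} (hJ : J ∈ atBot)
    (hk : IntegrableOn k J μ) (hl : LocallyIntegrable k μ) (c : Interval a b) :
    IntegrableOn k (Iio c) μ := by
  have : Nonempty (Interval a b) := ⟨c⟩
  obtain ⟨d, hd⟩ := mem_atBot_sets.1 hJ
  refine ((hk.mono_set fun t ht => hd t (le_of_lt ht) : IntegrableOn k (Iio d) μ).union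
    (integrableOn_Ico hl d c)).mono_set fun t ht => ?_
  rcases lt_or_ge t d with h | h
  · exact Or.inl h
  · exact Or.inr ⟨h, ht⟩

theorem integrableOn_Ici {k : Interval a b → ℂ} {J : Set (Interval a b)} (hJ : J ∈ atTop)
    (hk : IntegrableOn k J μ) (hl : LocallyIntegrable k μ) (c : Interval a b) :
    IntegrableOn k (Ici c) μ := by
  have : Nonempty (Interval a b) := ⟨c⟩
  obtain ⟨d, hd⟩ := mem_atTop_sets.1 hJ
  refine ((hk.mono_set fun t ht => hd t ht : IntegrableOn k (Ici d) μ).union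
    (integrableOn_Ico hl c d)).mono_set fun t ht => ?_
  rcases lt_or_ge t d with h | h
  · exact Or.inr ⟨ht, h⟩
  · exact Or.inl h

theorem tendsto_setIntegral_Ico_atBot {k : Interval a b → ℂ} {c : Interval a b}
    (hk : IntegrableOn k (Iio c) μ) :
    Tendsto (fun t => ∫ s in Ico t c, k s ∂μ) atBot (𝓝 (∫ s in Iio c, k s ∂μ)) := by
  have h1 := tendsto_setIntegral_Iio (Iio_mem_atBot c) hk
  have h2 : (fun t => (∫ s in Iio c, k s ∂μ) - ∫ s in Iio t, k s ∂μ) =ᶠ[atBot]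
      fun t => ∫ s in Ico t c, k s ∂μ := by
    have : Nonempty (Interval a b) := ⟨c⟩
    filter_upwards [eventually_le_atBot c] with t ht
    rw [← Iio_union_Ico_eq_Iio ht, setIntegral_union _ measurableSet_Ico
      (hk.mono_set (Iio_subset_Iio ht)) (hk.mono_set fun s hs => hs.2)]
    · ring
    · exact disjoint_left.2 fun s h1 h2 => not_le.2 h1 h2.1
  simpa using (tendsto_const_nhds.sub h1).congr' h2

theorem tendsto_setIntegral_Ico_atTop {k : Interval a b → ℂ} {c : Interval a b}
    (hk : IntegrableOn k (Ici c) μ) :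
    Tendsto (fun t => ∫ s in Ico c t, k s ∂μ) atTop (𝓝 (∫ s in Ici c, k s ∂μ)) := by
  have h1 := tendsto_setIntegral_Ici (Ici_mem_atTop c) hk
  have h2 : (fun t => (∫ s in Ici c, k s ∂μ) - ∫ s in Ici t, k s ∂μ) =ᶠ[atTop]
      fun t => ∫ s in Ico c t, k s ∂μ := by
    have : Nonempty (Interval a b) := ⟨c⟩
    filter_upwards [eventually_ge_atTop c] with t ht
    rw [← Ico_union_Ici_eq_Ici ht, setIntegral_union _ measurableSet_Ici
      (hk.mono_set fun s hs => hs.1) (hk.mono_set (Ici_subset_Ici.2 ht))]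
    · ring
    · exact disjoint_left.2 fun s h1 h2 => not_le.2 h1.2 h2
  simpa using (tendsto_const_nhds.sub h1).congr' h2

theorem IsEnd.exists_tendsto_stieltjesIntegral {l : Filter (Interval a b)} (hl : IsEnd l)
    {k : Interval a b → ℂ} (hk : LocallyIntegrable k μ) {J : Set (Interval a b)} (hJ : J ∈ l)
    (hkJ : IntegrableOn k J μ) (c : Interval a b) :
    ∃ L, Tendsto (stieltjesIntegral μ k c) l (𝓝 L) := by
  have : Nonempty (Interval a b) := ⟨c⟩
  rcases hl with rfl | rfl
  · refine ⟨_, ((tendsto_setIntegral_Ico_atBot (integrableOn_Iio hJ hkJ hk c)).neg).congr' ?_⟩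
    filter_upwards [eventually_le_atBot c] with t ht
    rw [stieltjesIntegral_symm, stieltjesIntegral_of_le ht]
  · refine ⟨_, (tendsto_setIntegral_Ico_atTop (integrableOn_Ici hJ hkJ hk c)).congr' ?_⟩
    filter_upwards [eventually_ge_atTop c] with t ht
    rw [stieltjesIntegral_of_le ht]

end Ends

/-! ### The form `V` on pairs and its behaviour near an end. -/

namespace Coefficients

variable {τ : Coefficients a b} {F G H K : (Interval a b → ℂ) × (Interval a b → ℂ)}
  {x y : Interval a b} {l : Filter (Interval a b)} {u : Interval a b → ℂ} {z : ℂ}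

theorem nonempty_interval (τ : Coefficients a b) : Nonempty (Interval a b) := by
  by_contra hE
  rw [not_nonempty_iff] at hE
  exact τ.chi_ne_zero (Measure.eq_zero_of_isEmpty _)

theorem isTau_of_mem_Tloc (hF : F ∈ τ.Tloc) : τ.IsTau F.1 (τ.quasiDeriv F.1) F.2 := by
  obtain ⟨-, -, q, hq⟩ := hF
  rwa [hq.quasiDeriv_eq]

theorem mem_Tloc {q : Interval a b → ℂ} (h : τ.IsTau F.1 q F.2) (h2 : F.2 ∈ ACloc τ.sigma) :
    F ∈ τ.Tloc := ⟨⟨q, h.1⟩, h2, q, h⟩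

theorem add_mem_Tloc (hF : F ∈ τ.Tloc) (hG : G ∈ τ.Tloc) : F + G ∈ τ.Tloc :=
  mem_Tloc ((isTau_of_mem_Tloc hF).add (isTau_of_mem_Tloc hG))
    ⟨_, (hasRNDeriv_rnDeriv hF.2.1).add (hasRNDeriv_rnDeriv hG.2.1)⟩

theorem smul_mem_Tloc (r : ℂ) (hF : F ∈ τ.Tloc) : r • F ∈ τ.Tloc :=
  mem_Tloc ((isTau_of_mem_Tloc hF).smul r) ⟨_, (hasRNDeriv_rnDeriv hF.2.1).smul r⟩

theorem star_mem_Tloc (hF : F ∈ τ.Tloc) : star F ∈ τ.Tloc :=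
  mem_Tloc (isTau_of_mem_Tloc hF).star ⟨_, (hasRNDeriv_rnDeriv hF.2.1).star⟩

theorem IsSolution.isTau (hu : τ.IsSolution z u) : τ.IsTau u (τ.quasiDeriv u) (z • u) := by
  obtain ⟨q, hq⟩ := hu
  rwa [hq.quasiDeriv_eq]

theorem IsSolution.mem_Tloc (hu : τ.IsSolution z u) : (u, z • u) ∈ τ.Tloc :=
  Coefficients.mem_Tloc hu.isTau ⟨_, hu.isTau.1.smul z⟩

theorem quasiDeriv_add (hF : F ∈ τ.Tloc) (hG : G ∈ τ.Tloc) :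
    τ.quasiDeriv (F.1 + G.1) = τ.quasiDeriv F.1 + τ.quasiDeriv G.1 :=
  ((isTau_of_mem_Tloc hF).add (isTau_of_mem_Tloc hG)).quasiDeriv_eq

theorem quasiDeriv_smul (r : ℂ) (hF : F ∈ τ.Tloc) :
    τ.quasiDeriv (r • F.1) = r • τ.quasiDeriv F.1 :=
  ((isTau_of_mem_Tloc hF).smul r).quasiDeriv_eq

theorem quasiDeriv_star (hF : F ∈ τ.Tloc) : τ.quasiDeriv (star F.1) = star (τ.quasiDeriv F.1) :=
  (isTau_of_mem_Tloc hF).star.quasiDeriv_eq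

theorem V_add_left (hF : F ∈ τ.Tloc) (hG : G ∈ τ.Tloc) (H : (Interval a b → ℂ) × (Interval a b → ℂ))
    (x : Interval a b) : τ.V (F + G) H x = τ.V F H x + τ.V G H x := by
  simp only [V, Prod.fst_add, Prod.snd_add, quasiDeriv_add hF hG, Pi.add_apply]; ring

theorem V_smul_left (r : ℂ) (hF : F ∈ τ.Tloc) (H : (Interval a b → ℂ) × (Interval a b → ℂ))
    (x : Interval a b) : τ.V (r • F) H x = r * τ.V F H x := by
  simp only [V, Prod.smul_fst, Prod.smul_snd, quasiDeriv_smul r hF, Pi.smul_apply, smul_eq_mul]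
  ring

theorem V_star (hF : F ∈ τ.Tloc) (hG : G ∈ τ.Tloc) (x : Interval a b) :
    τ.V (star F) (star G) x = conj (τ.V F G x) := by
  simp [V, quasiDeriv_star hF, quasiDeriv_star hG]

theorem V_swap (τ : Coefficients a b) (F G : (Interval a b → ℂ) × (Interval a b → ℂ))
    (x : Interval a b) : τ.V F G x = -τ.V G F x := by
  simp only [V]; ring

/-- `V` is the determinant of the vectors `(f_τ, f^{[1]})` at `x`, and this is the Plücker relation
for four vectors in a plane. -/
theorem V_plucker (τ : Coefficients a b) (F G H K : (Interval a b → ℂ) × (Interval a b → ℂ))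
    (x : Interval a b) :
    τ.V F G x * τ.V H K x + τ.V F H x * τ.V K G x + τ.V F K x * τ.V G H x = 0 := by
  simp only [V]; ring

/-- The part of the Lagrange bracket that is integrated against `χ`. -/
def bracketChi (F G : (Interval a b → ℂ) × (Interval a b → ℂ)) (s : Interval a b) : ℂ :=
  F.2 s * G.1 s - F.1 s * G.2 s

theorem locallyIntegrable_bracketChi (hF : F ∈ τ.Tloc) (hG : G ∈ τ.Tloc) :
    LocallyIntegrable (bracketChi F G) τ.chi := by
  have hf₂ := hasRNDeriv_rnDeriv hF.2.1
  have hg₂ := hasRNDeriv_rnDeriv hG.2.1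
  have hf := isTau_of_mem_Tloc hF
  have hg := isTau_of_mem_Tloc hG
  exact (hf₂.locallyBdd.locallyIntegrable_mul hf₂.measurable hg.locallyIntegrable_chi).sub
    (hf.1.locallyBdd.locallyIntegrable_mul hf.1.measurable
      (hg₂.locallyBdd.locallyIntegrable hg₂.measurable))

theorem locallyIntegrable_bracketSigma {d e : Interval a b → ℂ} (hF : F ∈ τ.Tloc)
    (hG : G ∈ τ.Tloc) (hd : LocallyIntegrable d τ.sigma) (he : LocallyIntegrable e τ.sigma) :
    LocallyIntegrable (fun s => d s * τ.quasiDeriv G.1 s - τ.quasiDeriv F.1 s * e s) τ.sigma := by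
  have hf := isTau_of_mem_Tloc hF
  have hg := isTau_of_mem_Tloc hG
  have := (hg.locallyBdd.locallyIntegrable_mul hg.measurable hd)
  simp only [mul_comm (τ.quasiDeriv G.1 _)] at this
  exact this.sub (hf.locallyBdd.locallyIntegrable_mul hf.measurable he)

theorem V_sub_V {d e : Interval a b → ℂ} (hF : F ∈ τ.Tloc) (hd : HasRNDeriv τ.sigma F.2 d)
    (hG : G ∈ τ.Tloc) (he : HasRNDeriv τ.sigma G.2 e) (hxy : x ≤ y) :
    τ.V F G y - τ.V F G x = (∫ s in Ico x y, bracketChi F G s ∂τ.chi) +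
      ∫ s in Ico x y, (d s * τ.quasiDeriv G.1 s - τ.quasiDeriv F.1 s * e s) ∂τ.sigma :=
  (isTau_of_mem_Tloc hF).lagrange hd (isTau_of_mem_Tloc hG) he hxy

theorem V_eq {d e : Interval a b → ℂ} (hF : F ∈ τ.Tloc) (hd : HasRNDeriv τ.sigma F.2 d)
    (hG : G ∈ τ.Tloc) (he : HasRNDeriv τ.sigma G.2 e) (x y : Interval a b) :
    τ.V F G y = τ.V F G x + stieltjesIntegral τ.chi (bracketChi F G) x y +
      stieltjesIntegral τ.sigma
        (fun s => d s * τ.quasiDeriv G.1 s - τ.quasiDeriv F.1 s * e s) x y := by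
  rcases le_total x y with hxy | hxy
  · rw [stieltjesIntegral_of_le hxy, stieltjesIntegral_of_le hxy]
    linear_combination V_sub_V hF hd hG he hxy
  · rw [stieltjesIntegral_symm, stieltjesIntegral_of_le hxy,
      stieltjesIntegral_symm, stieltjesIntegral_of_le hxy]
    linear_combination -(V_sub_V hF hd hG he hxy)

theorem locallyBdd_V (hF : F ∈ τ.Tloc) (hG : G ∈ τ.Tloc) : LocallyBdd (τ.V F G) := by
  have hf₂ := (hasRNDeriv_rnDeriv hF.2.1).locallyBdd
  have hg₂ := (hasRNDeriv_rnDeriv hG.2.1).locallyBdd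
  have := (hf₂.mul (isTau_of_mem_Tloc hG).locallyBdd).add
    (((isTau_of_mem_Tloc hF).locallyBdd.mul hg₂).neg)
  intro x y
  obtain ⟨C, hC⟩ := this x y
  exact ⟨C, fun t ht => by simpa [V, sub_eq_add_neg] using hC t ht⟩

/-- `f` lies in `H¹(a,b)` near the end `l`. -/
def H1Near (τ : Coefficients a b) (l : Filter (Interval a b)) (f : Interval a b → ℂ) : Prop :=
  f ∈ ACloc τ.sigma ∧ ∃ J ∈ l, MemLp f 2 (τ.chi.restrict J) ∧
    MemLp (rnDeriv τ.sigma f) 2 (τ.sigma.restrict J)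

theorem h1NearLeft_iff {f : Interval a b → ℂ} : τ.H1NearLeft f ↔ τ.H1Near atBot f := by
  have := τ.nonempty_interval
  refine and_congr_right fun _ => ⟨fun ⟨c, h1, h2⟩ => ⟨_, Iio_mem_atBot c, h1, h2⟩, ?_⟩
  rintro ⟨J, hJ, h1, h2⟩
  obtain ⟨c, hc⟩ := mem_atBot_sets.1 hJ
  have : Iio c ⊆ J := fun t ht => hc t (le_of_lt ht)
  exact ⟨c, h1.mono_measure (Measure.restrict_mono_set _ this),
    h2.mono_measure (Measure.restrict_mono_set _ this)⟩

theorem h1NearRight_iff {f : Interval a b → ℂ} : τ.H1NearRight f ↔ τ.H1Near atTop f := by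
  have := τ.nonempty_interval
  refine and_congr_right fun _ => ⟨fun ⟨c, h1, h2⟩ => ⟨_, Ici_mem_atTop c, h1, h2⟩, ?_⟩
  rintro ⟨J, hJ, h1, h2⟩
  obtain ⟨c, hc⟩ := mem_atTop_sets.1 hJ
  have : Ici c ⊆ J := fun t ht => hc t ht
  exact ⟨c, h1.mono_measure (Measure.restrict_mono_set _ this),
    h2.mono_measure (Measure.restrict_mono_set _ this)⟩

theorem H1Near.of_hasRNDeriv {f q : Interval a b → ℂ} (hf : HasRNDeriv τ.sigma f q)
    {J : Set (Interval a b)} (hJ : J ∈ l) (h1 : MemLp f 2 (τ.chi.restrict J))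
    (h2 : MemLp q 2 (τ.sigma.restrict J)) : τ.H1Near l f :=
  ⟨⟨q, hf⟩, J, hJ, h1, (memLp_congr_ae (ae_restrict_of_ae hf.rnDeriv_ae_eq)).2 h2⟩

theorem H1Near.exists_memLp {f q : Interval a b → ℂ} (h : τ.H1Near l f)
    (hf : HasRNDeriv τ.sigma f q) : ∃ J ∈ l, ∀ J' ⊆ J, MemLp f 2 (τ.chi.restrict J') ∧
      MemLp q 2 (τ.sigma.restrict J') := by
  obtain ⟨-, J, hJ, h1, h2⟩ := h
  refine ⟨J, hJ, fun J' hJ' => ⟨h1.mono_measure (Measure.restrict_mono_set _ hJ'), ?_⟩⟩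
  exact ((memLp_congr_ae (ae_restrict_of_ae hf.rnDeriv_ae_eq)).1 h2).mono_measure
    (Measure.restrict_mono_set _ hJ')

theorem H1Near.add {f g : Interval a b → ℂ} (hf : τ.H1Near l f) (hg : τ.H1Near l g) :
    τ.H1Near l (f + g) := by
  obtain ⟨J, hJ, h1⟩ := hf.exists_memLp (hasRNDeriv_rnDeriv hf.1)
  obtain ⟨J', hJ', h2⟩ := hg.exists_memLp (hasRNDeriv_rnDeriv hg.1)
  have a1 := h1 _ (inter_subset_left (s := J) (t := J'))
  have a2 := h2 _ (inter_subset_right (s := J) (t := J'))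
  exact .of_hasRNDeriv ((hasRNDeriv_rnDeriv hf.1).add (hasRNDeriv_rnDeriv hg.1))
    (inter_mem hJ hJ') (a1.1.add a2.1) (a1.2.add a2.2)

theorem H1Near.smul {f : Interval a b → ℂ} (r : ℂ) (hf : τ.H1Near l f) : τ.H1Near l (r • f) := by
  obtain ⟨J, hJ, h1⟩ := hf.exists_memLp (hasRNDeriv_rnDeriv hf.1)
  exact .of_hasRNDeriv ((hasRNDeriv_rnDeriv hf.1).smul r) hJ
    ((h1 J le_rfl).1.const_smul r) ((h1 J le_rfl).2.const_smul r)

theorem H1Near.star {f : Interval a b → ℂ} (hf : τ.H1Near l f) : τ.H1Near l (star f) := by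
  obtain ⟨J, hJ, h1⟩ := hf.exists_memLp (hasRNDeriv_rnDeriv hf.1)
  exact .of_hasRNDeriv (hasRNDeriv_rnDeriv hf.1).star hJ (h1 J le_rfl).1.star (h1 J le_rfl).2.star

/-- The pair `F` lies in the maximal relation near the end `l`. -/
def TNear (τ : Coefficients a b) (l : Filter (Interval a b))
    (F : (Interval a b → ℂ) × (Interval a b → ℂ)) : Prop :=
  F ∈ τ.Tloc ∧ τ.H1Near l F.1 ∧ τ.H1Near l F.2

theorem TNear.add (hF : τ.TNear l F) (hG : τ.TNear l G) : τ.TNear l (F + G) :=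
  ⟨add_mem_Tloc hF.1 hG.1, hF.2.1.add hG.2.1, hF.2.2.add hG.2.2⟩

theorem TNear.smul (r : ℂ) (hF : τ.TNear l F) : τ.TNear l (r • F) :=
  ⟨smul_mem_Tloc r hF.1, hF.2.1.smul r, hF.2.2.smul r⟩

theorem TNear.star (hF : τ.TNear l F) : τ.TNear l (star F) :=
  ⟨star_mem_Tloc hF.1, hF.2.1.star, hF.2.2.star⟩

theorem IsSolution.tNear (hu : τ.IsSolution z u) (h : τ.H1Near l u) : τ.TNear l (u, z • u) :=
  ⟨hu.mem_Tloc, h, h.smul z⟩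

theorem TNear.exists_memLp (hF : τ.TNear l F) : ∃ J ∈ l, ∀ J' ⊆ J,
    (MemLp F.1 2 (τ.chi.restrict J') ∧ MemLp F.2 2 (τ.chi.restrict J')) ∧
    MemLp (τ.quasiDeriv F.1) 2 (τ.sigma.restrict J') ∧
    MemLp (rnDeriv τ.sigma F.2) 2 (τ.sigma.restrict J') := by
  obtain ⟨J, hJ, h1⟩ := hF.2.1.exists_memLp (isTau_of_mem_Tloc hF.1).1
  obtain ⟨J', hJ', h2⟩ := hF.2.2.exists_memLp (hasRNDeriv_rnDeriv hF.1.2.1)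
  refine ⟨J ∩ J', inter_mem hJ hJ', fun K hK => ?_⟩
  have a1 := h1 K (hK.trans inter_subset_left)
  have a2 := h2 K (hK.trans inter_subset_right)
  exact ⟨⟨a1.1, a2.1⟩, a1.2, a2.2⟩

/-- By the Lagrange identity `V` is a primitive of sums of products of functions that are `L²` near
the end, hence of functions integrable up to the end. -/
theorem TNear.exists_tendsto_V (hl : IsEnd l) (hF : τ.TNear l F) (hG : τ.TNear l G) :
    ∃ L, Tendsto (τ.V F G) l (𝓝 L) := by
  obtain ⟨J, hJ, h1⟩ := hF.exists_memLp
  obtain ⟨J', hJ', h2⟩ := hG.exists_memLp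
  obtain ⟨⟨a1, a2⟩, a3, a4⟩ := h1 _ (inter_subset_left (s := J) (t := J'))
  obtain ⟨⟨b1, b2⟩, b3, b4⟩ := h2 _ (inter_subset_right (s := J) (t := J'))
  obtain ⟨c⟩ := τ.nonempty_interval
  have hd := hasRNDeriv_rnDeriv hF.1.2.1
  have he := hasRNDeriv_rnDeriv hG.1.2.1
  obtain ⟨L1, hL1⟩ := hl.exists_tendsto_stieltjesIntegral
    (locallyIntegrable_bracketChi hF.1 hG.1) (inter_mem hJ hJ')
    ((a2.integrable_mul b1).sub (a1.integrable_mul b2)) c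
  obtain ⟨L2, hL2⟩ := hl.exists_tendsto_stieltjesIntegral
    (locallyIntegrable_bracketSigma hF.1 hG.1 hd.1 he.1) (inter_mem hJ hJ')
    ((a4.integrable_mul b3).sub (a3.integrable_mul b4)) c
  exact ⟨_, ((tendsto_const_nhds.add hL1).add hL2).congr fun y => (V_eq hF.1 hd hG.1 he c y).symm⟩

variable {v : (Interval a b → ℂ) × (Interval a b → ℂ)} {c : Interval a b}

theorem norm_stieltjesIntegral_le {μ : Measure (Interval a b)} {k : Interval a b → ℂ}
    {g : Interval a b → ℝ} {J : Set (Interval a b)} (hJ : OrdConnected J)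
    (hg : IntegrableOn g J μ) (hg0 : ∀ s, 0 ≤ g s) (hc : c ∈ J) (hx : x ∈ J)
    {M : ℝ} (hM : 0 ≤ M) (hk : ∀ s ∈ uIcc c x, ‖k s‖ ≤ M * g s) :
    ‖stieltjesIntegral μ k c x‖ ≤ M * ∫ s in J, g s ∂μ := by
  have key : ∀ c x, c ∈ J → x ∈ J → c ≤ x → (∀ s ∈ Icc c x, ‖k s‖ ≤ M * g s) →
      ‖∫ s in Ico c x, k s ∂μ‖ ≤ M * ∫ s in J, g s ∂μ := by
    intro c x hc hx hcx hk
    have hsub : Ico c x ⊆ J := Ico_subset_Icc_self.trans (hJ.out hc hx)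
    calc ‖∫ s in Ico c x, k s ∂μ‖ ≤ ∫ s in Ico c x, M * g s ∂μ := by
          refine norm_integral_le_of_norm_le ((hg.mono_set hsub).const_mul M) ?_
          filter_upwards [ae_restrict_mem measurableSet_Ico] with s hs
          exact hk s (Ico_subset_Icc_self hs)
      _ = M * ∫ s in Ico c x, g s ∂μ := integral_const_mul _ _
      _ ≤ _ := mul_le_mul_of_nonneg_left (setIntegral_mono_set hg (ae_of_all _ hg0)
          hsub.eventuallyLE) hM
  rcases le_total c x with h | h
  · rw [stieltjesIntegral_of_le h]
    exact key c x hc hx h (by rwa [uIcc_of_le h] at hk)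
  · rw [stieltjesIntegral_symm, norm_neg, stieltjesIntegral_of_le h]
    exact key x c hx hc h (by rwa [uIcc_of_ge h] at hk)

/-- If the Wronskian of two pairs that lie in the maximal relation near an end does not vanish
there, then all solutions lie in `H¹` near this end. -/
theorem h1Near_of_tendsto_V_ne_zero (hl : IsEnd l) (hF : τ.TNear l F) (hG : τ.TNear l G) {L : ℂ}
    (hL : Tendsto (τ.V F G) l (𝓝 L)) (hL0 : L ≠ 0) (hz : z ≠ 0) (hu : τ.IsSolution z u) :
    τ.H1Near l u := by
  have := τ.nonempty_interval
  have hlne : l.NeBot := by rcases hl with rfl | rfl <;> infer_instance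
  set U : (Interval a b → ℂ) × (Interval a b → ℂ) := (u, z • u) with hU
  have hUT : U ∈ τ.Tloc := hu.mem_Tloc
  set q := τ.quasiDeriv u
  have hqd : HasRNDeriv τ.sigma U.2 (z • q) := hu.isTau.1.smul z
  set dF := rnDeriv τ.sigma F.2
  set dG := rnDeriv τ.sigma G.2
  have hdF : HasRNDeriv τ.sigma F.2 dF := hasRNDeriv_rnDeriv hF.1.2.1
  have hdG : HasRNDeriv τ.sigma G.2 dG := hasRNDeriv_rnDeriv hG.1.2.1
  set qF := τ.quasiDeriv F.1
  set qG := τ.quasiDeriv G.1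
  obtain ⟨J₁, hJ₁, h1⟩ := hF.exists_memLp
  obtain ⟨J₂, hJ₂, h2⟩ := hG.exists_memLp
  set δ := ‖L‖ / 2
  have hδ : 0 < δ := half_pos (norm_pos_iff.2 hL0)
  have hz0 : 0 < ‖z‖ := norm_pos_iff.2 hz
  have hδ' : ∀ᶠ t in l, δ < ‖τ.V F G t‖ :=
    hL.norm.eventually (lt_mem_nhds (half_lt_self (norm_pos_iff.2 hL0)))
  set J₀ := (J₁ ∩ J₂) ∩ {t | δ < ‖τ.V F G t‖}
  have hJ₀ : J₀ ∈ l := inter_mem (inter_mem hJ₁ hJ₂) hδ'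
  obtain ⟨⟨a1, a2⟩, a3, a4⟩ := h1 J₀ (inter_subset_left.trans inter_subset_left)
  obtain ⟨⟨b1, b2⟩, b3, b4⟩ := h2 J₀ (inter_subset_left.trans inter_subset_right)
  -- Solving for `u` and `u^{[1]}` in terms of `V(u, F)` and `V(u, G)` turns the Lagrange identity
  -- into a linear integral system for these two functions. `kχ` and `kσ` dominate its kernels and
  -- are integrable as products of `L²` functions; division by `δ` uses `|V(F, G)| > δ`.
  set kχ : Interval a b → ℝ := fun s => (‖F.2 s‖ + ‖G.2 s‖) *
    (‖(z • G.1 - G.2) s‖ + ‖(z • F.1 - F.2) s‖) / (‖z‖ * δ)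
  set kσ : Interval a b → ℝ := fun s => (‖qF s‖ + ‖qG s‖) *
    (‖(z • qG - dG) s‖ + ‖(z • qF - dF) s‖) / δ
  have hkχ : IntegrableOn kχ J₀ τ.chi :=
    ((a2.norm.add b2.norm).integrable_mul
      (((b1.const_smul z).sub b2).norm.add ((a1.const_smul z).sub a2).norm)).div_const _
  have hkσ : IntegrableOn kσ J₀ τ.sigma :=
    ((a3.norm.add b3.norm).integrable_mul
      (((b3.const_smul z).sub b4).norm.add ((a3.const_smul z).sub a4).norm)).div_const _
  -- With both tails at most 1/8, each of the two Wronskians varies by at most a quarter of the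
  -- supremum of `N`, hence `N` by at most a half, which can be absorbed.
  obtain ⟨Jx, x1, x2, x3, x4, x5⟩ := hl.exists_tail hJ₀ hkχ (ε := 1 / 8) (by norm_num)
  obtain ⟨Js, s1, s2, s3, s4, s5⟩ := hl.exists_tail hJ₀ hkσ (ε := 1 / 8) (by norm_num)
  have kχ0 : ∀ s, 0 ≤ kχ s := fun s => by positivity
  have kσ0 : ∀ s, 0 ≤ kσ s := fun s => by positivity
  set J := Jx ∩ Js
  have hJ : J ∈ l := inter_mem x1 s1
  have hJo : OrdConnected J := x3.inter s3
  have hJJ₀ : J ⊆ J₀ := inter_subset_left.trans x2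
  have iχ : ∫ s in J, kχ s ∂τ.chi ≤ 1 / 8 :=
    (setIntegral_mono_set (hkχ.mono_set x2) (ae_of_all _ kχ0) inter_subset_left.eventuallyLE).trans
      x5.le
  have iσ : ∫ s in J, kσ s ∂τ.sigma ≤ 1 / 8 :=
    (setIntegral_mono_set (hkσ.mono_set s2) (ae_of_all _ kσ0) inter_subset_right.eventuallyLE).trans
      s5.le
  set N : Interval a b → ℝ := fun t => ‖τ.V U G t‖ + ‖τ.V U F t‖
  -- Cramer's rule: `z u V(F, G) = V(u, G) F_τ - V(u, F) G_τ`.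
  have hub : ∀ s ∈ J, ‖u s‖ * (‖z‖ * δ) ≤ N s * (‖F.2 s‖ + ‖G.2 s‖) := by
    intro s hs
    have e : z * u s * τ.V F G s = τ.V U G s * F.2 s - τ.V U F s * G.2 s := by
      simp only [V, hU, Pi.smul_apply, smul_eq_mul]; ring
    calc ‖u s‖ * (‖z‖ * δ) ≤ ‖u s‖ * (‖z‖ * ‖τ.V F G s‖) := by
          have : δ ≤ ‖τ.V F G s‖ := le_of_lt (hJJ₀ hs).2
          gcongr
      _ = ‖τ.V U G s * F.2 s - τ.V U F s * G.2 s‖ := by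
          rw [← e, norm_mul, norm_mul]; ring
      _ ≤ ‖τ.V U G s‖ * ‖F.2 s‖ + ‖τ.V U F s‖ * ‖G.2 s‖ := by
          refine (norm_sub_le _ _).trans ?_; rw [norm_mul, norm_mul]
      _ ≤ N s * (‖F.2 s‖ + ‖G.2 s‖) := by
          simp only [N]
          nlinarith [mul_nonneg (norm_nonneg (τ.V U G s)) (norm_nonneg (G.2 s)),
            mul_nonneg (norm_nonneg (τ.V U F s)) (norm_nonneg (F.2 s))]
  have hqb : ∀ s ∈ J, ‖q s‖ * δ ≤ N s * (‖qF s‖ + ‖qG s‖) := by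
    intro s hs
    have e : q s * τ.V F G s = τ.V U G s * qF s - τ.V U F s * qG s := by
      simp only [V, hU, Pi.smul_apply, smul_eq_mul]; ring
    calc ‖q s‖ * δ ≤ ‖q s‖ * ‖τ.V F G s‖ := by
          have : δ ≤ ‖τ.V F G s‖ := le_of_lt (hJJ₀ hs).2
          gcongr
      _ = ‖τ.V U G s * qF s - τ.V U F s * qG s‖ := by
          rw [← e, norm_mul]
      _ ≤ ‖τ.V U G s‖ * ‖qF s‖ + ‖τ.V U F s‖ * ‖qG s‖ := by
          refine (norm_sub_le _ _).trans ?_; rw [norm_mul, norm_mul]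
      _ ≤ N s * (‖qF s‖ + ‖qG s‖) := by
          simp only [N]
          nlinarith [mul_nonneg (norm_nonneg (τ.V U G s)) (norm_nonneg (qG s)),
            mul_nonneg (norm_nonneg (τ.V U F s)) (norm_nonneg (qF s))]
  have step : ∀ (K : (Interval a b → ℂ) × (Interval a b → ℂ)) (dK : Interval a b → ℂ),
      K ∈ τ.Tloc → HasRNDeriv τ.sigma K.2 dK →
      (∀ s, ‖(z • K.1 - K.2) s‖ ≤ ‖(z • G.1 - G.2) s‖ + ‖(z • F.1 - F.2) s‖) →
      (∀ s, ‖(z • τ.quasiDeriv K.1 - dK) s‖ ≤ ‖(z • qG - dG) s‖ + ‖(z • qF - dF) s‖) →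
      ∀ c ∈ J, ∀ x ∈ J, ∀ M, (∀ s ∈ uIcc c x, N s ≤ M) → ‖τ.V U K x - τ.V U K c‖ ≤ M / 4 := by
    intro K dK hK hdK k1 k2 c hc x hx M hM
    have hM0 : 0 ≤ M := le_trans (by positivity) (hM c left_mem_uIcc)
    have hsub : ∀ s ∈ uIcc c x, s ∈ J := fun s hs => hJo.uIcc_subset hc hx hs
    have e := V_eq hUT hqd hK hdK c x
    have e1 : ‖stieltjesIntegral τ.chi (bracketChi U K) c x‖ ≤ M * ∫ s in J, kχ s ∂τ.chi := by
      refine norm_stieltjesIntegral_le hJo (hkχ.mono_set hJJ₀) kχ0 hc hx hM0 fun s hs => ?_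
      have : bracketChi U K s = u s * (z • K.1 - K.2) s := by
        simp only [bracketChi, hU, Pi.smul_apply, Pi.sub_apply, smul_eq_mul]; ring
      rw [this, norm_mul]
      have hb := hub s (hsub s hs)
      have hb' : ‖u s‖ ≤ M * (‖F.2 s‖ + ‖G.2 s‖) / (‖z‖ * δ) := by
        rw [le_div_iff₀ (by positivity)]
        exact hb.trans (mul_le_mul_of_nonneg_right (hM s hs) (by positivity))
      calc _ ≤ (M * (‖F.2 s‖ + ‖G.2 s‖) / (‖z‖ * δ)) *
            (‖(z • G.1 - G.2) s‖ + ‖(z • F.1 - F.2) s‖) :=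
            mul_le_mul hb' (k1 s) (norm_nonneg _) (by positivity)
        _ = M * kχ s := by simp only [kχ]; ring
    have e2 : ‖stieltjesIntegral τ.sigma
        (fun s => (z • q) s * τ.quasiDeriv K.1 s - τ.quasiDeriv U.1 s * dK s) c x‖ ≤
        M * ∫ s in J, kσ s ∂τ.sigma := by
      refine norm_stieltjesIntegral_le hJo (hkσ.mono_set hJJ₀) kσ0 hc hx hM0 fun s hs => ?_
      have : (z • q) s * τ.quasiDeriv K.1 s - τ.quasiDeriv U.1 s * dK s =
          q s * (z • τ.quasiDeriv K.1 - dK) s := by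
        simp only [hU, Pi.smul_apply, Pi.sub_apply, smul_eq_mul, q]; ring
      rw [this, norm_mul]
      have hb := hqb s (hsub s hs)
      have hb' : ‖q s‖ ≤ M * (‖qF s‖ + ‖qG s‖) / δ := by
        rw [le_div_iff₀ (by positivity)]
        exact hb.trans (mul_le_mul_of_nonneg_right (hM s hs) (by positivity))
      calc _ ≤ (M * (‖qF s‖ + ‖qG s‖) / δ) *
            (‖(z • qG - dG) s‖ + ‖(z • qF - dF) s‖) :=
            mul_le_mul hb' (k2 s) (norm_nonneg _) (by positivity)
        _ = M * kσ s := by simp only [kσ]; ring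
    have e3 : τ.V U K x - τ.V U K c = stieltjesIntegral τ.chi (bracketChi U K) c x +
        stieltjesIntegral τ.sigma
          (fun s => (z • q) s * τ.quasiDeriv K.1 s - τ.quasiDeriv U.1 s * dK s) c x := by
      rw [e]; ring
    rw [e3]
    refine (norm_add_le _ _).trans ?_
    have := mul_le_mul_of_nonneg_left iχ hM0
    have := mul_le_mul_of_nonneg_left iσ hM0
    linarith
  obtain ⟨c, hc⟩ := hlne.nonempty_of_mem hJ
  have hN : ∀ x ∈ J, N x ≤ 2 * N c := by
    intro x hx
    obtain ⟨C₁, hC₁⟩ := locallyBdd_V hUT hG.1 (c ⊓ x) (c ⊔ x)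
    obtain ⟨C₂, hC₂⟩ := locallyBdd_V hUT hF.1 (c ⊓ x) (c ⊔ x)
    have hbdd : BddAbove (N '' uIcc c x) := by
      refine ⟨C₁ + C₂, ?_⟩
      rintro _ ⟨t, ht, rfl⟩
      exact add_le_add (hC₁ t ht) (hC₂ t ht)
    set M := sSup (N '' uIcc c x)
    have hM : ∀ s ∈ uIcc c x, N s ≤ M := fun s hs => le_csSup hbdd (mem_image_of_mem _ hs)
    -- The supremum `M` is finite by local boundedness, so this yields `M ≤ 2 N c` with a bound that
    -- does not depend on `x`.
    have hle : M ≤ N c + M / 2 := by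
      refine csSup_le ((nonempty_uIcc).image _) ?_
      rintro _ ⟨t, ht, rfl⟩
      have htJ : t ∈ J := hJo.uIcc_subset hc hx ht
      have hM' : ∀ s ∈ uIcc c t, N s ≤ M := fun s hs =>
        hM s (uIcc_subset_uIcc_left ht hs)
      have g1 := step G dG hG.1 hdG (fun s => le_add_of_nonneg_right (norm_nonneg _))
        (fun s => le_add_of_nonneg_right (norm_nonneg _)) c hc t htJ M hM'
      have g2 := step F dF hF.1 hdF (fun s => le_add_of_nonneg_left (norm_nonneg _))
        (fun s => le_add_of_nonneg_left (norm_nonneg _)) c hc t htJ M hM'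
      have t1 := norm_sub_norm_le (τ.V U G t) (τ.V U G c)
      have t2 := norm_sub_norm_le (τ.V U F t) (τ.V U F c)
      simp only [N]
      linarith
    have := hM x right_mem_uIcc
    linarith
  have hNc : 0 ≤ N c := by positivity
  obtain ⟨⟨-, c2⟩, c3, -⟩ := h1 J (hJJ₀.trans (inter_subset_left.trans inter_subset_left))
  obtain ⟨⟨-, d2⟩, d3, -⟩ := h2 J (hJJ₀.trans (inter_subset_left.trans inter_subset_right))
  have hJm : MeasurableSet J := x4.inter s4
  refine .of_hasRNDeriv hu.isTau.1 hJ ?_ ?_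
  · refine (c2.norm.add d2.norm).of_le_mul (c := 2 * N c / (‖z‖ * δ))
      hu.isTau.1.measurable.aestronglyMeasurable ?_
    filter_upwards [ae_restrict_mem hJm] with s hs
    have hb := (hub s hs).trans (mul_le_mul_of_nonneg_right (hN s hs) (by positivity))
    rw [Real.norm_of_nonneg (by simp only [Pi.add_apply]; positivity), div_mul_eq_mul_div,
      le_div_iff₀ (by positivity)]
    exact hb
  · refine (c3.norm.add d3.norm).of_le_mul (c := 2 * N c / δ)
      hu.isTau.measurable.aestronglyMeasurable ?_
    filter_upwards [ae_restrict_mem hJm] with s hs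
    have hb := (hqb s hs).trans (mul_le_mul_of_nonneg_right (hN s hs) (by positivity))
    rw [Real.norm_of_nonneg (by simp only [Pi.add_apply]; positivity), div_mul_eq_mul_div,
      le_div_iff₀ (by positivity)]
    exact hb

/-! ### Separated boundary conditions and their invariance under conjugation. -/

/-- The limit-circle case at the end `l`. -/
def LimitCircle (τ : Coefficients a b) (l : Filter (Interval a b)) : Prop :=
  ∀ z : ℂ, z ≠ 0 → ∀ u, τ.IsSolution z u → τ.H1Near l u

theorem limitCircleLeft_iff : τ.LimitCircleLeft ↔ τ.LimitCircle atBot := by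
  simp only [LimitCircleLeft, LimitCircle, h1NearLeft_iff]

theorem limitCircleRight_iff : τ.LimitCircleRight ↔ τ.LimitCircle atTop := by
  simp only [LimitCircleRight, LimitCircle, h1NearRight_iff]

/-- The limit exists, and a nonzero value would force the limit-circle case. -/
theorem TNear.tendsto_V_zero (hl : IsEnd l) (hlc : ¬τ.LimitCircle l) (hF : τ.TNear l F)
    (hG : τ.TNear l G) : Tendsto (τ.V F G) l (𝓝 0) := by
  obtain ⟨L, hL⟩ := hF.exists_tendsto_V hl hG
  by_cases h0 : L = 0
  · rwa [h0] at hL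
  · exact absurd (fun z hz u hu => h1Near_of_tendsto_V_ne_zero hl hF hG hL h0 hz hu) hlc

/-- `v` defines a self-adjoint boundary condition at the end `l`. -/
def IsBoundary (τ : Coefficients a b) (l : Filter (Interval a b))
    (v : (Interval a b → ℂ) × (Interval a b → ℂ)) : Prop :=
  τ.TNear l v ∧ (τ.LimitCircle l → Tendsto (τ.V v (star v)) l (𝓝 0) ∧
    ∃ f, τ.TNear l f ∧ ∃ c : ℂ, c ≠ 0 ∧ Tendsto (τ.V f (star v)) l (𝓝 c))

/-- The pair `F` lies in `S` near the end `l`. -/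
def InSNear (τ : Coefficients a b) (l : Filter (Interval a b))
    (v F : (Interval a b → ℂ) × (Interval a b → ℂ)) : Prop :=
  τ.TNear l F ∧ Tendsto (τ.V F (star v)) l (𝓝 0)

theorem H1Near.of_mem_H1 {f : Interval a b → ℂ} (hf : f ∈ τ.H1) : τ.H1Near l f :=
  ⟨hf.1, univ, univ_mem, by simpa using hf.2.1, by simpa using hf.2.2⟩

theorem TNear.of_mem_Tmax (hF : F ∈ τ.Tmax) : τ.TNear l F :=
  ⟨hF.2.2, .of_mem_H1 hF.1, .of_mem_H1 hF.2.1⟩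

theorem IsBoundaryLeft.isBoundary (hv : τ.IsBoundaryLeft v) : τ.IsBoundary atBot v := by
  refine ⟨.of_mem_Tmax hv.1, fun h => ?_⟩
  obtain ⟨h1, f, hf, h2⟩ := hv.2 (limitCircleLeft_iff.2 h)
  exact ⟨h1, f, .of_mem_Tmax hf, h2⟩

theorem IsBoundaryRight.isBoundary (hv : τ.IsBoundaryRight v) : τ.IsBoundary atTop v := by
  refine ⟨.of_mem_Tmax hv.1, fun h => ?_⟩
  obtain ⟨h1, f, hf, h2⟩ := hv.2 (limitCircleRight_iff.2 h)
  exact ⟨h1, f, .of_mem_Tmax hf, h2⟩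

/-- Outside the limit-circle case the boundary condition holds automatically, so both cases can be
handled by one definition. -/
theorem inSNear_iff (hl : IsEnd l) (hv : τ.IsBoundary l v) : τ.InSNear l v F ↔
    τ.TNear l F ∧ (τ.LimitCircle l → Tendsto (τ.V F (star v)) l (𝓝 0)) := by
  refine ⟨fun h => ⟨h.1, fun _ => h.2⟩, fun h => ⟨h.1, ?_⟩⟩
  by_cases hlc : τ.LimitCircle l
  · exact h.2 hlc
  · exact h.1.tendsto_V_zero hl hlc hv.1.star

theorem inSNearLeft_iff (hv : τ.IsBoundary atBot v) :
    τ.InSNearLeft v F ↔ τ.InSNear atBot v F := by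
  rw [inSNear_iff (Or.inl rfl) hv, InSNearLeft, h1NearLeft_iff, h1NearLeft_iff,
    limitCircleLeft_iff, TNear, and_assoc, and_assoc]

theorem inSNearRight_iff (hv : τ.IsBoundary atTop v) :
    τ.InSNearRight v F ↔ τ.InSNear atTop v F := by
  rw [inSNear_iff (Or.inr rfl) hv, InSNearRight, h1NearRight_iff, h1NearRight_iff,
    limitCircleRight_iff, TNear, and_assoc, and_assoc]

theorem InSNear.add (hF : τ.InSNear l v F) (hG : τ.InSNear l v G) : τ.InSNear l v (F + G) :=
  ⟨hF.1.add hG.1, by simpa using (hF.2.add hG.2).congr fun x =>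
    (V_add_left hF.1.1 hG.1.1 (star v) x).symm⟩

theorem InSNear.smul (r : ℂ) (hF : τ.InSNear l v F) : τ.InSNear l v (r • F) :=
  ⟨hF.1.smul r, by simpa using (hF.2.const_mul r).congr fun x =>
    (V_smul_left r hF.1.1 (star v) x).symm⟩

/-- In the limit-circle case take limits in the Plücker relation for `F`, `v^*`, `G` and a pair `f`
with `V(f, v^*) → c ≠ 0`. The two terms containing `V(F, v^*)` or `V(G, v^*)` vanish, leaving `c`
times the limit of `V(F, G)`. -/
theorem InSNear.tendsto_V (hl : IsEnd l) (hv : τ.IsBoundary l v) (hF : τ.InSNear l v F)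
    (hG : τ.InSNear l v G) : Tendsto (τ.V F G) l (𝓝 0) := by
  by_cases hlc : τ.LimitCircle l
  · obtain ⟨-, f, hf, c, hc, hlim⟩ := hv.2 hlc
    obtain ⟨L₁, h1⟩ := hG.1.exists_tendsto_V hl hf
    obtain ⟨L₂, h2⟩ := hF.1.exists_tendsto_V hl hf
    obtain ⟨L₃, h3⟩ := hF.1.exists_tendsto_V hl hG.1
    have e : ∀ x, τ.V F (star v) x * τ.V G f x + τ.V F f x * -τ.V G (star v) x =
        -(τ.V F G x * τ.V f (star v) x) := fun x => by
      rw [← V_swap τ (star v) G]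
      linear_combination V_plucker τ F (star v) G f x
    have t1 := ((hF.2.mul h1).add (h2.mul hG.2.neg)).congr e
    have := tendsto_nhds_unique_of_frequently_eq t1 (h3.mul hlim).neg
      (by
        have := τ.nonempty_interval
        have : l.NeBot := by rcases hl with rfl | rfl <;> infer_instance
        exact Frequently.of_forall fun _ => rfl)
    have hL : L₃ = 0 := by
      have : L₃ * c = 0 := by simpa using this.symm
      exact (mul_eq_zero.1 this).resolve_right hc
    rwa [hL] at h3
  · exact hF.1.tendsto_V_zero hl hlc hG.1

/-- `V(F^*, v^*)` is the conjugate of `V(F, v)`. In the limit-circle case `v` itself satisfies the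
boundary condition, so the preceding lemma applies to `F` and `v`. -/
theorem InSNear.star (hl : IsEnd l) (hv : τ.IsBoundary l v) (hF : τ.InSNear l v F) :
    τ.InSNear l v (star F) := by
  have hvS : τ.LimitCircle l → τ.InSNear l v v := fun h => ⟨hv.1, (hv.2 h).1⟩
  refine (inSNear_iff hl hv).2 ⟨hF.1.star, fun h => ?_⟩
  have h1 := (hF.tendsto_V hl hv (hvS h)).star
  simpa using h1.congr fun x => (V_star hF.1.1 hv.1.1 x).symm

/-! ### Completeness of `H¹(a,b)` and boundedness of point evaluations. -/

section Hilbert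

variable {f g q : Interval a b → ℂ}

theorem mem_H1_of_hasRNDeriv (hf : HasRNDeriv τ.sigma f q) (h1 : MemLp f 2 τ.chi)
    (h2 : MemLp q 2 τ.sigma) : f ∈ τ.H1 :=
  ⟨⟨q, hf⟩, h1, (memLp_congr_ae hf.rnDeriv_ae_eq).2 h2⟩

theorem hasRNDeriv_of_mem_H1 (hf : f ∈ τ.H1) : HasRNDeriv τ.sigma f (rnDeriv τ.sigma f) :=
  hasRNDeriv_rnDeriv hf.1

/-- `H¹(a,b)` as a linear space of functions. -/
def H1Submodule (τ : Coefficients a b) : Submodule ℂ (Interval a b → ℂ) where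
  carrier := τ.H1
  add_mem' hf hg := mem_H1_of_hasRNDeriv ((hasRNDeriv_of_mem_H1 hf).add (hasRNDeriv_of_mem_H1 hg))
    (hf.2.1.add hg.2.1) (hf.2.2.add hg.2.2)
  zero_mem' := mem_H1_of_hasRNDeriv .zero MemLp.zero MemLp.zero
  smul_mem' r _ hf := mem_H1_of_hasRNDeriv ((hasRNDeriv_of_mem_H1 hf).smul r)
    (hf.2.1.const_smul r) (hf.2.2.const_smul r)

theorem star_mem_H1 (hf : f ∈ τ.H1) : star f ∈ τ.H1 :=
  mem_H1_of_hasRNDeriv (hasRNDeriv_of_mem_H1 hf).star hf.2.1.star hf.2.2.star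

theorem normH1_star (hf : f ∈ τ.H1) : τ.normH1 (star f) = τ.normH1 f := by
  have h := (hasRNDeriv_of_mem_H1 hf).star.rnDeriv_ae_eq
  have e : ∫ x, ‖rnDeriv τ.sigma (star f) x‖ ^ 2 ∂τ.sigma =
      ∫ x, ‖rnDeriv τ.sigma f x‖ ^ 2 ∂τ.sigma := by
    refine integral_congr_ae ?_
    filter_upwards [h] with x hx
    simp [hx]
  rw [normH1, e, normH1]
  simp

/-- The embedding of `H¹(a,b)` into `L²(χ) × L²(ς)`. -/
def toLpProd (τ : Coefficients a b) :
    τ.H1Submodule →ₗ[ℂ] Lp ℂ 2 τ.chi × Lp ℂ 2 τ.sigma where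
  toFun f := (MemLp.toLp f.1 f.2.2.1, MemLp.toLp (rnDeriv τ.sigma f.1) f.2.2.2)
  map_add' f g := by
    refine Prod.ext (by exact MemLp.toLp_add f.2.2.1 g.2.2.1) ?_
    rw [Prod.snd_add, ← MemLp.toLp_add, MemLp.toLp_eq_toLp_iff]
    exact ((hasRNDeriv_of_mem_H1 f.2).add (hasRNDeriv_of_mem_H1 g.2)).rnDeriv_ae_eq
  map_smul' r f := by
    refine Prod.ext (by exact MemLp.toLp_const_smul r f.2.2.1) ?_
    rw [Prod.smul_snd, ← MemLp.toLp_const_smul, MemLp.toLp_eq_toLp_iff]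
    exact ((hasRNDeriv_of_mem_H1 f.2).smul r).rnDeriv_ae_eq

theorem norm_toLp_sq {μ : Measure (Interval a b)} (hf : MemLp f 2 μ) :
    ‖hf.toLp‖ ^ 2 = ∫ x, ‖f x‖ ^ 2 ∂μ := by
  have h2 := @inner_self_eq_norm_sq_to_K ℂ (Lp ℂ 2 μ) _ _ _ hf.toLp
  rw [L2.inner_def] at h2
  have h3 : ∫ x, inner ℂ ((hf.toLp : Lp ℂ 2 μ) x) ((hf.toLp : Lp ℂ 2 μ) x) ∂μ = ((∫ x, ‖f x‖ ^ 2 ∂μ : ℝ) : ℂ) := by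
    rw [← integral_complex_ofReal]
    refine integral_congr_ae ?_
    filter_upwards [hf.coeFn_toLp] with x hx
    rw [hx, inner_self_eq_norm_sq_to_K]; simp
  rw [h3] at h2
  have h4 : ((∫ x, ‖f x‖ ^ 2 ∂μ : ℝ) : ℂ) = ((‖(hf.toLp : Lp ℂ 2 μ)‖ ^ 2 : ℝ) : ℂ) := by
    rw [h2]; simp
  exact (Complex.ofReal_injective h4).symm

theorem normH1_eq (f : τ.H1Submodule) :
    τ.normH1 f = Real.sqrt (‖(τ.toLpProd f).1‖ ^ 2 + ‖(τ.toLpProd f).2‖ ^ 2) := by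
  rw [normH1, ← norm_toLp_sq f.2.2.1, ← norm_toLp_sq f.2.2.2]
  rfl

theorem norm_toLpProd_le (f : τ.H1Submodule) : ‖τ.toLpProd f‖ ≤ τ.normH1 f := by
  rw [normH1_eq, Prod.norm_def, max_le_iff]
  constructor <;> refine Real.le_sqrt_of_sq_le ?_
  · exact le_add_of_nonneg_right (by positivity)
  · exact le_add_of_nonneg_left (by positivity)

theorem normH1_le (f : τ.H1Submodule) : τ.normH1 f ≤ 2 * ‖τ.toLpProd f‖ := by
  rw [normH1_eq]
  refine Real.sqrt_le_iff.2 ⟨by positivity, ?_⟩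
  have h1 := norm_fst_le (τ.toLpProd f)
  have h2 := norm_snd_le (τ.toLpProd f)
  nlinarith [norm_nonneg (τ.toLpProd f).1, norm_nonneg (τ.toLpProd f).2,
    norm_nonneg (τ.toLpProd f)]

/-- Cauchy–Schwarz on a set of finite measure, with constant `μ(A)^{1/2}`. -/
theorem exists_integral_norm_le {μ : Measure (Interval a b)} {A : Set (Interval a b)}
    (hA : μ A ≠ ⊤) : ∃ C : ℝ, 0 ≤ C ∧ ∀ f : Lp ℂ 2 μ, IntegrableOn f A μ ∧
      ∫ s in A, ‖f s‖ ∂μ ≤ C * ‖f‖ := by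
  refine ⟨(μ A ^ (1 / 2 : ℝ)).toReal, ENNReal.toReal_nonneg, fun f => ?_⟩
  have hfin : IsFiniteMeasure (μ.restrict A) := ⟨by simpa using hA.lt_top⟩
  have hm : MemLp f 2 μ := Lp.memLp f
  have hi : IntegrableOn f A μ := (hm.restrict A).integrable one_le_two
  refine ⟨hi, ?_⟩
  have h1 : eLpNorm f 1 (μ.restrict A) ≤ eLpNorm f 2 (μ.restrict A) * μ A ^ (1 / 2 : ℝ) := by
    have := eLpNorm_le_eLpNorm_mul_rpow_measure_univ (p := 1) (q := 2) (by norm_num)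
      (hm.restrict A).aestronglyMeasurable
    convert this using 2
    rw [Measure.restrict_apply_univ]
    norm_num
  have h2 : eLpNorm f 1 (μ.restrict A) ≤ eLpNorm f 2 μ * μ A ^ (1 / 2 : ℝ) :=
    h1.trans (mul_le_mul_left (eLpNorm_mono_measure _ Measure.restrict_le_self) _)
  rw [integral_norm_eq_lintegral_enorm hi.aestronglyMeasurable, ← eLpNorm_one_eq_lintegral_enorm,
    Lp.norm_def, mul_comm, ← ENNReal.toReal_mul]
  refine ENNReal.toReal_mono (ENNReal.mul_ne_top hm.2.ne ?_) h2
  exact ENNReal.rpow_ne_top_of_nonneg (by norm_num) hA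

theorem exists_chi_Ico_ne_zero (τ : Coefficients a b) : ∃ p r, τ.chi (Ico p r) ≠ 0 := by
  by_contra hcon
  push Not at hcon
  have := τ.nonempty_interval
  obtain ⟨u, hu⟩ := exists_seq_tendsto (atTop : Filter (Interval a b))
  obtain ⟨v, hv⟩ := exists_seq_tendsto (atBot : Filter (Interval a b))
  have hU : (⋃ n, Ico (v n) (u n)) = univ := by
    refine eq_univ_of_forall fun x => mem_iUnion.2 ?_
    obtain ⟨n, hn⟩ := ((hu.eventually_gt_atTop x).and (hv.eventually_le_atBot x)).exists
    exact ⟨n, hn.2, hn.1⟩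
  apply τ.chi_ne_zero
  rw [← Measure.measure_univ_eq_zero, ← hU]
  exact measure_iUnion_null fun n => hcon _ _

/-- Point evaluations are bounded on `H¹(a,b)`. -/
theorem exists_norm_apply_le (τ : Coefficients a b) (x : Interval a b) :
    ∃ C : ℝ, 0 ≤ C ∧ ∀ f : τ.H1Submodule, ‖f.1 x‖ ≤ C * ‖τ.toLpProd f‖ := by
  obtain ⟨p', r', hpr⟩ := τ.exists_chi_Ico_ne_zero
  set p := min p' x
  set r := max r' x
  have hχ : τ.chi (Ico p r) ≠ 0 := fun h0 => hpr
    (measure_mono_null (Ico_subset_Ico (min_le_left _ _) (le_max_left _ _)) h0)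
  have hχt : τ.chi (Ico p r) ≠ ⊤ := (measure_Ico_lt_top p r).ne
  obtain ⟨C₁, hC₁, h1⟩ := exists_integral_norm_le hχt
  obtain ⟨C₂, hC₂, h2⟩ := exists_integral_norm_le (measure_Ico_lt_top (μ := τ.sigma) p r).ne
  set m := (τ.chi (Ico p r)).toReal
  have hm : 0 < m := ENNReal.toReal_pos hχ hχt
  refine ⟨C₁ / m + C₂, by positivity, fun f => ?_⟩
  have hd := hasRNDeriv_of_mem_H1 f.2
  set d := rnDeriv τ.sigma f.1
  have b1 : ∫ s in Ico p r, ‖f.1 s‖ ∂τ.chi ≤ C₁ * ‖τ.toLpProd f‖ := by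
    have e : ∫ s in Ico p r, ‖f.1 s‖ ∂τ.chi = ∫ s in Ico p r, ‖(τ.toLpProd f).1 s‖ ∂τ.chi := by
      refine integral_congr_ae (ae_restrict_of_ae ?_)
      filter_upwards [f.2.2.1.coeFn_toLp] with s hs
      exact (congrArg norm hs).symm
    rw [e]
    exact (h1 _).2.trans (mul_le_mul_of_nonneg_left (norm_fst_le _) hC₁)
  have b2 : ∫ s in Ico p r, ‖d s‖ ∂τ.sigma ≤ C₂ * ‖τ.toLpProd f‖ := by
    have e : ∫ s in Ico p r, ‖d s‖ ∂τ.sigma = ∫ s in Ico p r, ‖(τ.toLpProd f).2 s‖ ∂τ.sigma := by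
      refine integral_congr_ae (ae_restrict_of_ae ?_)
      filter_upwards [f.2.2.2.coeFn_toLp] with s hs
      exact (congrArg norm hs).symm
    rw [e]
    exact (h2 _).2.trans (mul_le_mul_of_nonneg_left (norm_snd_le _) hC₂)
  have hi : IntegrableOn (fun s => ‖d s‖) (Ico p r) τ.sigma := (integrableOn_Ico hd.1 p r).norm
  -- This bound by `|f(s)|` plus the variation of `f` is then averaged over `s` against `χ`; the
  -- interval was chosen to have positive `χ`-measure.
  have b3 : ∀ s ∈ Ico p r, ‖f.1 x‖ ≤ ‖f.1 s‖ + ∫ t in Ico p r, ‖d t‖ ∂τ.sigma := by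
    intro s hs
    have key : ‖stieltjesIntegral τ.sigma d s x‖ ≤ ∫ t in Ico p r, ‖d t‖ ∂τ.sigma := by
      rcases le_total s x with h | h
      · rw [stieltjesIntegral_of_le h]
        exact (norm_integral_le_integral_norm _).trans (setIntegral_mono_set hi
          (ae_of_all _ fun _ => norm_nonneg _)
          (Ico_subset_Ico hs.1 (le_max_right _ _)).eventuallyLE)
      · rw [stieltjesIntegral_symm, norm_neg, stieltjesIntegral_of_le h]
        exact (norm_integral_le_integral_norm _).trans (setIntegral_mono_set hi
          (ae_of_all _ fun _ => norm_nonneg _)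
          (Ico_subset_Ico (min_le_right _ _) hs.2.le).eventuallyLE)
    rw [hd.2 s x]
    exact (norm_add_le _ _).trans (add_le_add_right key _)
  have b4 : m * ‖f.1 x‖ ≤ (∫ s in Ico p r, ‖f.1 s‖ ∂τ.chi) +
      m * ∫ t in Ico p r, ‖d t‖ ∂τ.sigma := by
    have hfin : IsFiniteMeasure (τ.chi.restrict (Ico p r)) := ⟨by simpa using hχt.lt_top⟩
    have i1 : IntegrableOn (fun s => ‖f.1 s‖) (Ico p r) τ.chi :=
      ((f.2.2.1.restrict _).integrable one_le_two).norm
    have := setIntegral_mono_on (μ := τ.chi) (s := Ico p r) (f := fun _ => ‖f.1 x‖)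
      (g := fun s => ‖f.1 s‖ + ∫ t in Ico p r, ‖d t‖ ∂τ.sigma) (integrable_const _)
      (i1.add (integrable_const _)) measurableSet_Ico b3
    rw [integral_add i1 (integrable_const _)] at this
    simpa [Measure.real, m] using this
  have b5 : m * ‖f.1 x‖ ≤ m * ((C₁ / m + C₂) * ‖τ.toLpProd f‖) := by
    calc _ ≤ C₁ * ‖τ.toLpProd f‖ + m * (C₂ * ‖τ.toLpProd f‖) :=
          b4.trans (add_le_add b1 (mul_le_mul_of_nonneg_left b2 hm.le))
      _ = _ := by field_simp
  exact le_of_mul_le_mul_left b5 hm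

theorem toLpProd_injective (τ : Coefficients a b) : Function.Injective τ.toLpProd := by
  rw [← LinearMap.ker_eq_bot, LinearMap.ker_eq_bot']
  intro f hf
  ext x
  obtain ⟨C, -, hC⟩ := τ.exists_norm_apply_le x
  have := hC f
  rw [hf, norm_zero, mul_zero] at this
  exact norm_le_zero_iff.1 this

/-- If the images converge, bounded point evaluations provide a pointwise limit `F`. Integrals over
`[x, y)` pass to the limit, so `F` is a primitive of the second component, and an almost everywhere
convergent subsequence identifies `F` with the first. -/
theorem isClosed_range_toLpProd (τ : Coefficients a b) :
    IsClosed (LinearMap.range τ.toLpProd : Set (Lp ℂ 2 τ.chi × Lp ℂ 2 τ.sigma)) := by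
  refine IsSeqClosed.isClosed fun u P hu hP => ?_
  choose f hf using hu
  have hcau : ∀ x, ∃ L, Tendsto (fun n => (f n).1 x) atTop (𝓝 L) := by
    intro x
    obtain ⟨C, hC0, hC⟩ := τ.exists_norm_apply_le x
    refine cauchySeq_tendsto_of_complete ?_
    have hu : CauchySeq u := hP.cauchySeq
    rw [Metric.cauchySeq_iff'] at hu ⊢
    intro ε hε
    obtain ⟨N, hN⟩ := hu (ε / (C + 1)) (by positivity)
    refine ⟨N, fun n hn => ?_⟩
    have h1 := hC (f n - f N)
    rw [map_sub, hf, hf, ← dist_eq_norm] at h1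
    have h2 : dist ((f n).1 x) ((f N).1 x) ≤ C * dist (u n) (u N) := by
      rw [dist_eq_norm]; exact h1
    have h3 := hN n hn
    rw [lt_div_iff₀ (by positivity)] at h3
    nlinarith [dist_nonneg (x := u n) (y := u N)]
  choose F hF using hcau
  have hP1 : Tendsto (fun n => (u n).1) atTop (𝓝 P.1) := (continuous_fst.tendsto P).comp hP
  have hP2 : Tendsto (fun n => (u n).2) atTop (𝓝 P.2) := (continuous_snd.tendsto P).comp hP
  have hloc : LocallyIntegrable P.2 τ.sigma := locallyIntegrable_of_Ico fun x y => by
    obtain ⟨C, -, hC⟩ := exists_integral_norm_le (measure_Ico_lt_top (μ := τ.sigma) x y).ne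
    exact (hC P.2).1
  have hFd : HasRNDeriv τ.sigma F P.2 := by
    refine .of_le hloc fun x y hxy => ?_
    obtain ⟨C, hC0, hC⟩ := exists_integral_norm_le (measure_Ico_lt_top (μ := τ.sigma) x y).ne
    have t1 : Tendsto (fun n => (f n).1 y - (f n).1 x) atTop (𝓝 (F y - F x)) := (hF y).sub (hF x)
    refine tendsto_nhds_unique t1 ?_
    have e : ∀ n, (f n).1 y - (f n).1 x = ∫ s in Ico x y, (u n).2 s ∂τ.sigma := by
      intro n
      rw [(hasRNDeriv_of_mem_H1 (f n).2).sub_eq hxy]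
      refine integral_congr_ae (ae_restrict_of_ae ?_)
      filter_upwards [(f n).2.2.2.coeFn_toLp] with s hs
      rw [← hf n]; exact hs.symm
    simp_rw [e]
    rw [tendsto_iff_norm_sub_tendsto_zero]
    have hz : Tendsto (fun n => C * ‖(u n).2 - P.2‖) atTop (𝓝 0) := by
      simpa using (tendsto_iff_norm_sub_tendsto_zero.1 hP2).const_mul C
    refine squeeze_zero (fun _ => norm_nonneg _) (fun n => ?_) hz
    rw [← integral_sub (hC _).1 (hC _).1]
    refine (norm_integral_le_integral_norm _).trans (le_trans (le_of_eq ?_) (hC _).2)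
    refine integral_congr_ae (ae_restrict_of_ae ?_)
    filter_upwards [Lp.coeFn_sub (u n).2 P.2] with s hs
    rw [hs]; rfl
  have hFae : F =ᵐ[τ.chi] P.1 := by
    have hm := tendstoInMeasure_of_tendsto_Lp hP1
    obtain ⟨ns, hns, hae⟩ := hm.exists_seq_tendsto_ae
    have hall : ∀ᵐ s ∂τ.chi, ∀ n, (u n).1 s = (f n).1 s := by
      rw [ae_all_iff]
      intro n
      filter_upwards [(f n).2.2.1.coeFn_toLp] with s hs
      rw [← hf n]; exact hs
    filter_upwards [hae, hall] with s hs hs'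
    refine tendsto_nhds_unique ((hF s).comp hns.tendsto_atTop) (hs.congr fun n => ?_)
    exact hs' (ns n)
  have hFH : F ∈ τ.H1 := mem_H1_of_hasRNDeriv hFd ((memLp_congr_ae hFae).2 (Lp.memLp _)) (Lp.memLp _)
  refine ⟨⟨F, hFH⟩, Prod.ext ?_ ?_⟩
  · refine Lp.ext ?_
    exact (hFH.2.1.coeFn_toLp).trans hFae
  · refine Lp.ext ?_
    exact (hFH.2.2.coeFn_toLp).trans hFd.rnDeriv_ae_eq

end Hilbert

/-! ### Analytic dependence of the resolvent of a linear relation. -/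

section Resolvent

variable {S : Set ((Interval a b → ℂ) × (Interval a b → ℂ))} {z₀ : ℂ}

/-- The solution operator of `f = T (g + (z - z₀) f)` depends analytically on `z`. -/
theorem exists_analyticAt_solution {X : Type*} [NormedAddCommGroup X] [NormedSpace ℂ X]
    [CompleteSpace X] (T : X →L[ℂ] X) (z₀ : ℂ) : ∃ Q : ℂ → X →L[ℂ] X,
      (∀ (ev : X →L[ℂ] ℂ) (p : X), AnalyticAt ℂ (fun z => ev (Q z p)) z₀) ∧
      ∀ᶠ z in 𝓝 z₀, ∀ f g, f = T (g + (z - z₀) • f) ↔ f = Q z g := by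
  -- The equation reads `(1 - (z - z₀) T) f = T g`, and the operator on the left is invertible for
  -- `z` near `z₀`.
  let A : ℂ → (X →L[ℂ] X) := fun z => 1 - (z - z₀) • T
  have hAan : AnalyticAt ℂ A z₀ :=
    analyticAt_const.sub ((analyticAt_id.sub analyticAt_const).smul analyticAt_const)
  have hA0 : A z₀ = 1 := by simp [A]
  have hinv : AnalyticAt ℂ (fun z => Ring.inverse (A z)) z₀ := by
    refine AnalyticAt.fun_comp (g := Ring.inverse) ?_ hAan
    rw [hA0]; exact analyticAt_inverse (𝕜 := ℂ) (1 : (X →L[ℂ] X)ˣ)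
  have hunit : ∀ᶠ z in 𝓝 z₀, IsUnit (A z) := by
    have h1 : ∀ᶠ B in 𝓝 (A z₀), IsUnit B :=
      Units.isOpen.mem_nhds (by rw [hA0]; exact isUnit_one)
    exact hAan.continuousAt.eventually h1
  refine ⟨fun z => Ring.inverse (A z) * T, fun ev p => ?_, ?_⟩
  · have h1 : AnalyticAt ℂ (fun z => Ring.inverse (A z) (T p)) z₀ :=
      ((ContinuousLinearMap.apply ℂ X (T p)).analyticAt _).comp hinv
    exact (ev.analyticAt _).comp h1
  · filter_upwards [hunit] with z hz f g
    have e2 : A z f = f - (z - z₀) • T f := rfl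
    rw [map_add, map_smul]
    constructor
    · intro h
      have h3 : A z f = T g := by rw [e2]; nth_rewrite 1 [h]; abel
      change _ = Ring.inverse (A z) (T g)
      rw [← h3]
      exact (congrArg (fun B : X →L[ℂ] X => B f) (Ring.inverse_mul_cancel _ hz)).symm
    · intro h
      have h3 : A z f = T g := by
        rw [h]
        exact congrArg (fun B : X →L[ℂ] X => B (T g)) (Ring.mul_inverse_cancel _ hz)
      rw [e2] at h3
      rw [← h3]; abel

/-- Around a point of the resolvent set of a linear relation, the resolvent exists and its values
depend analytically on the spectral parameter. -/
theorem exists_analyticAt_resolvent (hadd : ∀ F ∈ S, ∀ G ∈ S, F + G ∈ S)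
    (hsmul : ∀ (r : ℂ), ∀ F ∈ S, r • F ∈ S) (hz₀ : z₀ ∈ τ.resolventSet S)
    {g : Interval a b → ℂ} (hg : g ∈ τ.H1) :
    ∃ w : ℂ → Interval a b → ℂ, (∀ x, AnalyticAt ℂ (fun z => w z x) z₀) ∧
      ∀ᶠ z in 𝓝 z₀, z ∈ τ.resolventSet S ∧ w z ∈ τ.H1 ∧ (w z, g + z • w z) ∈ S := by
  obtain ⟨hex, C, hC⟩ := hz₀
  choose R hR hRu using hex
  simp only at hR hRu
  let Rl : τ.H1Submodule →ₗ[ℂ] τ.H1Submodule :=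
    { toFun := fun g => ⟨R g.1 g.2, (hR g.1 g.2).1⟩
      map_add' := fun g h => by
        refine Subtype.ext (hRu _ _ _ ⟨τ.H1Submodule.add_mem (hR g.1 g.2).1 (hR h.1 h.2).1, ?_⟩).symm
        convert hadd _ (hR g.1 g.2).2 _ (hR h.1 h.2).2 using 1
        refine Prod.ext rfl ?_
        simp only [Prod.snd_add, Submodule.coe_add, smul_add]; abel
      map_smul' := fun r g => by
        refine Subtype.ext (hRu _ _ _ ⟨τ.H1Submodule.smul_mem r (hR g.1 g.2).1, ?_⟩).symm
        convert hsmul r _ (hR g.1 g.2).2 using 1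
        refine Prod.ext rfl ?_
        simp only [Prod.smul_snd, Submodule.coe_smul, smul_add, smul_comm r z₀] }
  have hRl : ∀ (g f : τ.H1Submodule), (f.1, g.1 + z₀ • f.1) ∈ S ↔ f = Rl g := by
    intro g f
    refine ⟨fun h => Subtype.ext (hRu g.1 g.2 _ ⟨f.2, h⟩), ?_⟩
    rintro rfl
    exact (hR g.1 g.2).2
  -- The resolvent at `z₀` is transported to the closed range of the embedding, a complete space
  -- whose norm is equivalent to `normH1`.
  set X := LinearMap.range τ.toLpProd
  have hX : CompleteSpace X := τ.isClosed_range_toLpProd.completeSpace_coe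
  let e : τ.H1Submodule ≃ₗ[ℂ] X := LinearEquiv.ofInjective τ.toLpProd τ.toLpProd_injective
  have he : ∀ f, ‖e f‖ = ‖τ.toLpProd f‖ := fun f => rfl
  have heS : ∀ P : X, ‖P‖ = ‖τ.toLpProd (e.symm P)‖ := fun P => by rw [← he, e.apply_symm_apply]
  let T₀ : X →ₗ[ℂ] X := e.toLinearMap ∘ₗ Rl ∘ₗ e.symm.toLinearMap
  let T : X →L[ℂ] X := T₀.mkContinuous (|C| * 2) fun P => by
    have h1 : ‖T₀ P‖ = ‖τ.toLpProd (Rl (e.symm P))‖ := he _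
    rw [h1, heS P]
    have h2 := hC (e.symm P).1 (e.symm P).2 (Rl (e.symm P)).1 (Rl (e.symm P)).2
      ((hRl (e.symm P) _).2 rfl)
    calc _ ≤ τ.normH1 (Rl (e.symm P)) := norm_toLpProd_le _
      _ ≤ C * τ.normH1 (e.symm P) := h2
      _ ≤ |C| * τ.normH1 (e.symm P) := by
        gcongr
        · exact Real.sqrt_nonneg _
        · exact le_abs_self C
      _ ≤ |C| * (2 * ‖τ.toLpProd (e.symm P)‖) := by gcongr; exact normH1_le _
      _ = _ := by ring
  have hT : ∀ f : τ.H1Submodule, T (e f) = e (Rl f) := fun f => by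
    change e (Rl (e.symm (e f))) = _
    rw [e.symm_apply_apply]
  obtain ⟨Q, hQan, hQ⟩ := exists_analyticAt_solution T z₀
  -- Since `g + z f = (g + (z - z₀) f) + z₀ f`, membership in `S` at `z` is a fixed point equation
  -- for the resolvent at `z₀`.
  have key : ∀ z, (∀ f g, f = T (g + (z - z₀) • f) ↔ f = Q z g) → ∀ g f : τ.H1Submodule,
      (f.1, g.1 + z • f.1) ∈ S ↔ e f = Q z (e g) := by
    intro z hz g f
    have e1 : (f.1, g.1 + z • f.1) = (f.1, (g + (z - z₀) • f).1 + z₀ • f.1) := by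
      refine Prod.ext rfl ?_
      simp only [Submodule.coe_add, Submodule.coe_smul, sub_smul]; abel
    rw [e1, hRl, ← e.injective.eq_iff, ← hT, map_add, map_smul, hz]
  refine ⟨fun z => (e.symm (Q z (e ⟨g, hg⟩))).1, fun x => ?_, ?_⟩
  · obtain ⟨C', hC'0, hC'⟩ := τ.exists_norm_apply_le x
    let ev : X →L[ℂ] ℂ := LinearMap.mkContinuous
      ((LinearMap.proj x) ∘ₗ τ.H1Submodule.subtype ∘ₗ e.symm.toLinearMap) C' fun P => by
        rw [heS P]; exact hC' _
    exact hQan ev (e ⟨g, hg⟩)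
  · filter_upwards [hQ] with z hz
    refine ⟨⟨fun g hg => ⟨(e.symm (Q z (e ⟨g, hg⟩))).1, ⟨Subtype.prop _, ?_⟩, ?_⟩,
      2 * ‖Q z‖, ?_⟩, Subtype.prop _, ?_⟩
    · exact (key z hz ⟨g, hg⟩ _).2 (e.apply_symm_apply _)
    · rintro f ⟨hf, hfS⟩
      have := (key z hz ⟨g, hg⟩ ⟨f, hf⟩).1 hfS
      rw [← this, e.symm_apply_apply]
    · intro g hg f hf hfS
      have h1 := (key z hz ⟨g, hg⟩ ⟨f, hf⟩).1 hfS
      calc τ.normH1 f ≤ 2 * ‖e ⟨f, hf⟩‖ := normH1_le ⟨f, hf⟩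
        _ ≤ 2 * (‖Q z‖ * ‖e ⟨g, hg⟩‖) := by
          rw [h1]; gcongr; exact (Q z).le_opNorm _
        _ ≤ 2 * (‖Q z‖ * τ.normH1 g) := by gcongr; exact norm_toLpProd_le ⟨g, hg⟩
        _ = _ := by ring
    · exact (key z hz ⟨g, hg⟩ _).2 (e.apply_symm_apply _)

end Resolvent

end Coefficients

/-! ### Localisation of derivatives and of square integrability. -/

section Local

variable {μ : Measure (Interval a b)} {f g h k : Interval a b → ℂ} {d : Interval a b}

open Classical in
-- Gluing `g` to `f` at `d` returns `f`, so the glued derivative is a derivative of `f` and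
-- coincides with `h` almost everywhere.
theorem HasRNDeriv.ae_eq_of_eqOn_Ici [SFinite μ] (hf : HasRNDeriv μ f h) (hg : HasRNDeriv μ g k)
    (hfg : EqOn f g (Ici d)) : ∀ᵐ s ∂μ.restrict (Ici d), h s = k s := by
  have h1 := hf.glue hg (hfg (mem_Ici.2 le_rfl))
  have h2 : (Iio d).piecewise f g = f := by
    ext x
    rcases lt_or_ge x d with hx | hx
    · exact piecewise_eq_of_mem (Iio d) _ _ hx
    · rw [piecewise_eq_of_notMem (Iio d) _ _ (by simpa using hx)]
      exact (hfg hx).symm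
  rw [h2] at h1
  rw [ae_restrict_iff' measurableSet_Ici]
  filter_upwards [hf.ae_eq h1] with s hs hsd
  rw [hs, piecewise_eq_of_notMem (Iio d) _ _ (by simpa using hsd)]

/-- A complex-valued integrand allows the tail lemmas at the ends to be applied to `|f|²`. -/
theorem memLp_two_iff_integrable_mul_conj (hf : AEStronglyMeasurable f μ) :
    MemLp f 2 μ ↔ Integrable (fun s => f s * conj (f s)) μ := by
  have hm : AEStronglyMeasurable (fun s => f s * conj (f s)) μ := hf.mul hf.star
  rw [memLp_two_iff_integrable_sq_norm hf, ← integrable_norm_iff hm]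
  refine integrable_congr (ae_of_all _ fun s => ?_)
  simp [sq]

theorem LocallyBdd.conj (hf : LocallyBdd f) : LocallyBdd (fun s => conj (f s)) := by
  intro x y
  obtain ⟨C, hC⟩ := hf x y
  exact ⟨C, fun t ht => by simpa using hC t ht⟩

theorem locallyIntegrable_mul_conj [IsLocallyFiniteMeasure μ] (hf : LocallyBdd f)
    (hm : Measurable f) : LocallyIntegrable (fun s => f s * conj (f s)) μ :=
  hf.locallyIntegrable_mul hm
    (hf.conj.locallyIntegrable (Complex.continuous_conj.measurable.comp hm))

theorem memLp_of_near_ends [IsLocallyFiniteMeasure μ] (hf : LocallyBdd f) (hm : Measurable f)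
    {J J' : Set (Interval a b)} (hJ : J ∈ atBot) (hJ' : J' ∈ atTop)
    (h1 : MemLp f 2 (μ.restrict J)) (h2 : MemLp f 2 (μ.restrict J')) : MemLp f 2 μ := by
  rcases isEmpty_or_nonempty (Interval a b) with hE | ⟨⟨c⟩⟩
  · rw [Measure.eq_zero_of_isEmpty μ]; exact memLp_measure_zero
  rw [memLp_two_iff_integrable_mul_conj hm.aestronglyMeasurable] at h1 h2 ⊢
  have hl := locallyIntegrable_mul_conj hf hm (μ := μ)
  have := (integrableOn_Iio hJ h1 hl c).union (integrableOn_Ici hJ' h2 hl c)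
  rwa [Iio_union_Ici, integrableOn_univ] at this

end Local

namespace Coefficients

variable {τ : Coefficients a b} {F G U va vb v : (Interval a b → ℂ) × (Interval a b → ℂ)}
  {x y c d : Interval a b} {l : Filter (Interval a b)} {u θ φ : Interval a b → ℂ} {z : ℂ}

/-! ### The relation `S`: linearity, conjugation, absence of eigenvalues in the resolvent set. -/

section Relation

theorem mem_sepRelation_iff : F ∈ τ.sepRelation va vb ↔
    F ∈ τ.Tmax ∧ τ.InSNear atBot va F ∧ τ.InSNear atTop vb F :=
  ⟨fun h => ⟨h.1, ⟨.of_mem_Tmax h.1, h.2.1⟩, .of_mem_Tmax h.1, h.2.2⟩,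
    fun h => ⟨h.1, h.2.1.2, h.2.2.2⟩⟩

theorem add_mem_Tmax (hF : F ∈ τ.Tmax) (hG : G ∈ τ.Tmax) : F + G ∈ τ.Tmax :=
  ⟨τ.H1Submodule.add_mem hF.1 hG.1, τ.H1Submodule.add_mem hF.2.1 hG.2.1,
    add_mem_Tloc hF.2.2 hG.2.2⟩

theorem smul_mem_Tmax (r : ℂ) (hF : F ∈ τ.Tmax) : r • F ∈ τ.Tmax :=
  ⟨τ.H1Submodule.smul_mem r hF.1, τ.H1Submodule.smul_mem r hF.2.1, smul_mem_Tloc r hF.2.2⟩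

theorem add_mem_sepRelation (hF : F ∈ τ.sepRelation va vb) (hG : G ∈ τ.sepRelation va vb) :
    F + G ∈ τ.sepRelation va vb := by
  rw [mem_sepRelation_iff] at *
  exact ⟨add_mem_Tmax hF.1 hG.1, hF.2.1.add hG.2.1, hF.2.2.add hG.2.2⟩

theorem smul_mem_sepRelation (r : ℂ) (hF : F ∈ τ.sepRelation va vb) :
    r • F ∈ τ.sepRelation va vb := by
  rw [mem_sepRelation_iff] at *
  exact ⟨smul_mem_Tmax r hF.1, hF.2.1.smul r, hF.2.2.smul r⟩

theorem star_mem_sepRelation (hva : τ.IsBoundary atBot va) (hvb : τ.IsBoundary atTop vb)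
    (hF : F ∈ τ.sepRelation va vb) : star F ∈ τ.sepRelation va vb := by
  rw [mem_sepRelation_iff] at *
  exact ⟨⟨star_mem_H1 hF.1.1, star_mem_H1 hF.1.2.1, star_mem_Tloc hF.1.2.2⟩,
    hF.2.1.star (Or.inl rfl) hva, hF.2.2.star (Or.inr rfl) hvb⟩

/-- Conjugation is an antilinear isometry of `H¹` that maps `S` to itself and `S - z` to `S - z^*`.
-/
theorem conj_mem_resolventSet (hva : τ.IsBoundary atBot va) (hvb : τ.IsBoundary atTop vb)
    (hz : z ∈ τ.resolventSet (τ.sepRelation va vb)) :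
    conj z ∈ τ.resolventSet (τ.sepRelation va vb) := by
  have key : ∀ {w : ℂ} {f g : Interval a b → ℂ}, (f, g + w • f) ∈ τ.sepRelation va vb →
      (star f, star g + conj w • star f) ∈ τ.sepRelation va vb := by
    intro w f g h
    have := star_mem_sepRelation hva hvb h
    have e : star (f, g + w • f) = (star f, star g + conj w • star f) := by
      refine Prod.ext rfl ?_
      ext x; simp
    rwa [e] at this
  obtain ⟨h1, C, h2⟩ := hz
  refine ⟨fun g hg => ?_, C, fun g hg f hf h => ?_⟩
  · obtain ⟨f, ⟨hf, hfS⟩, hu⟩ := h1 (star g) (star_mem_H1 hg)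
    refine ⟨star f, ⟨star_mem_H1 hf, by simpa using key hfS⟩, ?_⟩
    rintro f' ⟨hf', hfS'⟩
    have := hu (star f') ⟨star_mem_H1 hf', by simpa using key hfS'⟩
    rw [← this, star_star]
  · have := h2 (star g) (star_mem_H1 hg) (star f) (star_mem_H1 hf) (by simpa using key h)
    rwa [normH1_star hf, normH1_star hg] at this

theorem IsSolution.mem_H1 (hu : τ.IsSolution z u) (h1 : τ.H1Near atBot u) (h2 : τ.H1Near atTop u) :
    u ∈ τ.H1 := by
  have ht := hu.isTau
  obtain ⟨J, hJ, j1⟩ := h1.exists_memLp ht.1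
  obtain ⟨J', hJ', j2⟩ := h2.exists_memLp ht.1
  exact mem_H1_of_hasRNDeriv ht.1
    (memLp_of_near_ends ht.1.locallyBdd ht.1.measurable hJ hJ' (j1 J le_rfl).1 (j2 J' le_rfl).1)
    (memLp_of_near_ends ht.locallyBdd ht.measurable hJ hJ' (j1 J le_rfl).2 (j2 J' le_rfl).2)

theorem IsSolution.mem_sepRelation (hu : τ.IsSolution z u) (h1 : τ.InSNear atBot va (u, z • u))
    (h2 : τ.InSNear atTop vb (u, z • u)) : (u, z • u) ∈ τ.sepRelation va vb := by
  have hH := hu.mem_H1 h1.1.2.1 h2.1.2.1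
  exact mem_sepRelation_iff.2 ⟨⟨hH, τ.H1Submodule.smul_mem z hH, hu.mem_Tloc⟩, h1, h2⟩

/-- Such a `u` is an eigenfunction: both `u` and zero solve the resolvent equation with right-hand
side zero. -/
theorem IsSolution.eq_zero (hz : z ∈ τ.resolventSet (τ.sepRelation va vb))
    (hu : τ.IsSolution z u) (h1 : τ.InSNear atBot va (u, z • u))
    (h2 : τ.InSNear atTop vb (u, z • u)) : u = 0 := by
  have hS := hu.mem_sepRelation h1 h2
  obtain ⟨f, -, hf⟩ := hz.1 0 τ.H1Submodule.zero_mem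
  have e1 := hf u ⟨hS.1.1, by simpa using hS⟩
  have e2 := hf 0 ⟨τ.H1Submodule.zero_mem, by
    have := smul_mem_sepRelation 0 hS
    rw [zero_smul] at this
    rw [smul_zero, add_zero]
    exact this⟩
  rw [e1, e2]

end Relation

/-! ### Solutions to the right of a point and uniqueness of the Weyl value. -/

section Solutions

theorem IsSolution.add_smul (hθ : τ.IsSolution z θ) (hφ : τ.IsSolution z φ) (m : ℂ) :
    τ.IsSolution z (θ + m • φ) := by
  have := hθ.isTau.add (hφ.isTau.smul m)
  refine ⟨τ.quasiDeriv θ + m • τ.quasiDeriv φ, ?_⟩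
  rw [smul_add, smul_comm z m]
  exact this

theorem pair_add_smul (θ φ : Interval a b → ℂ) (m z : ℂ) :
    (θ + m • φ, z • (θ + m • φ)) = (θ, z • θ) + m • (φ, z • φ) := by
  refine Prod.ext rfl ?_
  simp only [Prod.snd_add, Prod.smul_snd, smul_add, smul_comm m z]

theorem IsSolution.quasiDeriv_add_smul (hθ : τ.IsSolution z θ) (hφ : τ.IsSolution z φ) (m : ℂ) :
    τ.quasiDeriv (θ + m • φ) = τ.quasiDeriv θ + m • τ.quasiDeriv φ :=
  (hθ.isTau.add (hφ.isTau.smul m)).quasiDeriv_eq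

/-- The Wronskian of two pairs that solve `(τ - z) u = 0` to the right of `d` is constant there. -/
theorem V_eq_of_Ici (hF : F ∈ τ.Tloc) (hG : G ∈ τ.Tloc) (hFd : ∀ x ∈ Ici d, F.2 x = z * F.1 x)
    (hGd : ∀ x ∈ Ici d, G.2 x = z * G.1 x) (hx : d ≤ x) : τ.V F G x = τ.V F G d := by
  have hd := hasRNDeriv_rnDeriv hF.2.1
  have he := hasRNDeriv_rnDeriv hG.2.1
  have h := V_sub_V hF hd hG he hx
  -- To the right of `d` the derivatives of the second components are `z` times the
  -- quasi-derivatives, so both integrands of the Lagrange identity vanish there.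
  have a1 := hd.ae_eq_of_eqOn_Ici ((isTau_of_mem_Tloc hF).1.smul z) hFd
  have a2 := he.ae_eq_of_eqOn_Ici ((isTau_of_mem_Tloc hG).1.smul z) hGd
  have hsub : Ico d x ⊆ Ici d := fun s hs => hs.1
  have i1 : ∫ s in Ico d x, bracketChi F G s ∂τ.chi = 0 := by
    rw [setIntegral_congr_fun (g := 0) measurableSet_Ico]
    · simp
    · intro s hs
      simp only [bracketChi, hFd s hs.1, hGd s hs.1, Pi.zero_apply]; ring
  have i2 : ∫ s in Ico d x, (rnDeriv τ.sigma F.2 s * τ.quasiDeriv G.1 s -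
      τ.quasiDeriv F.1 s * rnDeriv τ.sigma G.2 s) ∂τ.sigma = 0 := by
    rw [integral_congr_ae (g := 0)]
    · simp
    · filter_upwards [ae_restrict_of_ae_restrict_of_subset hsub a1,
        ae_restrict_of_ae_restrict_of_subset hsub a2] with s h1 h2
      simp only [h1, h2, Pi.smul_apply, smul_eq_mul, Pi.zero_apply]; ring
  rw [i1, i2, add_zero] at h
  exact sub_eq_zero.1 h

/-- A pair that lies in `S` near `b` and solves `(τ - z) u = 0` to the right of `d` is a linear
combination of the fundamental solutions there; up to a factor it is a Weyl solution. -/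
theorem exists_coeff_of_inSNear (hθ : τ.IsSolution z θ) (hφ : τ.IsSolution z φ) (hz : z ≠ 0)
    (hW : ∀ x, τ.V (θ, z • θ) (φ, z • φ) x = 1) (hU : τ.InSNear atTop vb U)
    (hUd : ∀ x ∈ Ici d, U.2 x = z * U.1 x) :
    ∃ β, (∀ x ∈ Ici d, U.1 x = τ.V U (φ, z • φ) d * θ x + β * φ x) ∧
      (τ.V U (φ, z • φ) d ≠ 0 → τ.InSNear atTop vb
        (θ + (β / τ.V U (φ, z • φ) d) • φ, z • (θ + (β / τ.V U (φ, z • φ) d) • φ))) := by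
  set α := τ.V U (φ, z • φ) d with hα
  set β := τ.V (θ, z • θ) U d with hβ
  have hUT := hU.1.1
  have c1 : ∀ x ∈ Ici d, τ.V U (φ, z • φ) x = α := fun x hx =>
    V_eq_of_Ici hUT hφ.mem_Tloc hUd (fun _ _ => rfl) hx
  have c2 : ∀ x ∈ Ici d, τ.V (θ, z • θ) U x = β := fun x hx =>
    V_eq_of_Ici hθ.mem_Tloc hUT (fun _ _ => rfl) hUd hx
  -- Cramer's rule with determinant `V(θ, φ) = 1`. It recovers `U.2 = z U.1` directly, whence the
  -- division by `z`.
  have e1 : ∀ x ∈ Ici d, U.1 x = α * θ x + β * φ x := by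
    intro x hx
    have h1 := hW x
    have h2 := hUd x hx
    rw [← c1 x hx, ← c2 x hx]
    simp only [V, Pi.smul_apply, smul_eq_mul] at h1 ⊢
    refine mul_left_cancel₀ hz ?_
    rw [← h2]
    linear_combination -(U.2 x) * h1
  have e2 : ∀ x ∈ Ici d, τ.quasiDeriv U.1 x = α * τ.quasiDeriv θ x + β * τ.quasiDeriv φ x := by
    intro x hx
    have h1 := hW x
    rw [← c1 x hx, ← c2 x hx]
    simp only [V, Pi.smul_apply, smul_eq_mul] at h1 ⊢
    linear_combination -(τ.quasiDeriv U.1 x) * h1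
  refine ⟨β, e1, fun hα0 => ?_⟩
  have hψ := hθ.add_smul hφ (β / α)
  have hq := hθ.quasiDeriv_add_smul hφ (β / α)
  set ψ := θ + (β / α) • φ with hψdef
  have e3 : ∀ x ∈ Ici d, ψ x = α⁻¹ * U.1 x := by
    intro x hx
    rw [e1 x hx, hψdef]
    simp only [Pi.add_apply, Pi.smul_apply, smul_eq_mul]; field_simp
  have e4 : ∀ x ∈ Ici d, τ.quasiDeriv ψ x = α⁻¹ * τ.quasiDeriv U.1 x := by
    intro x hx
    rw [e2 x hx, hq]
    simp only [Pi.add_apply, Pi.smul_apply, smul_eq_mul]; field_simp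
  have := τ.nonempty_interval
  obtain ⟨J, hJ, h1⟩ := hU.1.2.1.exists_memLp (isTau_of_mem_Tloc hUT).1
  obtain ⟨d', hd'⟩ := mem_atTop_sets.1 hJ
  have hsub : Ici (max d d') ⊆ J := fun x hx => hd' x ((le_max_right _ _).trans hx)
  have hsub' : Ici (max d d') ⊆ Ici d := Ici_subset_Ici.2 (le_max_left _ _)
  obtain ⟨m1, m2⟩ := h1 _ hsub
  have hH : τ.H1Near atTop ψ := by
    refine .of_hasRNDeriv hψ.isTau.1 (Ici_mem_atTop (max d d')) ?_ ?_
    · refine (memLp_congr_ae ?_).2 (m1.const_mul α⁻¹)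
      filter_upwards [ae_restrict_mem measurableSet_Ici] with x hx using e3 x (hsub' hx)
    · refine (memLp_congr_ae ?_).2 (m2.const_mul α⁻¹)
      filter_upwards [ae_restrict_mem measurableSet_Ici] with x hx using e4 x (hsub' hx)
  refine ⟨hψ.tNear hH, ?_⟩
  have hlim : Tendsto (fun x => α⁻¹ * τ.V U (star vb) x) atTop (𝓝 0) := by
    simpa using hU.2.const_mul α⁻¹
  refine hlim.congr' ?_
  filter_upwards [Ici_mem_atTop d] with x hx
  simp only [V, Pi.smul_apply, smul_eq_mul, e3 x hx, e4 x hx, hUd x hx]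
  ring

/-- The difference of the two Weyl solutions, divided by `m - m'`, is `φ`, which would then lie in
`S` near both ends and be an eigenfunction. -/
theorem weylValue_unique {m m' : ℂ} (hφ0 : φ ≠ 0)
    (hφ : τ.IsSolution z φ) (hz : z ∈ τ.resolventSet (τ.sepRelation va vb)) (hφa : τ.InSNear atBot va (φ, z • φ))
    (h1 : τ.InSNear atTop vb (θ + m • φ, z • (θ + m • φ)))
    (h2 : τ.InSNear atTop vb (θ + m' • φ, z • (θ + m' • φ))) : m = m' := by
  by_contra hne
  refine hφ0 (hφ.eq_zero hz hφa ?_)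
  have h3 := (h1.add (h2.smul (-1))).smul (m - m')⁻¹
  have hne' : m - m' ≠ 0 := sub_ne_zero.2 hne
  convert h3 using 1
  rw [pair_add_smul, pair_add_smul]
  refine Prod.ext ?_ ?_ <;> ext x <;>
    simp only [Prod.fst_add, Prod.smul_fst, Prod.snd_add, Prod.smul_snd, Pi.add_apply,
      Pi.smul_apply, smul_eq_mul] <;> field_simp <;> ring

end Solutions

end Coefficients

/-! ### Cut-off functions and integrability from bounded partial integrals. -/

section Interpolation

variable {μ : Measure (Interval a b)} {w₁ w₂ d₁ d₂ : Interval a b → ℂ} {c d : Interval a b}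

open Classical in
theorem LocallyBdd.piecewise (h₁ : LocallyBdd d₁) (h₂ : LocallyBdd d₂) (A : Set (Interval a b)) :
    LocallyBdd (A.piecewise d₁ d₂) := by
  intro x y
  obtain ⟨C, hC⟩ := h₁ x y
  obtain ⟨D, hD⟩ := h₂ x y
  refine ⟨max C D, fun t ht => ?_⟩
  by_cases h : t ∈ A
  · rw [piecewise_eq_of_mem _ _ _ h]; exact (hC t ht).trans (le_max_left _ _)
  · rw [piecewise_eq_of_notMem _ _ _ h]; exact (hD t ht).trans (le_max_right _ _)

open Classical in
/-- Two locally absolutely continuous functions, one given to the left of `c` and the other one to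
the right of `d`, can be interpolated in between. -/
theorem exists_interpolation [IsLocallyFiniteMeasure μ] (hμ : μ (Ico c d) ≠ 0) (hcd : c < d)
    (h₁ : HasRNDeriv μ w₁ d₁) (b₁ : LocallyBdd d₁) (m₁ : Measurable d₁)
    (h₂ : HasRNDeriv μ w₂ d₂) (b₂ : LocallyBdd d₂) (m₂ : Measurable d₂) :
    ∃ g e, HasRNDeriv μ g e ∧ LocallyBdd e ∧ Measurable e ∧ EqOn g w₁ (Iic c) ∧
      EqOn e d₁ (Iio c) ∧ EqOn g w₂ (Ici d) ∧ EqOn e d₂ (Ici d) ∧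
      ∀ x ∈ Icc c d, ‖g x‖ ≤ ‖w₁ c‖ + ‖w₂ d‖ := by
  set N : ℝ := μ.real (Ico c d)
  have hN : 0 < N := ENNReal.toReal_pos hμ (measure_Ico_lt_top c d).ne
  -- The middle piece has constant derivative with respect to `μ`. Its values are convex
  -- combinations of `w₁ c` and `w₂ d`, which gives a bound independent of `μ`.
  set k : ℂ := (w₂ d - w₁ c) / N
  set r : Interval a b → ℂ := fun x => w₁ c + stieltjesIntegral μ (fun _ => k) c x
  have hS : ∀ x, c ≤ x → stieltjesIntegral μ (fun _ => k) c x = μ.real (Ico c x) * k := by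
    intro x hx
    rw [stieltjesIntegral_of_le hx]; simp
  have hrc : r c = w₁ c := by simp [r, hS c le_rfl]
  have hrd : r d = w₂ d := by
    have : (N : ℂ) ≠ 0 := by exact_mod_cast hN.ne'
    simp only [r, hS d hcd.le, k]
    change w₁ c + N * ((w₂ d - w₁ c) / N) = w₂ d
    field_simp; ring
  have hr : HasRNDeriv μ r (fun _ => k) :=
    .of_base (locallyIntegrable_const k) c fun x => by rw [hrc]
  have hglue := h₁.glue (hr.glue h₂ hrd) (d := c)
    (by rw [piecewise_eq_of_mem (Iio d) _ _ hcd, hrc])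
  refine ⟨_, _, hglue, b₁.piecewise ((LocallyBdd.const k).piecewise b₂ _) _,
    m₁.piecewise measurableSet_Iio (measurable_const.piecewise measurableSet_Iio m₂),
    fun x hx => ?_, fun x hx => ?_, fun x hx => ?_, fun x hx => ?_, fun x hx => ?_⟩
  · rcases lt_or_eq_of_le (mem_Iic.1 hx) with h | rfl
    · exact piecewise_eq_of_mem (Iio c) _ _ h
    · rw [piecewise_eq_of_notMem (Iio x) _ _ (by simp), piecewise_eq_of_mem (Iio d) _ _ hcd, hrc]
  · exact piecewise_eq_of_mem (Iio c) _ _ hx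
  · rw [piecewise_eq_of_notMem (Iio c) _ _ (by simpa using hcd.le.trans hx),
      piecewise_eq_of_notMem (Iio d) _ _ (by simpa using hx)]
  · rw [piecewise_eq_of_notMem (Iio c) _ _ (by simpa using hcd.le.trans hx),
      piecewise_eq_of_notMem (Iio d) _ _ (by simpa using hx)]
  · rw [piecewise_eq_of_notMem (Iio c) _ _ (by simpa using hx.1)]
    rcases lt_or_eq_of_le hx.2 with h | rfl
    · rw [piecewise_eq_of_mem (Iio d) _ _ h]
      set t : ℝ := μ.real (Ico c x) / N with ht
      have ht0 : 0 ≤ t := by positivity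
      have ht1 : t ≤ 1 := by
        rw [ht, div_le_one hN]
        exact measureReal_mono (Ico_subset_Ico_right hx.2) (measure_Ico_lt_top c d).ne
      have e : r x = ((1 - t : ℝ) : ℂ) * w₁ c + (t : ℂ) * w₂ d := by
        have : (N : ℂ) ≠ 0 := by exact_mod_cast hN.ne'
        simp only [r, hS x hx.1, k, ht]
        push_cast
        field_simp; ring
      rw [e]
      refine (norm_add_le _ _).trans ?_
      rw [norm_mul, norm_mul, Complex.norm_real, Complex.norm_real,
        Real.norm_of_nonneg ht0, Real.norm_of_nonneg (sub_nonneg.2 ht1)]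
      nlinarith [norm_nonneg (w₁ c), norm_nonneg (w₂ d)]
    · rw [piecewise_eq_of_notMem (Iio x) _ _ (by simp)]
      exact le_add_of_nonneg_left (norm_nonneg _)

theorem integrableOn_Ici_of_bounded {k : Interval a b → ℝ} (hk : ∀ x y, IntegrableOn k (Ico x y) μ)
    (h0 : ∀ s, 0 ≤ k s) {C : ℝ} (hC : ∀ y, c ≤ y → ∫ s in Ico c y, k s ∂μ ≤ C) :
    IntegrableOn k (Ici c) μ := by
  have : Nonempty (Interval a b) := ⟨c⟩
  have hcov : AECover (μ.restrict (Ici c)) atTop fun y : Interval a b => Iio y :=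
    aecover_Iio tendsto_id
  have e : ∀ y, (μ.restrict (Ici c)).restrict (Iio y) = μ.restrict (Ico c y) := fun y => by
    rw [Measure.restrict_restrict measurableSet_Iio, inter_comm, Ici_inter_Iio]
  refine hcov.integrable_of_integral_norm_bounded C (fun y => ?_) ?_
  · rw [IntegrableOn, e]; exact hk c y
  · filter_upwards [eventually_ge_atTop c] with y hy
    rw [e]
    simpa only [Real.norm_of_nonneg (h0 _)] using hC y hy

end Interpolation

/-! ### Existence of the Weyl solution at `b`. -/

namespace Coefficients

variable {τ : Coefficients a b} {F G U va vb v : (Interval a b → ℂ) × (Interval a b → ℂ)}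
  {x y c d : Interval a b} {l : Filter (Interval a b)} {u θ φ : Interval a b → ℂ} {z : ℂ}

theorem sigma_Ico_ne_zero (τ : Coefficients a b) (hcd : c < d) : τ.sigma (Ico c d) ≠ 0 := fun h =>
  τ.sigma_support (Ioo c d) isOpen_Ioo (nonempty_Ioo.2 hcd)
    (measure_mono_null Ioo_subset_Ico_self h)

theorem mem_H1_of_near_ends {g e : Interval a b → ℂ} (hg : HasRNDeriv τ.sigma g e)
    (he : LocallyBdd e) (hem : Measurable e) (h1 : τ.H1Near atBot g) (h2 : τ.H1Near atTop g) :
    g ∈ τ.H1 := by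
  obtain ⟨J, hJ, j1⟩ := h1.exists_memLp hg
  obtain ⟨J', hJ', j2⟩ := h2.exists_memLp hg
  exact mem_H1_of_hasRNDeriv hg
    (memLp_of_near_ends hg.locallyBdd hg.measurable hJ hJ' (j1 J le_rfl).1 (j2 J' le_rfl).1)
    (memLp_of_near_ends he hem hJ hJ' (j1 J le_rfl).2 (j2 J' le_rfl).2)

theorem h1Near_atBot_of_eqOn {g e w d : Interval a b → ℂ} (hg : HasRNDeriv τ.sigma g e)
    (hw : HasRNDeriv τ.sigma w d) (h : τ.H1Near atBot w) (h1 : EqOn g w (Iic c))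
    (h2 : EqOn e d (Iio c)) : τ.H1Near atBot g := by
  obtain ⟨J, hJ, j1⟩ := h.exists_memLp hw
  have hJ' : J ∩ Iio c ∈ atBot := inter_mem hJ (Iio_mem_atBot c)
  have : Nonempty (Interval a b) := ⟨c⟩
  obtain ⟨r, hr⟩ := mem_atBot_sets.1 hJ'
  obtain ⟨m1, m2⟩ := j1 (Iic r) fun s hs => (hr s hs).1
  refine .of_hasRNDeriv hg (Iic_mem_atBot r) ?_ ?_
  · refine (memLp_congr_ae ?_).2 m1
    filter_upwards [ae_restrict_mem measurableSet_Iic] with s hs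
    exact h1 (mem_Iic.2 (le_of_lt (mem_Iio.1 (hr s hs).2)))
  · refine (memLp_congr_ae ?_).2 m2
    filter_upwards [ae_restrict_mem measurableSet_Iic] with s hs
    exact h2 (hr s hs).2

theorem h1Near_atTop_of_eqOn {g e w d : Interval a b → ℂ} (hg : HasRNDeriv τ.sigma g e)
    (hw : HasRNDeriv τ.sigma w d) (h : τ.H1Near atTop w) (h1 : EqOn g w (Ici c))
    (h2 : EqOn e d (Ici c)) : τ.H1Near atTop g := by
  obtain ⟨J, hJ, j1⟩ := h.exists_memLp hw
  have hJ' : J ∩ Ici c ∈ atTop := inter_mem hJ (Ici_mem_atTop c)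
  have : Nonempty (Interval a b) := ⟨c⟩
  obtain ⟨r, hr⟩ := mem_atTop_sets.1 hJ'
  obtain ⟨m1, m2⟩ := j1 (Ici r) fun s hs => (hr s hs).1
  refine .of_hasRNDeriv hg (Ici_mem_atTop r) ?_ ?_
  · refine (memLp_congr_ae ?_).2 m1
    filter_upwards [ae_restrict_mem measurableSet_Ici] with s hs
    exact h1 (hr s hs).2
  · refine (memLp_congr_ae ?_).2 m2
    filter_upwards [ae_restrict_mem measurableSet_Ici] with s hs
    exact h2 (hr s hs).2

theorem H1Near.zero : τ.H1Near l 0 := .of_mem_H1 τ.H1Submodule.zero_mem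

/-- Existence of a Weyl solution at `b` in the limit-circle case. -/
theorem exists_weylValue_of_limitCircle (hlc : τ.LimitCircle atTop)
    (hvb : τ.IsBoundary atTop vb) (hz0 : z ≠ 0) (hz : z ∈ τ.resolventSet (τ.sepRelation va vb))
    (hθ : τ.IsSolution z θ) (hφ : τ.IsSolution z φ) (hφ0 : φ ≠ 0)
    (hφa : τ.InSNear atBot va (φ, z • φ)) :
    ∃ m : ℂ, τ.InSNear atTop vb (θ + m • φ, z • (θ + m • φ)) := by
  have tθ := hθ.tNear (hlc z hz0 θ hθ)
  have tφ := hφ.tNear (hlc z hz0 φ hφ)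
  obtain ⟨L, hL⟩ := tθ.exists_tendsto_V (Or.inr rfl) hvb.1.star
  obtain ⟨K, hK⟩ := tφ.exists_tendsto_V (Or.inr rfl) hvb.1.star
  -- Otherwise `φ` would satisfy the boundary condition at `b` as well and be an eigenfunction.
  have hK0 : K ≠ 0 := by
    rintro rfl
    exact hφ0 (hφ.eq_zero hz hφa ⟨tφ, hK⟩)
  refine ⟨-L / K, ?_⟩
  rw [pair_add_smul]
  refine ⟨tθ.add (tφ.smul _), ?_⟩
  have hlim := hL.add (hK.const_mul (-L / K))
  have e0 : L + -L / K * K = 0 := by field_simp; ring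
  rw [e0] at hlim
  refine hlim.congr fun x => ?_
  rw [V_add_left tθ.1 (smul_mem_Tloc _ tφ.1), V_smul_left _ tφ.1]

/-- The energy of `φ` to the left of `c`. -/
def leftEnergy (τ : Coefficients a b) (φ : Interval a b → ℂ) (c : Interval a b) : ℂ :=
  (∫ s in Iio c, φ s * conj (φ s) ∂τ.chi) +
    ∫ s in Iio c, τ.quasiDeriv φ s * conj (τ.quasiDeriv φ s) ∂τ.sigma

theorem IsSolution.locallyIntegrable_chi (hφ : τ.IsSolution z φ) :
    LocallyIntegrable (fun s => φ s * conj (φ s)) τ.chi :=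
  locallyIntegrable_mul_conj hφ.isTau.1.locallyBdd hφ.isTau.1.measurable

theorem IsSolution.locallyIntegrable_sigma (hφ : τ.IsSolution z φ) :
    LocallyIntegrable (fun s => τ.quasiDeriv φ s * conj (τ.quasiDeriv φ s)) τ.sigma :=
  locallyIntegrable_mul_conj hφ.isTau.locallyBdd hφ.isTau.measurable

theorem IsSolution.integrableOn_Iio (hφ : τ.IsSolution z φ) (h : τ.H1Near atBot φ)
    (c : Interval a b) : IntegrableOn (fun s => φ s * conj (φ s)) (Iio c) τ.chi ∧
      IntegrableOn (fun s => τ.quasiDeriv φ s * conj (τ.quasiDeriv φ s)) (Iio c) τ.sigma := by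
  obtain ⟨J, hJ, j⟩ := h.exists_memLp hφ.isTau.1
  obtain ⟨j1, j2⟩ := j J le_rfl
  rw [memLp_two_iff_integrable_mul_conj hφ.isTau.1.measurable.aestronglyMeasurable] at j1
  rw [memLp_two_iff_integrable_mul_conj hφ.isTau.measurable.aestronglyMeasurable] at j2
  exact ⟨LeftDefinite.integrableOn_Iio hJ j1 hφ.locallyIntegrable_chi c,
    LeftDefinite.integrableOn_Iio hJ j2 hφ.locallyIntegrable_sigma c⟩

theorem IsSolution.mul_conj_sub (hφ : τ.IsSolution z φ) (hxy : x ≤ y) :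
    τ.quasiDeriv φ y * conj (φ y) - τ.quasiDeriv φ x * conj (φ x) =
      (∫ s in Ico x y, φ s * conj (φ s) ∂τ.chi) -
      ((∫ s in Ico x y, conj (φ s) * (z * φ s) ∂τ.rho.pos) -
        ∫ s in Ico x y, conj (φ s) * (z * φ s) ∂τ.rho.neg) +
      ∫ s in Ico x y, τ.quasiDeriv φ s * conj (τ.quasiDeriv φ s) ∂τ.sigma := by
  have h := hφ.isTau.mul_sub_mul hφ.isTau.1.star hxy
  have e : ∀ s, (star φ) s * φ s = φ s * conj (φ s) := fun s => mul_comm _ _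
  simp only [e] at h
  exact h

theorem leftEnergy_sub (hφ : τ.IsSolution z φ) (h : τ.H1Near atBot φ) (hxy : x ≤ y) :
    τ.leftEnergy φ y - τ.leftEnergy φ x = (∫ s in Ico x y, φ s * conj (φ s) ∂τ.chi) +
      ∫ s in Ico x y, τ.quasiDeriv φ s * conj (τ.quasiDeriv φ s) ∂τ.sigma := by
  have hd : Disjoint (Iio x) (Ico x y) := disjoint_left.2 fun s h1 h2 => not_le.2 h1 h2.1
  obtain ⟨i1, i2⟩ := hφ.integrableOn_Iio h y
  simp only [leftEnergy]
  rw [← Iio_union_Ico_eq_Iio hxy] at i1 i2 ⊢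
  rw [setIntegral_union hd measurableSet_Ico i1.left_of_union i1.right_of_union,
    setIntegral_union hd measurableSet_Ico i2.left_of_union i2.right_of_union]
  ring

/-- The Wronskian of `(f, g + z f) ∈ S` with a solution of `(τ - z) u = 0` that lies in `S` near
`a`. -/
theorem V_eq_of_eqOn_star (hva : τ.IsBoundary atBot va) (hφ : τ.IsSolution z φ)
    (hφa : τ.InSNear atBot va (φ, z • φ)) {f g e : Interval a b → ℂ}
    (hf : τ.InSNear atBot va (f, g + z • f)) (hg : HasRNDeriv τ.sigma g e)
    (h1 : EqOn g (star φ) (Iic c)) (h2 : EqOn e (star (τ.quasiDeriv φ)) (Iio c)) (hcd : c ≤ d) :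
    τ.V (f, g + z • f) (φ, z • φ) d = τ.leftEnergy φ c + (∫ s in Ico c d, g s * φ s ∂τ.chi) +
      ∫ s in Ico c d, τ.quasiDeriv φ s * e s ∂τ.sigma := by
  have hfT := isTau_of_mem_Tloc hf.1.1
  have hder : HasRNDeriv τ.sigma (g + z • f) (e + z • τ.quasiDeriv f) :=
    hg.add (hfT.1.smul z)
  have hbr : ∀ s, bracketChi (f, g + z • f) (φ, z • φ) s = g s * φ s := fun s => by
    simp only [bracketChi, Pi.add_apply, Pi.smul_apply, smul_eq_mul]; ring
  have hbs : ∀ s, (e + z • τ.quasiDeriv f) s * τ.quasiDeriv φ s -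
      τ.quasiDeriv f s * (z • τ.quasiDeriv φ) s = τ.quasiDeriv φ s * e s := fun s => by
    simp only [Pi.add_apply, Pi.smul_apply, smul_eq_mul]; ring
  have hlag : ∀ x y, x ≤ y → τ.V (f, g + z • f) (φ, z • φ) y - τ.V (f, g + z • f) (φ, z • φ) x =
      (∫ s in Ico x y, g s * φ s ∂τ.chi) + ∫ s in Ico x y, τ.quasiDeriv φ s * e s ∂τ.sigma := by
    intro x y hxy
    have := V_sub_V hf.1.1 hder hφ.mem_Tloc (hφ.isTau.1.smul z) hxy
    simp only [hbr, hbs] at this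
    exact this
  -- At `a` the form vanishes because both pairs satisfy the boundary condition. To the left of `c`
  -- one has `g = φ^*`, so the Lagrange integrals are the energy.
  have hc : τ.V (f, g + z • f) (φ, z • φ) c = τ.leftEnergy φ c := by
    have : Nonempty (Interval a b) := ⟨c⟩
    obtain ⟨i1, i2⟩ := hφ.integrableOn_Iio hφa.1.2.1 c
    have t1 := (tendsto_setIntegral_Ico_atBot i1).add (tendsto_setIntegral_Ico_atBot i2)
    have t2 := (hf.tendsto_V (Or.inl rfl) hva hφa).const_sub (τ.V (f, g + z • f) (φ, z • φ) c)
    rw [sub_zero] at t2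
    refine tendsto_nhds_unique t2 (t1.congr' ?_)
    filter_upwards [eventually_le_atBot c] with y hy
    rw [hlag y c hy]
    congr 1
    · refine setIntegral_congr_fun measurableSet_Ico fun s hs => ?_
      rw [h1 (mem_Iic.2 hs.2.le)]; exact mul_comm _ _
    · refine setIntegral_congr_fun measurableSet_Ico fun s hs => ?_
      rw [h2 (mem_Iio.2 hs.2)]; rfl
  linear_combination hlag c d hcd + hc

/-- If no compactly supported perturbation to the right excites a component along `θ`, then the
boundary term of `φ` is its energy. -/
theorem quasiDeriv_mul_conj_eq_leftEnergy (hva : τ.IsBoundary atBot va)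
    (hz : z ∈ τ.resolventSet (τ.sepRelation va vb)) (hφ : τ.IsSolution z φ)
    (hφa : τ.InSNear atBot va (φ, z • φ))
    (hbad : ∀ d, ∀ g ∈ τ.H1, (∀ x ∈ Ici d, g x = 0) → ∀ f,
      (f, g + z • f) ∈ τ.sepRelation va vb → τ.V (f, g + z • f) (φ, z • φ) d = 0)
    (c : Interval a b) : τ.quasiDeriv φ c * conj (φ c) = τ.leftEnergy φ c := by
  obtain ⟨c₀, hc₀⟩ := exists_lt c
  obtain ⟨B, hB⟩ := hφ.isTau.1.locallyBdd c₀ c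
  have hB0 : 0 ≤ B := (norm_nonneg _).trans (hB c ⟨hc₀.le, le_rfl⟩)
  set D : Interval a b → ℂ := fun t => τ.quasiDeriv φ t * conj (φ t) - τ.leftEnergy φ t
  have bound : ∀ {μ : Measure (Interval a b)} [IsLocallyFiniteMeasure μ] {k : Interval a b → ℂ}
      {t : Interval a b}, (∀ s ∈ Ico t c, ‖k s‖ ≤ B * (‖z‖ * B)) →
      ‖∫ s in Ico t c, k s ∂μ‖ ≤ B * (‖z‖ * B) * μ.real (Ico t c) := fun hk =>
    norm_setIntegral_le_of_norm_le_const (measure_Ico_lt_top _ _) hk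
  -- The test function is `φ^*` up to `t`, cut off to zero on `[t, c)`. The resulting error consists
  -- of `ϱ`-integrals over `[t, c)` with uniformly bounded integrands, and it disappears as `t`
  -- increases to `c`.
  have step : ∀ t, c₀ ≤ t → t < c →
      ‖D c‖ ≤ 2 * (B * (‖z‖ * B)) * (τ.rho.pos.real (Ico t c) + τ.rho.neg.real (Ico t c)) := by
    intro t hc₀t htc
    have hφstar : τ.H1Near atBot (star φ) := hφa.1.2.1.star
    obtain ⟨g, e, hg, heb, hem, g1, e1, g2, e2, gb⟩ := exists_interpolation
      (τ.sigma_Ico_ne_zero htc) htc hφ.isTau.1.star hφ.isTau.star.locallyBdd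
      hφ.isTau.star.measurable (HasRNDeriv.zero (μ := τ.sigma)) (LocallyBdd.const 0)
      measurable_const
    have hgH : g ∈ τ.H1 := mem_H1_of_near_ends hg heb hem
      (h1Near_atBot_of_eqOn hg hφ.isTau.1.star hφstar g1 e1)
      (h1Near_atTop_of_eqOn hg HasRNDeriv.zero .zero g2 e2)
    obtain ⟨f, ⟨-, hfS⟩, -⟩ := hz.1 g hgH
    have hV := hbad c g hgH (fun x hx => g2 hx) f hfS
    rw [V_eq_of_eqOn_star hva hφ hφa (mem_sepRelation_iff.1 hfS).2.1 hg g1 e1 htc.le] at hV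
    have hen := hφ.isTau.mul_sub_mul hg htc.le
    have gc : g c = 0 := g2 (mem_Ici.2 le_rfl)
    have gt : g t = conj (φ t) := g1 (mem_Iic.2 le_rfl)
    rw [gc, gt] at hen
    -- The vanishing of `V` at `c`, combined with the energy identity for `φ` tested with `g`,
    -- cancels all `χ`- and `ς`-integrals over `[t, c)`.
    have hD : D t = (∫ s in Ico t c, g s * (z • φ) s ∂τ.rho.pos) -
        ∫ s in Ico t c, g s * (z • φ) s ∂τ.rho.neg := by
      simp only [D]
      linear_combination -hen + (-1 : ℂ) * hV
    have hDD : D c - D t = -((∫ s in Ico t c, conj (φ s) * (z * φ s) ∂τ.rho.pos) -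
        ∫ s in Ico t c, conj (φ s) * (z * φ s) ∂τ.rho.neg) := by
      simp only [D]
      linear_combination hφ.mul_conj_sub htc.le - leftEnergy_sub hφ hφa.1.2.1 htc.le
    have hgB : ∀ s ∈ Ico t c, ‖g s * (z • φ) s‖ ≤ B * (‖z‖ * B) := by
      intro s hs
      have b1 : ‖g s‖ ≤ B := by
        refine (gb s (Ico_subset_Icc_self hs)).trans ?_
        simpa using hB t ⟨hc₀t, htc.le⟩
      have b2 := hB s ⟨hc₀t.trans hs.1, hs.2.le⟩
      rw [norm_mul, Pi.smul_apply, norm_smul]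
      gcongr
    have hφB : ∀ s ∈ Ico t c, ‖conj (φ s) * (z * φ s)‖ ≤ B * (‖z‖ * B) := by
      intro s hs
      have b2 := hB s ⟨hc₀t.trans hs.1, hs.2.le⟩
      rw [norm_mul, norm_mul, RCLike.norm_conj]
      gcongr
    have n1 : ‖D t‖ ≤ B * (‖z‖ * B) * τ.rho.pos.real (Ico t c) +
        B * (‖z‖ * B) * τ.rho.neg.real (Ico t c) := by
      rw [hD]; exact (norm_sub_le _ _).trans (add_le_add (bound hgB) (bound hgB))
    have n2 : ‖D c - D t‖ ≤ B * (‖z‖ * B) * τ.rho.pos.real (Ico t c) +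
        B * (‖z‖ * B) * τ.rho.neg.real (Ico t c) := by
      rw [hDD, norm_neg]; exact (norm_sub_le _ _).trans (add_le_add (bound hφB) (bound hφB))
    have n3 : ‖D c‖ ≤ ‖D c - D t‖ + ‖D t‖ := by
      simpa using norm_add_le (D c - D t) (D t)
    linarith
  obtain ⟨u, hu, hlt, hux⟩ := exists_strictMono_tendsto c
  have hreal : ∀ (μ : Measure (Interval a b)) [IsLocallyFiniteMeasure μ],
      Tendsto (fun n => μ.real (Ico (u n) c)) atTop (𝓝 0) := by
    intro μ _
    have := tendsto_setIntegral_Ico (μ := μ) (locallyIntegrable_const (1 : ℝ)) hu hux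
    simpa using this
  have hlim : Tendsto (fun n => 2 * (B * (‖z‖ * B)) *
      (τ.rho.pos.real (Ico (u n) c) + τ.rho.neg.real (Ico (u n) c))) atTop (𝓝 0) := by
    simpa using ((hreal τ.rho.pos).add (hreal τ.rho.neg)).const_mul (2 * (B * (‖z‖ * B)))
  have hDc : ‖D c‖ ≤ 0 := by
    refine ge_of_tendsto hlim ?_
    filter_upwards [hux.eventually (lt_mem_nhds hc₀)] with n hn
    exact step (u n) hn.le (hlt n)
  exact sub_eq_zero.1 (norm_le_zero_iff.1 hDc)

theorem setIntegral_mul_conj {μ : Measure (Interval a b)} (A : Set (Interval a b))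
    (w : Interval a b → ℂ) :
    ∫ s in A, w s * conj (w s) ∂μ = ((∫ s in A, ‖w s‖ ^ 2 ∂μ : ℝ) : ℂ) := by
  rw [← integral_complex_ofReal]
  refine integral_congr_ae (ae_of_all _ fun s => ?_)
  simp [Complex.mul_conj, Complex.normSq_eq_norm_sq]

theorem leftEnergy_eq (φ : Interval a b → ℂ) (c : Interval a b) : τ.leftEnergy φ c =
    (((∫ s in Iio c, ‖φ s‖ ^ 2 ∂τ.chi) + ∫ s in Iio c, ‖τ.quasiDeriv φ s‖ ^ 2 ∂τ.sigma : ℝ) : ℂ) := by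
  rw [leftEnergy, setIntegral_mul_conj, setIntegral_mul_conj]
  push_cast; rfl

theorem ae_eq_zero_of_setIntegral_eq_zero {μ : Measure (Interval a b)} {w : Interval a b → ℂ}
    {A : Set (Interval a b)} (hi : IntegrableOn (fun s => w s * conj (w s)) A μ)
    (h0 : ∫ s in A, ‖w s‖ ^ 2 ∂μ = 0) : ∀ᵐ s ∂μ.restrict A, w s = 0 := by
  have hi' : IntegrableOn (fun s => ‖w s‖ ^ 2) A μ := by
    refine hi.norm.congr (ae_of_all _ fun s => ?_)
    simp [sq]
  have := (integral_eq_zero_iff_of_nonneg (μ := μ.restrict A)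
    (fun s => sq_nonneg ‖w s‖) hi').1 h0
  filter_upwards [this] with s hs
  simpa using hs

/-- If the boundary term of `φ` is its energy, then `φ` has no zeros. -/
theorem ne_zero_of_eq_leftEnergy (hφ : τ.IsSolution z φ) (hφa : τ.H1Near atBot φ)
    (hW : ∀ x, τ.V (θ, z • θ) (φ, z • φ) x = 1)
    (hE : ∀ c, τ.quasiDeriv φ c * conj (φ c) = τ.leftEnergy φ c) (x : Interval a b) :
    φ x ≠ 0 := by
  intro h0
  have h1 := hE x
  rw [h0, map_zero, mul_zero, leftEnergy_eq] at h1
  have h2 : (∫ s in Iio x, ‖φ s‖ ^ 2 ∂τ.chi) + ∫ s in Iio x, ‖τ.quasiDeriv φ s‖ ^ 2 ∂τ.sigma = 0 :=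
    by exact_mod_cast h1.symm
  have p1 : 0 ≤ ∫ s in Iio x, ‖φ s‖ ^ 2 ∂τ.chi := integral_nonneg fun s => sq_nonneg _
  have p2 : 0 ≤ ∫ s in Iio x, ‖τ.quasiDeriv φ s‖ ^ 2 ∂τ.sigma := integral_nonneg fun s => sq_nonneg _
  obtain ⟨-, i2⟩ := hφ.integrableOn_Iio hφa x
  have hae := ae_eq_zero_of_setIntegral_eq_zero i2 (by linarith)
  obtain ⟨c, hc⟩ := exists_lt x
  -- Zero energy makes the quasi-derivative vanish almost everywhere to the left of `x`, hence at
  -- `x` by left continuity. Together with `φ x = 0` this contradicts the Wronskian being 1.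
  have hq : τ.quasiDeriv φ x = 0 := eq_zero_of_ae_eq_zero (τ := τ) hc
    (fun u h1 h2 h3 => hφ.isTau.tendsto_left h1 h2 h3)
    (ae_restrict_of_ae_restrict_of_subset (fun s hs => hs.2) hae)
  have := hW x
  simp [V, h0, hq] at this

/-- If the boundary term of `φ` is its energy, then `ϱ` vanishes. -/
theorem rho_eq_zero_of_eq_leftEnergy (hz0 : z ≠ 0) (hφ : τ.IsSolution z φ)
    (hφa : τ.H1Near atBot φ) (hne : ∀ x, φ x ≠ 0)
    (hE : ∀ c, τ.quasiDeriv φ c * conj (φ c) = τ.leftEnergy φ c) :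
    τ.rho.pos = 0 ∧ τ.rho.neg = 0 := by
  obtain ⟨A, hA, hpA, hnA⟩ := τ.rho.mutuallySingular
  set w : Interval a b → ℂ := fun s => φ s * conj (φ s)
  have hwl : ∀ (μ : Measure (Interval a b)) [IsLocallyFiniteMeasure μ], LocallyIntegrable w μ :=
    fun μ _ => locallyIntegrable_mul_conj hφ.isTau.1.locallyBdd hφ.isTau.1.measurable
  -- Comparing the increments of the boundary term and of the energy leaves `z ∫ |φ|² dϱ = 0`.
  have hinteg : ∀ x y, x ≤ y → ∫ s in Ico x y, w s ∂τ.rho.pos = ∫ s in Ico x y, w s ∂τ.rho.neg := by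
    intro x y hxy
    have h1 := hφ.mul_conj_sub hxy
    have h2 := leftEnergy_sub hφ hφa hxy
    rw [hE, hE] at h1
    have e : ∀ μ : Measure (Interval a b), ∫ s in Ico x y, conj (φ s) * (z * φ s) ∂μ =
        z * ∫ s in Ico x y, w s ∂μ := by
      intro μ
      rw [← integral_const_mul]
      refine integral_congr_ae (ae_of_all _ fun s => ?_)
      simp only [w]; ring
    rw [e, e] at h1
    refine mul_left_cancel₀ hz0 ?_
    linear_combination h1 - h2
  have pA : ∀ᵐ s ∂τ.rho.pos, s ∉ A := measure_eq_zero_iff_ae_notMem.1 hpA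
  have nA : ∀ᵐ s ∂τ.rho.neg, s ∈ A := by
    filter_upwards [measure_eq_zero_iff_ae_notMem.1 hnA] with s hs
    simpa using hs
  -- `k` is `|φ|²` times the sign of `ϱ` on a Hahn decomposition. Its integrals against the total
  -- variation are those of `|φ|²` against `ϱ`, hence zero, although `k` has no zeros.
  set k : Interval a b → ℂ := A.indicator (fun s => -w s) + Aᶜ.indicator w
  have kp : k =ᵐ[τ.rho.pos] w := by
    filter_upwards [pA] with s hs
    simp [k, hs]
  have kn : k =ᵐ[τ.rho.neg] -w := by
    filter_upwards [nA] with s hs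
    simp [k, hs]
  have ikp : ∀ x y, IntegrableOn k (Ico x y) τ.rho.pos := fun x y =>
    (integrableOn_Ico (hwl τ.rho.pos) x y).congr (EventuallyEq.symm (ae_restrict_of_ae kp))
  have ikn : ∀ x y, IntegrableOn k (Ico x y) τ.rho.neg := fun x y =>
    (integrableOn_Ico (hwl τ.rho.neg) x y).neg.congr (EventuallyEq.symm (ae_restrict_of_ae kn))
  have hk : k =ᵐ[τ.rho.pos + τ.rho.neg] 0 := by
    refine ae_eq_zero_of_forall_Ico (locallyIntegrable_of_Ico fun x y => ?_) fun x y hxy => ?_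
    · exact (ikp x y).add_measure (ikn x y)
    · rw [Measure.restrict_add, integral_add_measure (ikp x y) (ikn x y),
        integral_congr_ae (ae_restrict_of_ae kp), integral_congr_ae (ae_restrict_of_ae kn)]
      simp only [Pi.neg_apply]
      rw [integral_neg, hinteg x y hxy, add_neg_cancel]
  have hkne : ∀ s, k s ≠ 0 := by
    intro s
    have : w s ≠ 0 := mul_ne_zero (hne s) ((map_ne_zero _).2 (hne s))
    by_cases hs : s ∈ A <;> simp [k, hs, this]
  have hfalse : ∀ᵐ s ∂(τ.rho.pos + τ.rho.neg), False := by
    filter_upwards [hk] with s hs using hkne s hs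
  have h0 : τ.rho.pos + τ.rho.neg = 0 := by
    rw [← Measure.measure_univ_eq_zero]
    simpa [ae_iff] using hfalse
  exact ⟨Measure.ext fun s _ => (add_eq_zero.1 (congrArg (fun μ => μ s) h0)).1,
    Measure.ext fun s _ => (add_eq_zero.1 (congrArg (fun μ => μ s) h0)).2⟩

theorem exists_leftEnergy_pos (hφ : τ.IsSolution z φ) (hφa : τ.H1Near atBot φ)
    (hne : ∀ x, φ x ≠ 0) : ∃ c, ∃ ε : ℝ, 0 < ε ∧ τ.leftEnergy φ c = ε := by
  obtain ⟨p, r, hpr⟩ := τ.exists_chi_Ico_ne_zero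
  refine ⟨r, _, ?_, leftEnergy_eq φ r⟩
  have p2 : 0 ≤ ∫ s in Iio r, ‖τ.quasiDeriv φ s‖ ^ 2 ∂τ.sigma := integral_nonneg fun s => sq_nonneg _
  have p1 : 0 ≤ ∫ s in Iio r, ‖φ s‖ ^ 2 ∂τ.chi := integral_nonneg fun s => sq_nonneg _
  refine add_pos_of_pos_of_nonneg (lt_of_le_of_ne p1 fun h0 => hpr ?_) p2
  have hae := ae_eq_zero_of_setIntegral_eq_zero (hφ.integrableOn_Iio hφa r).1 h0.symm
  have hfalse : ∀ᵐ s ∂τ.chi.restrict (Iio r), False := by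
    filter_upwards [hae] with s hs using hne s hs
  have : τ.chi (Iio r) = 0 := by
    have h := ae_iff.1 hfalse
    simpa using h
  exact measure_mono_null (fun s hs => hs.2) this

/-- If `ϱ` vanishes, then there is a solution of `(τ - z) u = 0` that lies in `H¹` near `b`. -/
theorem exists_h1Near_of_rho_eq_zero (hp : τ.rho.pos = 0) (hn : τ.rho.neg = 0)
    (hθ : τ.IsSolution z θ) (hφ : τ.IsSolution z φ) (hne : ∀ x, φ x ≠ 0) {ε : ℝ} (hε : 0 < ε)
    (hc : τ.quasiDeriv φ c * conj (φ c) = ε) : ∃ m : ℂ, τ.H1Near atTop (θ + m • φ) := by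
  have : Nonempty (Interval a b) := ⟨c⟩
  set θ' := τ.quasiDeriv θ
  set φ' := τ.quasiDeriv φ
  -- The boundary term of `θ + m φ`. Since `ϱ = 0`, its increments are exactly the energies,
  -- independently of `z`.
  set P : Interval a b → ℂ → ℂ := fun y m => (θ' y + m * φ' y) * conj (θ y + m * φ y)
  have hsol : ∀ m, τ.IsSolution z (θ + m • φ) := fun m => hθ.add_smul hφ m
  have hqd : ∀ m, τ.quasiDeriv (θ + m • φ) = θ' + m • φ' := fun m => hθ.quasiDeriv_add_smul hφ m
  have hPe : ∀ m x y, x ≤ y → P y m - P x m =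
      (((∫ s in Ico x y, ‖(θ + m • φ) s‖ ^ 2 ∂τ.chi) +
        ∫ s in Ico x y, ‖(θ' + m • φ') s‖ ^ 2 ∂τ.sigma : ℝ) : ℂ) := by
    intro m x y hxy
    have := (hsol m).mul_conj_sub hxy
    rw [hp, hn, hqd, setIntegral_mul_conj, setIntegral_mul_conj] at this
    simp only [Measure.restrict_zero, integral_zero_measure, sub_zero] at this
    push_cast
    exact this
  set En : Interval a b → ℂ → ℝ := fun y m => (P y m - P c m).re
  have hEn : ∀ m y, c ≤ y → En y m = (∫ s in Ico c y, ‖(θ + m • φ) s‖ ^ 2 ∂τ.chi) +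
        ∫ s in Ico c y, ‖(θ' + m • φ') s‖ ^ 2 ∂τ.sigma := by
    intro m y hy
    simp only [En]
    rw [hPe m c y hy, Complex.ofReal_re]
  have hEn0 : ∀ m y, c ≤ y → 0 ≤ En y m := fun m y hy => by
    rw [hEn m y hy]
    exact add_nonneg (integral_nonneg fun s => sq_nonneg _) (integral_nonneg fun s => sq_nonneg _)
  have hmono : ∀ m x y, x ≤ y → En x m ≤ En y m := by
    intro m x y hxy
    have h1 : En y m - En x m = (P y m - P x m).re := by simp only [En, Complex.sub_re]; ring
    rw [hPe m x y hxy, Complex.ofReal_re] at h1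
    have : 0 ≤ (∫ s in Ico x y, ‖(θ + m • φ) s‖ ^ 2 ∂τ.chi) +
        ∫ s in Ico x y, ‖(θ' + m • φ') s‖ ^ 2 ∂τ.sigma :=
      add_nonneg (integral_nonneg fun s => sq_nonneg _) (integral_nonneg fun s => sq_nonneg _)
    linarith
  set A : ℝ := ‖θ' c‖ * ‖θ c‖
  set B : ℝ := ‖φ' c‖ * ‖θ c‖ + ‖θ' c‖ * ‖φ c‖
  have hA : 0 ≤ A := by positivity
  have hB : 0 ≤ B := by positivity
  -- If `‖m‖ > K`, then `ε ‖m‖² > (A + B) ‖m‖ ≥ A + B ‖m‖`, the last step because `K ≥ 1`; this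
  -- makes the upper bound for `-Re P c m` negative.
  set K : ℝ := (A + B) / ε + 1
  have hK1 : 1 ≤ K := le_add_of_nonneg_left (by positivity)
  have hPc : ∀ m, -(P c m).re ≤ A + B * ‖m‖ - ε * ‖m‖ ^ 2 := by
    intro m
    have e : P c m = θ' c * conj (θ c) + (m * φ' c * conj (θ c) + conj m * θ' c * conj (φ c)) +
        ((ε * ‖m‖ ^ 2 : ℝ) : ℂ) := by
      have hm : m * conj m = ((‖m‖ ^ 2 : ℝ) : ℂ) := by
        rw [Complex.mul_conj, Complex.normSq_eq_norm_sq]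
      simp only [P, map_add, map_mul]
      rw [Complex.ofReal_mul, ← hm, ← hc]; ring
    rw [e, Complex.add_re, Complex.ofReal_re]
    have n1 := Complex.abs_re_le_norm (θ' c * conj (θ c) +
      (m * φ' c * conj (θ c) + conj m * θ' c * conj (φ c)))
    have n2 : ‖θ' c * conj (θ c) + (m * φ' c * conj (θ c) + conj m * θ' c * conj (φ c))‖ ≤
        A + B * ‖m‖ := by
      refine (norm_add_le _ _).trans ?_
      refine (add_le_add_right (norm_add_le _ _) _).trans ?_
      simp only [norm_mul, RCLike.norm_conj, A, B]
      apply le_of_eq; ring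
    have := neg_abs_le (θ' c * conj (θ c) +
      (m * φ' c * conj (θ c) + conj m * θ' c * conj (φ c))).re
    linarith
  -- For this `m` the solution vanishes at `y`, so its energy on `[c, y)` is `-Re P c m`.
  -- Nonnegativity of the energy then bounds `m` uniformly in `y`.
  have hbest : ∀ y, c ≤ y → ‖-θ y / φ y‖ ≤ K ∧ En y (-θ y / φ y) ≤ A + B * K := by
    intro y hy
    set m := -θ y / φ y
    have hPy : P y m = 0 := by
      have : θ y + m * φ y = 0 := by simp only [m]; field_simp [hne y]; ring
      simp only [P, this, map_zero, mul_zero]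
    have h1 : En y m = -(P c m).re := by simp only [En, hPy]; simp
    have h2 := hEn0 m y hy
    have h3 := hPc m
    have hmK : ‖m‖ ≤ K := by
      by_contra hcon
      push Not at hcon
      have h4 : A + B < ε * ‖m‖ := by
        have : (A + B) / ε < ‖m‖ := by simp only [K] at hcon; linarith
        rwa [div_lt_iff₀ hε, mul_comm] at this
      nlinarith
    refine ⟨hmK, ?_⟩
    have : B * ‖m‖ ≤ B * K := mul_le_mul_of_nonneg_left hmK hB
    nlinarith [sq_nonneg ‖m‖]
  have hcont : ∀ y, Continuous (En y) := by
    intro y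
    simp only [En, P]
    fun_prop
  -- These compact sets shrink as `y` grows and are nonempty, so some `m` lies in all of them; its
  -- energy stays bounded up to `b`.
  set C : Ici c → Set ℂ := fun y => Metric.closedBall 0 K ∩ {m | En y m ≤ A + B * K}
  have hclosed : ∀ y, IsClosed (C y) := fun y =>
    Metric.isClosed_closedBall.inter (isClosed_le (hcont y) continuous_const)
  have hne' : Nonempty (Ici c) := ⟨⟨c, mem_Ici.2 le_rfl⟩⟩
  obtain ⟨m, hm⟩ := IsCompact.nonempty_iInter_of_directed_nonempty_isCompact_isClosed C
    (by
      refine directed_of_isDirected_le fun x y hxy m hm => ⟨hm.1, ?_⟩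
      exact (hmono m x y hxy).trans hm.2)
    (fun y => ⟨-θ y / φ y, by simpa using (hbest y y.2).1, (hbest y y.2).2⟩)
    (fun y => (isCompact_closedBall 0 K).of_isClosed_subset (hclosed y) inter_subset_left) hclosed
  have hmb : ∀ y, c ≤ y → En y m ≤ A + B * K := fun y hy => (mem_iInter.1 hm ⟨y, hy⟩).2
  refine ⟨m, .of_hasRNDeriv (hsol m).isTau.1 (Ici_mem_atTop c) ?_ ?_⟩
  · rw [memLp_two_iff_integrable_sq_norm (hsol m).isTau.1.measurable.aestronglyMeasurable]
    refine integrableOn_Ici_of_bounded (C := A + B * K) (fun x y => ?_) (fun s => sq_nonneg _)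
      fun y hy => ?_
    · refine (integrableOn_Ico (hsol m).locallyIntegrable_chi x y).norm.congr
        (ae_of_all _ fun s => ?_)
      beta_reduce
      rw [norm_mul, RCLike.norm_conj, sq]
    · have h1 := hmb y hy
      rw [hEn m y hy] at h1
      have : 0 ≤ ∫ s in Ico c y, ‖(θ' + m • φ') s‖ ^ 2 ∂τ.sigma := integral_nonneg fun s => sq_nonneg _
      linarith
  · rw [memLp_two_iff_integrable_sq_norm (hsol m).isTau.measurable.aestronglyMeasurable]
    refine integrableOn_Ici_of_bounded (C := A + B * K) (fun x y => ?_) (fun s => sq_nonneg _)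
      fun y hy => ?_
    · refine (integrableOn_Ico (hsol m).locallyIntegrable_sigma x y).norm.congr
        (ae_of_all _ fun s => ?_)
      beta_reduce
      rw [norm_mul, RCLike.norm_conj, sq]
    · have h1 := hmb y hy
      rw [hEn m y hy] at h1
      rw [hqd]
      have : 0 ≤ ∫ s in Ico c y, ‖(θ + m • φ) s‖ ^ 2 ∂τ.chi := integral_nonneg fun s => sq_nonneg _
      linarith

/-- Existence of a Weyl solution at `b`. -/
theorem exists_weylValue (hva : τ.IsBoundary atBot va) (hvb : τ.IsBoundary atTop vb) (hz0 : z ≠ 0)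
    (hz : z ∈ τ.resolventSet (τ.sepRelation va vb)) (hθ : τ.IsSolution z θ)
    (hφ : τ.IsSolution z φ) (hφ0 : φ ≠ 0) (hφa : τ.InSNear atBot va (φ, z • φ))
    (hW : ∀ x, τ.V (θ, z • θ) (φ, z • φ) x = 1) :
    ∃ m : ℂ, τ.InSNear atTop vb (θ + m • φ, z • (θ + m • φ)) := by
  by_cases hlc : τ.LimitCircle atTop
  · exact exists_weylValue_of_limitCircle hlc hvb hz0 hz hθ hφ hφ0 hφa
  -- Either some resolvent function has a nonzero `θ`-component to the right of the support of `g`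
  -- and yields the Weyl solution, or the degenerate case with `ϱ = 0` occurs.
  by_cases hbad : ∀ d, ∀ g ∈ τ.H1, (∀ x ∈ Ici d, g x = 0) → ∀ f,
      (f, g + z • f) ∈ τ.sepRelation va vb → τ.V (f, g + z • f) (φ, z • φ) d = 0
  · have hE := quasiDeriv_mul_conj_eq_leftEnergy hva hz hφ hφa hbad
    have hne := ne_zero_of_eq_leftEnergy hφ hφa.1.2.1 hW hE
    obtain ⟨hp, hn⟩ := rho_eq_zero_of_eq_leftEnergy hz0 hφ hφa.1.2.1 hne hE
    obtain ⟨c, ε, hε, hc⟩ := exists_leftEnergy_pos hφ hφa.1.2.1 hne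
    obtain ⟨m, hm⟩ := exists_h1Near_of_rho_eq_zero hp hn hθ hφ hne hε ((hE c).trans hc)
    exact ⟨m, (inSNear_iff (Or.inr rfl) hvb).2
      ⟨(hθ.add_smul hφ m).tNear hm, fun h => absurd h hlc⟩⟩
  · push Not at hbad
    obtain ⟨d, g, -, hgd, f, hfS, hV⟩ := hbad
    obtain ⟨β, -, hβ⟩ := exists_coeff_of_inSNear hθ hφ hz0 hW (mem_sepRelation_iff.1 hfS).2.2
      (d := d) (fun x hx => by simp [hgd x hx])
    exact ⟨_, hβ hV⟩

/-- Otherwise, for fixed `y > d`, the solution `θ(y) φ - φ(y) θ` vanishes on `[d, b)` and so does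
its quasi-derivative at `y`, contradicting the Wronskian. This permits Cramer's rule with point
values alone, the quantities for which analyticity of the resolvent is available. -/
theorem exists_det_ne_zero {θ φ : Interval a b → ℂ} {z : ℂ} (hθ : τ.IsSolution z θ)
    (hφ : τ.IsSolution z φ) (hW : ∀ x, τ.V (θ, z • θ) (φ, z • φ) x = 1) (d : Interval a b) :
    ∃ x ∈ Ici d, ∃ y ∈ Ici d, θ x * φ y - θ y * φ x ≠ 0 := by
  by_contra! hcon
  obtain ⟨y, hy⟩ := exists_gt d
  have hκ := (hφ.isTau.smul (θ y)).add (hθ.isTau.smul (-φ y))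
  have h0 : EqOn (θ y • φ + -φ y • θ) 0 (Ici d) := by
    intro x hx
    have := hcon x hx y (mem_Ici.2 hy.le)
    simp only [Pi.add_apply, Pi.smul_apply, smul_eq_mul, Pi.zero_apply]
    linear_combination -this
  have hae := hκ.1.ae_eq_of_eqOn_Ici (HasRNDeriv.zero (μ := τ.sigma)) h0
  have hq := eq_zero_of_ae_eq_zero (τ := τ) hy (fun u h1 h2 h3 => hκ.tendsto_left h1 h2 h3)
    (ae_restrict_of_ae_restrict_of_subset (fun s hs => hs.1) hae)
  have h1 := hW y
  simp only [V, Pi.add_apply, Pi.smul_apply, smul_eq_mul] at hq h1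
  have : z * (θ y * τ.quasiDeriv φ y + -φ y * τ.quasiDeriv θ y) = 1 := by linear_combination h1
  rw [hq, mul_zero] at this
  exact zero_ne_one this

/-! ### Analyticity of `M`. -/

variable {θ φ : ℂ → Interval a b → ℂ}

/-- The singular Weyl-Titchmarsh function is analytic. -/
theorem analyticAt_weylFunction (hva : τ.IsBoundary atBot va) (hvb : τ.IsBoundary atTop vb)
    (hθφ : τ.IsFundamentalSystem va θ φ) {M : ℂ → ℂ}
    (hM : ∀ z ∈ τ.resolventSet (τ.sepRelation va vb) \ {0}, τ.IsWeylValue vb θ φ z (M z))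
    {z₀ : ℂ} (hz₀ : z₀ ∈ τ.resolventSet (τ.sepRelation va vb) \ {0}) : AnalyticAt ℂ M z₀ := by
  have hz₀0 : z₀ ≠ 0 := hz₀.2
  have hθ := hθφ.θ_analytic.1
  have hφ := hθφ.φ_analytic.1
  have hψ := (inSNearRight_iff hvb).1 (hM z₀ hz₀)
  have hψs := (hθ z₀ hz₀0).add_smul (hφ z₀ hz₀0) (M z₀)
  set ψ := θ z₀ + M z₀ • φ z₀ with hψdef
  obtain ⟨c⟩ := τ.nonempty_interval
  obtain ⟨d, hcd⟩ := exists_gt c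
  obtain ⟨h, e, hh, heb, hem, h1, e1, h2, e2, -⟩ := exists_interpolation
    (τ.sigma_Ico_ne_zero hcd) hcd (HasRNDeriv.zero (μ := τ.sigma)) (LocallyBdd.const 0)
    measurable_const hψs.isTau.1 hψs.isTau.locallyBdd hψs.isTau.measurable
  have hhH : h ∈ τ.H1 := mem_H1_of_near_ends hh heb hem
    (h1Near_atBot_of_eqOn hh HasRNDeriv.zero .zero h1 e1)
    (h1Near_atTop_of_eqOn hh hψs.isTau.1 hψ.1.2.1 h2 e2)
  obtain ⟨w, hwan, hw⟩ := exists_analyticAt_resolvent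
    (fun F hF G hG => add_mem_sepRelation hF hG) (fun r F hF => smul_mem_sepRelation r hF)
    hz₀.1 hhH
  obtain ⟨x, hx, y, hy, hdet⟩ := exists_det_ne_zero (hθ z₀ hz₀0) (hφ z₀ hz₀0)
    (hθφ.wronskian z₀ hz₀0) d
  -- With `w z = (S - z)⁻¹ h` and `h = ψ` to the right of `d`, the second component there is `z₀ ψ +
  -- (z - z₀)(ψ + z w z) = z u z`, so `u z` continues `ψ` to nearby spectral parameters.
  let u : ℂ → Interval a b → ℂ := fun z t => ψ t + (z - z₀) * w z t
  have huan : ∀ t, AnalyticAt ℂ (fun z => u z t) z₀ := fun t =>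
    analyticAt_const.add ((analyticAt_id.sub analyticAt_const).mul (hwan t))
  have hθan : ∀ t, AnalyticAt ℂ (fun z => θ z t) z₀ := fun t =>
    (hθφ.θ_analytic.2 t).1.1 z₀ hz₀0
  have hφan : ∀ t, AnalyticAt ℂ (fun z => φ z t) z₀ := fun t =>
    (hθφ.φ_analytic.2 t).1.1 z₀ hz₀0
  -- If `u z = α θ z + β φ z` at `x` and `y`, then `den` and `num` are `α` and `β` times the same
  -- determinant, so their quotient is `β/α`.
  let den : ℂ → ℂ := fun z => u z x * φ z y - u z y * φ z x
  let num : ℂ → ℂ := fun z => θ z x * u z y - θ z y * u z x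
  have hden : AnalyticAt ℂ den z₀ := ((huan x).mul (hφan y)).sub ((huan y).mul (hφan x))
  have hnum : AnalyticAt ℂ num z₀ := ((hθan x).mul (huan y)).sub ((hθan y).mul (huan x))
  have hden0 : den z₀ ≠ 0 := by
    have : den z₀ = θ z₀ x * φ z₀ y - θ z₀ y * φ z₀ x := by
      simp only [den, u, sub_self, zero_mul, add_zero, hψdef, Pi.add_apply, Pi.smul_apply,
        smul_eq_mul]
      ring
    rwa [this]
  refine (hnum.div hden hden0).congr ?_
  filter_upwards [hw, hden.continuousAt.eventually_ne hden0, eventually_ne_nhds hz₀0]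
    with z ⟨hzS, _, hwS⟩ hdz hz0
  have hU := hψ.add (((mem_sepRelation_iff.1 hwS).2.2).smul (z - z₀))
  obtain ⟨β, hβ, hβS⟩ := exists_coeff_of_inSNear (hθ z hz0) (hφ z hz0) hz0 (hθφ.wronskian z hz0)
    hU (d := d) (fun t ht => by
      have := h2 ht
      simp only [Prod.fst_add, Prod.snd_add, Prod.smul_fst, Prod.smul_snd, Pi.add_apply,
        Pi.smul_apply, smul_eq_mul, this]
      ring)
  set α := τ.V ((ψ, z₀ • ψ) + (z - z₀) • (w z, h + z • w z)) (φ z, z • φ z) d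
  have hux : u z x = α * θ z x + β * φ z x := hβ x hx
  have huy : u z y = α * θ z y + β * φ z y := hβ y hy
  have hdenα : den z = α * (θ z x * φ z y - θ z y * φ z x) := by
    simp only [den, hux, huy]; ring
  have hnumβ : num z = β * (θ z x * φ z y - θ z y * φ z x) := by
    simp only [num, hux, huy]; ring
  have hα : α ≠ 0 := fun h0 => hdz (by rw [hdenα, h0, zero_mul])
  have hD : θ z x * φ z y - θ z y * φ z x ≠ 0 := fun h0 => hdz (by rw [hdenα, h0, mul_zero])
  have hφa := (inSNearLeft_iff hva).1 (hθφ.φ_left z hz0)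
  have := weylValue_unique (hθφ.φ_ne_zero z hz0) (hφ z hz0) hzS hφa (hβS hα)
    ((inSNearRight_iff hvb).1 (hM z ⟨hzS, hz0⟩))
  rw [Pi.div_apply, hnumβ, hdenα, mul_div_mul_right _ _ hD, this]

end Coefficients

end LeftDefinite

end

/-! ### Conclusion: existence, uniqueness, analyticity and symmetry. -/

open LeftDefinite.Coefficients in
theorem mainTheorem10 {a b : EReal} (τ : LeftDefinite.Coefficients a b)
    (va vb : (LeftDefinite.Interval a b → ℂ) × (LeftDefinite.Interval a b → ℂ))
    (hva : τ.IsBoundaryLeft va) (hvb : τ.IsBoundaryRight vb)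
    (θ φ : ℂ → LeftDefinite.Interval a b → ℂ) (hθφ : τ.IsFundamentalSystem va θ φ) :
    (∀ z ∈ τ.resolventSet (τ.sepRelation va vb) \ {0}, ∃! m : ℂ, τ.IsWeylValue vb θ φ z m) ∧
    ∀ M : ℂ → ℂ,
      (∀ z ∈ τ.resolventSet (τ.sepRelation va vb) \ {0}, τ.IsWeylValue vb θ φ z (M z)) →
      AnalyticOnNhd ℂ M (τ.resolventSet (τ.sepRelation va vb) \ {0}) ∧
      ∀ z ∈ τ.resolventSet (τ.sepRelation va vb) \ {0},
        conj z ∈ τ.resolventSet (τ.sepRelation va vb) \ {0} ∧ M z = conj (M (conj z)) := by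
  have ha := hva.isBoundary
  have hb := hvb.isBoundary
  have hφa : ∀ z, z ≠ 0 → τ.InSNear atBot va (φ z, z • φ z) := fun z hz =>
    (inSNearLeft_iff ha).1 (hθφ.φ_left z hz)
  have huniq : ∀ z ∈ τ.resolventSet (τ.sepRelation va vb) \ {0}, ∀ m m',
      τ.InSNear atTop vb (θ z + m • φ z, z • (θ z + m • φ z)) →
      τ.InSNear atTop vb (θ z + m' • φ z, z • (θ z + m' • φ z)) → m = m' := fun z hz m m' h1 h2 =>
    weylValue_unique (hθφ.φ_ne_zero z hz.2) (hθφ.φ_analytic.1 z hz.2) hz.1 (hφa z hz.2) h1 h2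
  refine ⟨fun z hz => ?_, fun M hM => ⟨fun z hz => analyticAt_weylFunction ha hb hθφ hM hz,
    fun z hz => ?_⟩⟩
  · obtain ⟨m, hm⟩ := exists_weylValue ha hb hz.2 hz.1 (hθφ.θ_analytic.1 z hz.2)
      (hθφ.φ_analytic.1 z hz.2) (hθφ.φ_ne_zero z hz.2) (hφa z hz.2) (hθφ.wronskian z hz.2)
    exact ⟨m, (inSNearRight_iff hb).2 hm, fun m' hm' =>
      huniq z hz _ _ ((inSNearRight_iff hb).1 hm') hm⟩
  · have hz0 : z ≠ 0 := hz.2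
    have hcz : conj z ∈ τ.resolventSet (τ.sepRelation va vb) \ {0} :=
      ⟨conj_mem_resolventSet ha hb hz.1, by simpa using hz0⟩
    refine ⟨hcz, huniq z hz _ _ ((inSNearRight_iff hb).1 (hM z hz)) ?_⟩
    -- The conjugate of the Weyl solution at `z^*` lies in `S` near `b`, and by reality of the
    -- fundamental system it equals `θ z + conj (M (conj z)) • φ z`.
    have h1 := ((inSNearRight_iff hb).1 (hM _ hcz)).star (Or.inr rfl) hb
    have hθc : ∀ x, θ (conj z) x = conj (θ z x) := fun x => (hθφ.θ_analytic.2 x).1.2.2 z hz0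
    have hφc : ∀ x, φ (conj z) x = conj (φ z x) := fun x => (hθφ.φ_analytic.2 x).1.2.2 z hz0
    convert h1 using 1
    refine Prod.ext ?_ ?_ <;> ext x <;> simp [hθc, hφc, mul_add]
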